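/- **Setting.** Let $H:\{0,1\}^*\to\{0,1\}^\ell$ be a public hash function, with a fixed digest $\bullet\in\{0,1\}^\ell$ for missing children, and let $x_1,x_2,\dots$ be bit strings that are appended one at a time to a list; $X_n=(x_1,\dots,x_n)$. In a rooted binary tree, the leaf of $x_i$ has the value $H(x_i)$ and every other node has the value $H(a\|b)$, where $a,b$ are the values of its two children. A *mountain* of height $s$ is a perfect tree with $2^s$ leaves. The *Merkle Mountain Belt* (MMB) of $X_n$ is built as follows. Start from the empty list of mountains. Each append adds the new leaf as a mountain of height $0$ at the right end of the list, and then, if there are consecutive mountains of the same height, merges the rightmost such pair into one mountain, in place. Split the list of mountains into *ranges*: consecutive mountains $(M,M')$ are in different ranges if and only if their height difference is $2$ or $M$ has the same height as the mountain to its left. In each range, chain the peaks by bagging nodes from left to right (a bagging node has the previous bagging node, or $\bullet$ for the first one, as left child, and the next peak as right child); then chain the resulting range roots in the same way. The commitment $\langle X_n\rangle\in\{0,1\}^\ell$ is the value of the final root. A *membership proof* of $x_i\in X_n$ consists of the values of the siblings of the leaf of $x_i$ and of its ancestors; it is valid if the root computed from $H(x_i)$ and these values, along the path of the $i$-th of $n$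 leaves, is the commitment. An *increment proof* for $X_m\prec X_n$ consists of the values of an independent set $C_n$ of nodes of the MMB of $X_n$ that covers all of its leaves and contains a set $C_m$ of nodes of the MMB of $X_m$ that covers all leaves of that one; it is valid if both $\langle X_m\rangle$ and $\langle X_n\rangle$ are derived from it by hashing. Running times are measured on a word RAM with words of $O(\log n)$ bits and memory cells for digests, where computing $H(a\|b)$ from digests $a,b$, receiving a digest and publishing a digest are single instructions; the hash of an item is part of the input. The CCC (communication and computational complexity) of an operation bounds both the number of digests received in an honest message and the number of steps taken on any message. **Theorem.** There are fixed programs for the manager and the participants, a choice of the node sets of the increment proofs, and an absolute constant $c$, which do not depend on $\ell$, $H$ or the items, such that the MMB is a commitment scheme with the following properties. 1. *Correctness.* The leaves of the MMB are $x_1,\dots,x_n$ in this order, and honestly generated membership proofs ($1\le i\le n$), updated membership proofs and increment proofs ($1\le m<n$) are valid. 2. *Soundness.* Two valid membership proofs, against the same commitment and for the same $n$ and $i$, of different items exhibit a collision of $H$ among the strings hashed in their verification. A valid increment proof from $\langle X_m\rangle$ to $\langle Y_n\rangle$, where $X_m$ is not a prefix of $Y_n$, exhibits a collision of $H$ among the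 strings hashed in its verification and in the MMBs of $X_m$ and $Y_n$. 3. *Succinctness.* Retrieving the current commitment, retrieving and verifying any membership proof, and retrieving and verifying any increment proof have a CCC polylogarithmic in $n$. 4. *Incrementality.* For a participant who resynchronizes from $X_m$ to $X_n$, $k=n-m\ge 1$, each of the following has a CCC that depends only on $k$, namely at most $c(\lfloor\log_2 k\rfloor+1)=O(\log k)$: updating the commitment; retrieving and verifying the increment proof (for $m\ge1$); retrieving and verifying a new membership proof of $x_i$, $m<i\le n$; updating and verifying an old membership proof of $x_i$, $1\le i\le m$, where an accepted proof is stored and can be updated again after later increments. A program accepts a message exactly if the (updated) proof is valid. The participant uses $O(\log n)$ memory cells. 5. *Optimal additivity.* Starting from the empty list, the manager performs each append, computes the new commitment and publishes the values of all new nodes in $O(1)$ time, with $O(\log n)$ memory cells. 6. *Commitment size.* The commitment is one digest of $\ell$ bits, independently of $n$. -/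

import Mathlib

namespace MMB

/-! ### Hashing and Merkle trees -/

/-- Hash values: bit strings of a fixed length `ℓ`. -/
abbrev Digest (ℓ : ℕ) := List.Vector Bool ℓ

/-- A public hash function on bit strings, and the default hash value of a missing child. -/
structure Hashing (ℓ : ℕ) where
  H : List Bool → Digest ℓ
  dflt : Digest ℓ

/-- The string that is hashed at a non-leaf node: the concatenation of the two children. -/
def cat {ℓ : ℕ} (a b : Digest ℓ) : List Bool := a.toList ++ b.toList

/-- Rooted binary trees whose leaves stand for the items `x₁, x₂, …` (by index); `empty` is a
missing child. -/
inductive MTree where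
  | empty : MTree
  | leaf : ℕ → MTree
  | node : MTree → MTree → MTree
  deriving DecidableEq

namespace MTree

/-- Indices of the leaves, from left to right. -/
def leaves : MTree → List ℕ
  | empty => []
  | leaf i => [i]
  | node l r => leaves l ++ leaves r

/-- All nodes (each node is identified with the subtree below it), children before parents;
missing children are not nodes. -/
def nodes : MTree → List MTree
  | empty => []
  | leaf i => [leaf i]
  | node l r => nodes l ++ nodes r ++ [node l r]

/-- The hash value of a node, when `x i` is the `i`-th item. -/
def hash {ℓ : ℕ} (A : Hashing ℓ) (x : ℕ → List Bool) : MTree → Digest ℓ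
  | empty => A.dflt
  | leaf i => A.H (x i)
  | node l r => A.H (cat (hash A x l) (hash A x r))

/-- All strings that are hashed in order to compute the hash values of a tree. -/
def inputs {ℓ : ℕ} (A : Hashing ℓ) (x : ℕ → List Bool) : MTree → List (List Bool)
  | empty => []
  | leaf i => [x i]
  | node l r => inputs A x l ++ inputs A x r ++ [cat (hash A x l) (hash A x r)]

/-- The siblings of the leaf `i` and of its ancestors, from the leaf upwards, with their handedness
(`true` for a left sibling). -/
def siblings (i : ℕ) : MTree → List (Bool × MTree)
  | empty => []
  | leaf _ => []
  | node l r => if i ∈ l.leaves then siblings i l ++ [(false, r)] else siblings i r ++ [(true, l)]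

end MTree

/-! ### The Merkle Mountain Belt -/

/-- A mountain: a (perfect) tree with its height. -/
structure Mountain where
  height : ℕ
  tree : MTree

/-- Merge the rightmost pair of consecutive mountains of equal height, if there is one. The list is
read from right to left. -/
def mergeStep : List Mountain → List Mountain
  | M' :: M :: rest =>
      if M.height = M'.height then ⟨M.height + 1, .node M.tree M'.tree⟩ :: rest
      else M' :: mergeStep (M :: rest)
  | L => L

/-- The mountains after `n` appends, from right to left: each append adds the new leaf as a
mountain of height `0` at the right end, and then performs at most one merge. -/
def mountainsRL : ℕ → List Mountain
  | 0 => []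
  | n + 1 => mergeStep (⟨0, .leaf (n + 1)⟩ :: mountainsRL n)

/-- The mountains after `n` appends, from left to right. -/
def mountains (n : ℕ) : List Mountain := (mountainsRL n).reverse

/-- Split a list of mountains (from left to right) into ranges: consecutive mountains `M`, `M'` are
in different ranges iff their height difference is `2`, or `M` and the mountain to its left have
equal heights. The first argument is the mountain to the left of the list, if any. -/
def splitRanges : Option Mountain → List Mountain → List (List Mountain)
  | _, [] => []
  | _, [M] => [[M]]
  | left, M :: M' :: rest =>
      if M.height = M'.height + 2 ∨ left.map Mountain.height = some M.height then
        [M] :: splitRanges (some M) (M' :: rest)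
      else
        match splitRanges (some M) (M' :: rest) with
        | [] => [[M]]
        | R :: Rs => (M :: R) :: Rs

/-- Forward bagging: one bagging node for each tree in the list, chained from left to right; the
first one has no left child. -/
def bag (ts : List MTree) : MTree := ts.foldl MTree.node MTree.empty

/-- The Merkle Mountain Belt for `n` items: bag the peaks of each range, then bag the ranges. -/
def mmb (n : ℕ) : MTree :=
  bag ((splitRanges none (mountains n)).map fun R => bag (R.map Mountain.tree))

/-- The nodes that the `n`-th append creates. -/
def newNodes (n : ℕ) : List MTree := (mmb n).nodes.filter fun t => t ∉ (mmb (n - 1)).nodes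

/-- The public commitment to `(x₁, …, xₙ)`: the hash of the root. -/
def commitment {ℓ : ℕ} (A : Hashing ℓ) (x : ℕ → List Bool) (n : ℕ) : Digest ℓ := (mmb n).hash A x

/-! ### Collisions -/

/-- A collision of the hash function between a string of the first and one of the second list. -/
def Collides {ℓ : ℕ} (A : Hashing ℓ) (S T : List (List Bool)) : Prop :=
  ∃ a ∈ S, ∃ b ∈ T, a ≠ b ∧ A.H a = A.H b

/-! ### Membership proofs -/

/-- The shape of a membership proof of item `i` among `n`: the siblings with their handedness. -/
def path (n i : ℕ) : List (Bool × MTree) := (mmb n).siblings i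

/-- The membership proof of `xᵢ`: the hashes of the siblings. The handedness depends only on `n`
and `i`, and the verifier has to check the proof for these two numbers. -/
def memProof {ℓ : ℕ} (A : Hashing ℓ) (x : ℕ → List Bool) (n i : ℕ) : List (Digest ℓ) :=
  (path n i).map fun p => p.2.hash A x

/-- The string that is hashed for the parent of a node of hash `a`, given the sibling. -/
def joinStr {ℓ : ℕ} (a : Digest ℓ) (p : Bool × Digest ℓ) : List Bool :=
  if p.1 then cat p.2 a else cat a p.2

/-- The hash of the topmost ancestor, computed from the hash `a` of a node and the siblings. -/
def climb {ℓ : ℕ} (A : Hashing ℓ) : Digest ℓ → List (Bool × Digest ℓ) → Digest ℓ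
  | a, [] => a
  | a, p :: ps => climb A (A.H (joinStr a p)) ps

/-- The strings that are hashed in `climb`. -/
def climbInputs {ℓ : ℕ} (A : Hashing ℓ) : Digest ℓ → List (Bool × Digest ℓ) → List (List Bool)
  | _, [] => []
  | a, p :: ps => joinStr a p :: climbInputs A (A.H (joinStr a p)) ps

/-- The hashes of a proof, together with the handedness for the leaf `i` among `n`. -/
def oriented {ℓ : ℕ} (n i : ℕ) (π : List (Digest ℓ)) : List (Bool × Digest ℓ) :=
  ((path n i).map Prod.fst).zip π

/-- `π` is a valid proof, against the commitment `c`, that the `i`-th of `n` leaves has hash `h`. -/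
def MemValid {ℓ : ℕ} (A : Hashing ℓ) (n i : ℕ) (h : Digest ℓ) (π : List (Digest ℓ))
    (c : Digest ℓ) : Prop :=
  π.length = (path n i).length ∧ climb A h (oriented n i π) = c

/-- All strings hashed in the verification of a membership proof for the item `y`. -/
def memTranscript {ℓ : ℕ} (A : Hashing ℓ) (n i : ℕ) (y : List Bool) (π : List (Digest ℓ)) :
    List (List Bool) :=
  y :: climbInputs A (A.H y) (oriented n i π)

/-! ### Increment proofs -/

/-- The members of a node set all of whose leaves are among the first `m`. -/
def oldPart (m : ℕ) (C : List MTree) : List MTree := C.filter fun t => ∀ i ∈ t.leaves, i ≤ m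

/-- `C` (listed from left to right) is an independent set of nodes of the structure for `n` items
that covers its leaves, and it contains an independent set of nodes of the structure for `m` items
that covers the leaves of that one. -/
structure IsIncrementCover (m n : ℕ) (C : List MTree) : Prop where
  sub_new : ∀ t ∈ C, t ∈ (mmb n).nodes
  covers_new : C.flatMap MTree.leaves = List.range' 1 n
  sub_old : ∀ t ∈ oldPart m C, t ∈ (mmb m).nodes
  covers_old : (oldPart m C).flatMap MTree.leaves = List.range' 1 m

/-- The hash of a tree derived by closing steps from the hashes `π` of the nodes `C`. -/
def derive {ℓ : ℕ} (A : Hashing ℓ) (C : List MTree) (π : List (Digest ℓ)) : MTree → Digest ℓ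
  | .empty => A.dflt
  | .leaf i => ((C.zip π).lookup (.leaf i)).getD A.dflt
  | .node l r =>
      ((C.zip π).lookup (.node l r)).getD (A.H (cat (derive A C π l) (derive A C π r)))

/-- The strings that are hashed in `derive`. -/
def deriveInputs {ℓ : ℕ} (A : Hashing ℓ) (C : List MTree) (π : List (Digest ℓ)) :
    MTree → List (List Bool)
  | .empty => []
  | .leaf _ => []
  | .node l r =>
      if .node l r ∈ C then []
      else deriveInputs A C π l ++ deriveInputs A C π r ++ [cat (derive A C π l) (derive A C π r)]

/-- The hashes `π` of the nodes `C` form a valid increment proof from the commitment `c` for `m`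
items to the commitment `c'` for `n` items: both roots can be derived from them. -/
def IncValid {ℓ : ℕ} (A : Hashing ℓ) (C : List MTree) (m n : ℕ) (c c' : Digest ℓ)
    (π : List (Digest ℓ)) : Prop :=
  π.length = C.length ∧ derive A C π (mmb m) = c ∧ derive A C π (mmb n) = c'

/-- All strings hashed in the verification of an increment proof, and in the two structures. -/
def incTranscript {ℓ : ℕ} (A : Hashing ℓ) (C : List MTree) (m n : ℕ) (x y : ℕ → List Bool)
    (π : List (Digest ℓ)) : List (List Bool) :=
  deriveInputs A C π (mmb m) ++ deriveInputs A C π (mmb n) ++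
    (mmb m).inputs A x ++ (mmb n).inputs A y

/-! ### A word RAM with a hash instruction

The memory has cells for words (natural numbers below a bound) and cells for hash values. A run gets
stuck if an address or a word is out of bounds. Every instruction, also the hash of two hash values,
costs one step for itself and one for each node of its expressions. -/

inductive Op where
  | add | sub | mul | div | mod | and | or | xor | shl | shr | lt | eq

def Op.apply : Op → ℕ → ℕ → ℕ
  | .add, a, b => a + b
  | .sub, a, b => a - b
  | .mul, a, b => a * b
  | .div, a, b => a / b
  | .mod, a, b => a % b
  | .and, a, b => a &&& b
  | .or, a, b => a ||| b
  | .xor, a, b => a ^^^ b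
  | .shl, a, b => a <<< b
  | .shr, a, b => a >>> b
  | .lt, a, b => if a < b then 1 else 0
  | .eq, a, b => if a = b then 1 else 0

/-- Word expressions: constants, the word cell with a given address, arithmetic, the binary
logarithm (rounded down), and the test whether two hash cells hold the same value. -/
inductive Expr where
  | const : ℕ → Expr
  | cell : Expr → Expr
  | op : Op → Expr → Expr → Expr
  | log2 : Expr → Expr
  | sameHash : Expr → Expr → Expr

def Expr.size : Expr → ℕ
  | .const _ => 1
  | .cell a => a.size + 1
  | .op _ a b => a.size + b.size + 1
  | .log2 a => a.size + 1
  | .sameHash a b => a.size + b.size + 1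

/-- Programs. The address arguments of hash instructions are expressions. -/
inductive Cmd where
  /-- write a word -/
  | set : (addr val : Expr) → Cmd
  /-- copy a hash value -/
  | copy : (dst src : Expr) → Cmd
  /-- write the default hash value -/
  | null : (dst : Expr) → Cmd
  /-- write the hash of the concatenation of two hash values -/
  | hash : (dst left right : Expr) → Cmd
  /-- receive the next hash value of the incoming message, and write `1` to the word cell `ok`;
  write `0` to it if the message is exhausted -/
  | recv : (dst ok : Expr) → Cmd
  /-- publish a hash value on the bulletin board -/
  | emit : (src : Expr) → Cmd
  | seq : Cmd → Cmd → Cmd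
  | ite : Expr → Cmd → Cmd → Cmd
  | loop : Expr → Cmd → Cmd

/-- States of the machine. -/
structure St (ℓ : ℕ) where
  words : ℕ → ℕ
  digs : ℕ → Digest ℓ
  inbox : List (Digest ℓ)
  outbox : List (Digest ℓ)

/-- The hash function, the number of cells (of each kind), and the bound on the words. -/
structure Env (ℓ : ℕ) where
  A : Hashing ℓ
  space : ℕ
  bound : ℕ

/-- `Eval E s e v`: the expression `e` has the value `v`, with no value out of bounds. -/
inductive Eval {ℓ : ℕ} (E : Env ℓ) (s : St ℓ) : Expr → ℕ → Prop
  | const {v : ℕ} : v < E.bound → Eval E s (.const v) v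
  | cell {a : Expr} {p : ℕ} : Eval E s a p → p < E.space → s.words p < E.bound →
      Eval E s (.cell a) (s.words p)
  | op {o : Op} {a b : Expr} {u v : ℕ} : Eval E s a u → Eval E s b v → o.apply u v < E.bound →
      Eval E s (.op o a b) (o.apply u v)
  | log2 {a : Expr} {u : ℕ} : Eval E s a u → Eval E s (.log2 a) (Nat.log 2 u)
  | same {a b : Expr} {p q : ℕ} : Eval E s a p → Eval E s b q → p < E.space → q < E.space →
      s.digs p = s.digs q → 1 < E.bound → Eval E s (.sameHash a b) 1
  | differ {a b : Expr} {p q : ℕ} : Eval E s a p → Eval E s b q → p < E.space → q < E.space →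
      s.digs p ≠ s.digs q → 1 < E.bound → Eval E s (.sameHash a b) 0

/-- The value of an address expression, which has to be the address of an existing cell. -/
def Addr {ℓ : ℕ} (E : Env ℓ) (s : St ℓ) (e : Expr) (p : ℕ) : Prop := Eval E s e p ∧ p < E.space

def St.setWord {ℓ : ℕ} (s : St ℓ) (p v : ℕ) : St ℓ := { s with words := Function.update s.words p v }

def St.setDig {ℓ : ℕ} (s : St ℓ) (p : ℕ) (d : Digest ℓ) : St ℓ :=
  { s with digs := Function.update s.digs p d }

/-- `Exec E P s t s'`: started in the state `s`, the program `P` halts after `t` steps in `s'`. -/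
inductive Exec {ℓ : ℕ} (E : Env ℓ) : Cmd → St ℓ → ℕ → St ℓ → Prop
  | set {s : St ℓ} {a e : Expr} {p v : ℕ} : Addr E s a p → Eval E s e v →
      Exec E (.set a e) s (1 + a.size + e.size) (s.setWord p v)
  | copy {s : St ℓ} {a b : Expr} {p q : ℕ} : Addr E s a p → Addr E s b q →
      Exec E (.copy a b) s (1 + a.size + b.size) (s.setDig p (s.digs q))
  | null {s : St ℓ} {a : Expr} {p : ℕ} : Addr E s a p →
      Exec E (.null a) s (1 + a.size) (s.setDig p E.A.dflt)
  | hash {s : St ℓ} {a b c : Expr} {p q r : ℕ} : Addr E s a p → Addr E s b q → Addr E s c r →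
      Exec E (.hash a b c) s (1 + a.size + b.size + c.size)
        (s.setDig p (E.A.H (cat (s.digs q) (s.digs r))))
  | recv {s : St ℓ} {a b : Expr} {p q : ℕ} {d : Digest ℓ} {ds : List (Digest ℓ)} :
      Addr E s a p → Addr E s b q → 1 < E.bound → s.inbox = d :: ds →
      Exec E (.recv a b) s (1 + a.size + b.size)
        { (s.setDig p d).setWord q 1 with inbox := ds }
  | recvNone {s : St ℓ} {a b : Expr} {p q : ℕ} :
      Addr E s a p → Addr E s b q → 1 < E.bound → s.inbox = [] →
      Exec E (.recv a b) s (1 + a.size + b.size) (s.setWord q 0)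
  | emit {s : St ℓ} {a : Expr} {p : ℕ} : Addr E s a p →
      Exec E (.emit a) s (1 + a.size) { s with outbox := s.outbox ++ [s.digs p] }
  | seq {s s' s'' : St ℓ} {P Q : Cmd} {t u : ℕ} : Exec E P s t s' → Exec E Q s' u s'' →
      Exec E (.seq P Q) s (t + u) s''
  | iteTrue {s s' : St ℓ} {e : Expr} {P Q : Cmd} {v t : ℕ} : Eval E s e v → v ≠ 0 →
      Exec E P s t s' → Exec E (.ite e P Q) s (1 + e.size + t) s'
  | iteFalse {s s' : St ℓ} {e : Expr} {P Q : Cmd} {t : ℕ} : Eval E s e 0 →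
      Exec E Q s t s' → Exec E (.ite e P Q) s (1 + e.size + t) s'
  | loopTrue {s s' s'' : St ℓ} {e : Expr} {P : Cmd} {v t u : ℕ} : Eval E s e v → v ≠ 0 →
      Exec E P s t s' → Exec E (.loop e P) s' u s'' →
      Exec E (.loop e P) s (1 + e.size + t + u) s''
  | loopFalse {s : St ℓ} {e : Expr} {P : Cmd} : Eval E s e 0 →
      Exec E (.loop e P) s (1 + e.size) s

/-- The program halts within `T` steps, in a state with the property `Q`. -/
def RunsIn {ℓ : ℕ} (E : Env ℓ) (P : Cmd) (s : St ℓ) (T : ℕ) (Q : St ℓ → Prop) : Prop :=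
  ∃ t s', Exec E P s t s' ∧ t ≤ T ∧ Q s'

/-- The order of magnitude of a logarithm, also for the argument `1`. -/
def lg (k : ℕ) : ℕ := Nat.log 2 k + 1

/-- The machine for a list of `n` items: `O(log n)` cells for words of `O(log n)` bits and as many
cells for hash values. -/
def env {ℓ : ℕ} (A : Hashing ℓ) (c n : ℕ) : Env ℓ := ⟨A, c * lg n, (n + 2) ^ c⟩

/-! ### The operations of the scheme -/

/-- The programs of the manager and of the participants, which depend on nothing, the nodes whose
hashes form an increment proof, and the number of hashes of an old membership proof that are kept
in an update from `m` to `n`. -/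
structure Protocol where
  append : Cmd
  fetch : Cmd
  verifyMem : Cmd
  verifyInc : Cmd
  updateMem : Cmd
  cover : (m n : ℕ) → List MTree
  keep : (m n i : ℕ) → ℕ

/-- The initial state of the manager. -/
def St.init {ℓ : ℕ} (A : Hashing ℓ) : St ℓ := ⟨fun _ => 0, fun _ => A.dflt, [], []⟩

/-- The state in which the manager starts an append: the hash of the new leaf has arrived. -/
def St.next {ℓ : ℕ} (s : St ℓ) (h : Digest ℓ) : St ℓ := { s with inbox := [h], outbox := [] }

/-- Appends. The manager starts with an empty list and appends `x₁, x₂, …`. The `n`-th append takes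
at most `T n` steps, leaves the commitment to `(x₁, …, xₙ)` in the hash cell `0`, and publishes the
hashes of all new nodes. -/
def Appends {ℓ : ℕ} (A : Hashing ℓ) (P : Protocol) (c : ℕ) (T : ℕ → ℕ) : Prop :=
  ∀ x : ℕ → List Bool, ∃ s : ℕ → St ℓ, s 0 = St.init A ∧ ∀ n, ∃ t ≤ T (n + 1),
    Exec (env A c (n + 1)) P.append ((s n).next (A.H (x (n + 1)))) t (s (n + 1)) ∧
    (s (n + 1)).digs 0 = commitment A x (n + 1) ∧
    (s (n + 1)).outbox = (newNodes (n + 1)).map (MTree.hash A x)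

/-- The state in which a participant starts an operation at list size `n`: this size is in the word
cell `2`, the current commitment `d` in the hash cell `1`, and the message `μ` has been requested.
The word cell `0` is for the result (`1`: accepted). -/
def St.load {ℓ : ℕ} (s : St ℓ) (n : ℕ) (d : Digest ℓ) (μ : List (Digest ℓ)) : St ℓ where
  words := Function.update (Function.update s.words 0 0) 2 n
  digs := Function.update s.digs 1 d
  inbox := μ
  outbox := []

/-- Retrieving the current commitment from the bulletin board, in any state. -/
def FetchesCommitment {ℓ : ℕ} (A : Hashing ℓ) (P : Protocol) (c : ℕ) (cc : ℕ → ℕ → ℕ) : Prop :=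
  ∀ (x : ℕ → List Bool) (m n : ℕ), m < n → 1 ≤ cc m n ∧
    ∀ s : St ℓ, s.words 2 = n → s.inbox = [commitment A x n] →
      RunsIn (env A c n) P.fetch s (cc m n) fun s' =>
        s'.digs = Function.update s.digs 1 (commitment A x n) ∧
        s'.words = Function.update s.words 0 1

/-- Retrieving and verifying the increment proof from `m` to `n` items, by a participant with the
numbers `m` and `n` in the word cells `1` and `2` and the commitments in the hash cells `0` and `1`,
who is sent any message `π`. -/
def VerifiesIncrement {ℓ : ℕ} (A : Hashing ℓ) (P : Protocol) (c : ℕ) (cc : ℕ → ℕ → ℕ) : Prop :=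
  ∀ m n, 1 ≤ m → m < n → (P.cover m n).length ≤ cc m n ∧
    ∀ (d d' : Digest ℓ) (π : List (Digest ℓ)) (s : St ℓ), s.words 1 = m → s.digs 0 = d →
      RunsIn (env A c n) P.verifyInc (s.load n d' π) (cc m n) fun s' =>
        s'.words 0 = 1 ↔ IncValid A (P.cover m n) m n d d' π

/-- Retrieving and verifying the membership proof of an item `m < i ≤ n`, by a participant with `n`
and `i` in the word cells `2` and `3` and the hash of the item in the hash cell `2`, who is sent any
message `π`. An accepting run ends in a state with the property `Q n i h d π`, where `h` is the
hash of the item and `d` is the commitment. -/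
def VerifiesMembership {ℓ : ℕ} (A : Hashing ℓ) (P : Protocol) (c : ℕ) (cc : ℕ → ℕ → ℕ)
    (Q : ℕ → ℕ → Digest ℓ → Digest ℓ → List (Digest ℓ) → St ℓ → Prop) : Prop :=
  ∀ m n i, m < i → i ≤ n → (path n i).length ≤ cc m n ∧
    ∀ (h d : Digest ℓ) (π : List (Digest ℓ)) (s : St ℓ), s.words 3 = i → s.digs 2 = h →
      RunsIn (env A c n) P.verifyMem (s.load n d π) (cc m n) fun s' =>
        (s'.words 0 = 1 ↔ MemValid A n i h π d) ∧ (s'.words 0 = 1 → Q n i h d π s')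

/-- The proof `π` is stored in the memory: its length in the word cell `4`, its hashes (from the
leaf upwards) in the hash cells `4, 6, 8, …`; the other cells are at the participant's disposal. -/
def Stores {ℓ : ℕ} (s : St ℓ) (π : List (Digest ℓ)) : Prop :=
  s.words 4 = π.length ∧ ∀ j (hj : j < π.length), s.digs (4 + 2 * j) = π[j]

/-- Updating a membership proof from `m` to `n` items. The participant, in a state with the property
`Q` for the old proof `π` and the old commitment, keeps the first hashes of `π` and is sent the
remaining ones. The message `μ` can be anything; if it is accepted, the new proof is valid and the
participant is in a state with the property `Q` for the new proof. -/
def UpdatesMembership {ℓ : ℕ} (A : Hashing ℓ) (P : Protocol) (c : ℕ) (cc : ℕ → ℕ → ℕ)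
    (Q : ℕ → ℕ → Digest ℓ → Digest ℓ → List (Digest ℓ) → St ℓ → Prop) : Prop :=
  ∀ m n i, 1 ≤ i → i ≤ m → m < n → (path n i).length - P.keep m n i ≤ cc m n ∧
    ∀ (h d d' : Digest ℓ) (π μ : List (Digest ℓ)) (s : St ℓ), Q m i h d π s →
      RunsIn (env A c n) P.updateMem (s.load n d' μ) (cc m n) fun s' =>
        (s'.words 0 = 1 ↔ MemValid A n i h (π.take (P.keep m n i) ++ μ) d') ∧
        (s'.words 0 = 1 → Q n i h d' (π.take (P.keep m n i) ++ μ) s')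

/-- The four resync operations from `m` to `n` items, each with a communication (in hashes) and
a computational complexity (in steps) of at most `cc m n`. The participant who has verified a
membership proof stores it, and keeps it up to date through any sequence of updates. -/
def Resyncs {ℓ : ℕ} (A : Hashing ℓ) (P : Protocol) (c : ℕ) (cc : ℕ → ℕ → ℕ) : Prop :=
  FetchesCommitment A P c cc ∧ VerifiesIncrement A P c cc ∧
  ∃ Q : ℕ → ℕ → Digest ℓ → Digest ℓ → List (Digest ℓ) → St ℓ → Prop,
    (∀ n i h d π s, Q n i h d π s → MemValid A n i h π d ∧ Stores s π) ∧
    VerifiesMembership A P c cc Q ∧ UpdatesMembership A P c cc Q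

/-! ### The properties of the scheme -/

/-- The structure has the leaves `1, …, n` in this order, and honest proofs are valid. -/
structure IsCorrect {ℓ : ℕ} (A : Hashing ℓ) (P : Protocol) : Prop where
  leaves : ∀ n, (mmb n).leaves = List.range' 1 n
  membership : ∀ (x : ℕ → List Bool) (n i : ℕ), 1 ≤ i → i ≤ n →
    MemValid A n i (A.H (x i)) (memProof A x n i) (commitment A x n)
  update : ∀ (x : ℕ → List Bool) (m n i : ℕ), 1 ≤ i → i ≤ m → m < n →
    (memProof A x m i).take (P.keep m n i) ++ (memProof A x n i).drop (P.keep m n i) =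
      memProof A x n i
  cover : ∀ m n, 1 ≤ m → m < n → IsIncrementCover m n (P.cover m n)
  increment : ∀ (x : ℕ → List Bool) (m n : ℕ), 1 ≤ m → m < n →
    IncValid A (P.cover m n) m n (commitment A x m) (commitment A x n)
      ((P.cover m n).map (MTree.hash A x))

/-- Valid proofs of two items for one position of one commitment, and a valid increment proof
between commitments to lists the first of which is not a prefix of the second, exhibit a collision
of the hash function among the strings that are hashed. -/
structure IsSound {ℓ : ℕ} (A : Hashing ℓ) (P : Protocol) : Prop where
  membership : ∀ (n i : ℕ) (y y' : List Bool) (π π' : List (Digest ℓ)) (d : Digest ℓ),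
    1 ≤ i → i ≤ n → MemValid A n i (A.H y) π d → MemValid A n i (A.H y') π' d → y ≠ y' →
    Collides A (memTranscript A n i y π) (memTranscript A n i y' π')
  increment : ∀ (x y : ℕ → List Bool) (m n : ℕ) (π : List (Digest ℓ)), 1 ≤ m → m < n →
    IncValid A (P.cover m n) m n (commitment A x m) (commitment A y n) π →
    (∃ i, 1 ≤ i ∧ i ≤ m ∧ x i ≠ y i) →
    Collides A (incTranscript A (P.cover m n) m n x y π)
      (incTranscript A (P.cover m n) m n x y π)

/-- Succinctness: the verifier's operations have a complexity polylogarithmic in `n`. -/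
def IsSuccinct {ℓ : ℕ} (A : Hashing ℓ) (P : Protocol) (c : ℕ) : Prop :=
  FetchesCommitment A P c (fun _ n => c * lg n ^ c) ∧
  VerifiesIncrement A P c (fun _ n => c * lg n ^ c) ∧
  VerifiesMembership A P c (fun _ n => c * lg n ^ c) (fun _ _ _ _ _ _ => True)

/-- Incrementality: the complexity of a resync operation depends only on `k = n - m`. -/
def IsIncremental {ℓ : ℕ} (A : Hashing ℓ) (P : Protocol) (c : ℕ) (f : ℕ → ℕ) : Prop :=
  Resyncs A P c fun m n => f (n - m)

/-- Optimal additivity: an append takes constant time. -/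
def IsOptimallyAdditive {ℓ : ℕ} (A : Hashing ℓ) (P : Protocol) (c : ℕ) : Prop :=
  Appends A P c fun _ => c

end MMB

/-!
# The Merkle Mountain Belt

Everything is read off the binary representation of `N = n + 1`. If the mountains are numbered by
`q = 0, 1, …` from the right, there is one for each `q < log₂ N`, and its height is `q` plus the bit
of `N` at `q` (`mountains_eq`). The append of an item is a binary increment: the only merge takes
place where the carry ends. Whether a range ends after the mountain `q` depends only on the bits at
`q - 1`, `q` and `q + 1` (`Closes`). Hence the double bagging is the fold `st` over the mountains from
left to right, whose state, the belt `bel` of the complete ranges and the chain `chn` of the current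
range, depends at `q` only on the bits from `q - 1` on (`mmb_eq`, `st_congr`).

Let `M = m + 1 < N = n + 1`, and let `L` be the lowest level at which the numbers `M >>> L` and
`N >>> L` of blocks differ by at most one; `L` is at most `log₂ (n - m) + 1` (`level_le`). At the level
`L` and above, `N` results from `M` by a single increment with a carry from `L` to some `P` (`Carry`).
Above `P` the two baggings agree, up to one range end; at `P` two mountains are merged; between `L` and
`P` the mountains are the same ones with their indices shifted by one, in one range. So a bounded
number of nodes (`farNodes`) determines both baggings at the level `L`.

* Appends: here `L = 0`, so that at most six nodes are new (`newNodes_eq`). The manager keeps the peaks,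
  the chains and the belts in cells that do not move when the indices shift, and finds the position
  of the carry and the belt above it with bitwise operations (`appends`).
* Increment proofs: the cover consists of `farNodes`, the old mountains below `L`, and the blocks and
  mountains of new items (`Split.built`). The verifier computes both roots in loops of length `L`
  (`verifyIncCmd_runs`). Its computation is related to `derive` by `Comp`: as the nodes of the cover
  are independent, hashing them in any way that builds a tree gives its derived value
  (`derive_of_comp`).
* Membership proofs: the nodes of the cover with old items are nodes of both trees. A path to an old
  item meets at most `|C|` nodes above the member of the cover `C` below which the item lies, so only
  the last `O(log (n - m))` siblings can change (`keepLen_spec`). The participant stores the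
  hashes of all ancestors and continues from the last one that is kept. Which siblings are on the
  left depends on the index of the mountain of the item, which is computed in constant time
  (`inMountain_mountainOf`), and the length of the path on the number of range ends to the right of it
  (`path_spec`); this number is updated by passing through the `O(log (n - m))` positions at
  which the range ends of the two lists differ (`card_onesDiff_endsOf`, `updateMemCmd_runs`).
* Soundness: without a collision among the hashed strings, equal hashes propagate from the root to the
  children, in the two climbs (`climb_collision`) and from the roots to the members of the cover and to
  the items (`derive_eq_hash`, `eq_of_hash_eq`).
-/

namespace MMB

open MTree

/-! ### Perfect blocks and the shape of the mountain list -/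

/-- The perfect tree of height `h` over the `a`-th (from `0`) aligned block of `2 ^ h` leaves. -/
def blk : ℕ → ℕ → MTree
  | 0, a => .leaf (a + 1)
  | h + 1, a => .node (blk h (2 * a)) (blk h (2 * a + 1))

theorem leaves_blk (h a : ℕ) : (blk h a).leaves = List.range' (a * 2 ^ h + 1) (2 ^ h) := by
  induction h generalizing a with
  | zero => simp [blk, leaves]
  | succ h ih =>
    rw [blk, leaves, ih, ih]
    have e : (2 * a + 1) * 2 ^ h + 1 = (2 * a * 2 ^ h + 1) + 2 ^ h := by ring
    rw [e, List.range'_append_1]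
    congr 1 <;> ring

theorem mem_leaves_blk {h a i : ℕ} : i ∈ (blk h a).leaves ↔ 1 ≤ i ∧ (i - 1) >>> h = a := by
  rw [leaves_blk, List.mem_range'_1, Nat.shiftRight_eq_div_pow]
  constructor
  · rintro ⟨h1, h2⟩
    refine ⟨by omega, ?_⟩
    rw [Nat.div_eq_iff (by positivity)]
    constructor <;> omega
  · rintro ⟨h1, h2⟩
    rw [Nat.div_eq_iff (by positivity)] at h2
    have := Nat.two_pow_pos h
    omega

theorem blk_ne_empty (h a : ℕ) : blk h a ≠ .empty := by cases h <;> simp [blk]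

/-- The mountain with index `q` (counted from the right) in the list for `N - 1` items. It has
`q + b` levels, where `b` is the bit of `N` at the position `q`. -/
def mtn (N q : ℕ) : MTree :=
  if (N >>> q) % 2 = 0 then blk q (N >>> q - 2) else blk (q + 1) (N >>> q / 2 - 1)

theorem mtn_ne_empty (N q : ℕ) : mtn N q ≠ .empty := by
  unfold mtn; split <;> exact blk_ne_empty _ _

theorem mtn_even {N q : ℕ} (h : (N >>> q) % 2 = 0) : mtn N q = blk q (N >>> q - 2) := if_pos h

theorem mtn_odd {N q : ℕ} (h : (N >>> q) % 2 = 1) : mtn N q = blk (q + 1) (N >>> q / 2 - 1) :=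
  if_neg (by omega)

theorem shr_succ (N q : ℕ) : N >>> (q + 1) = N >>> q / 2 := Nat.shiftRight_succ N q

/-- The mountains of level at least `t`, from right to left, as a function of `H = N >>> t`. -/
def levelList (t H : ℕ) : List Mountain :=
  if H ≤ 1 then [] else
    ⟨t + H % 2, if H % 2 = 0 then blk t (H - 2) else blk (t + 1) (H / 2 - 1)⟩ ::
      levelList (t + 1) (H / 2)
termination_by H
decreasing_by omega

theorem levelList_one (t : ℕ) : levelList t 1 = [] := by rw [levelList, if_pos le_rfl]

theorem levelList_even {t H : ℕ} (h : 2 ≤ H) (hb : H % 2 = 0) :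
    levelList t H = ⟨t, blk t (H - 2)⟩ :: levelList (t + 1) (H / 2) := by
  rw [levelList, if_neg (by omega), hb, if_pos rfl, Nat.add_zero]

theorem levelList_odd {t H : ℕ} (h : 2 ≤ H) (hb : H % 2 = 1) :
    levelList t H = ⟨t + 1, blk (t + 1) (H / 2 - 1)⟩ :: levelList (t + 1) (H / 2) := by
  rw [levelList, if_neg (by omega), hb, if_neg one_ne_zero]

/-- Appending a leaf is a binary increment: the trailing ones are passed, and the lowest zero is
where the merge takes place. -/
theorem mergeStep_levelList (t H : ℕ) (hH : 1 ≤ H) :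
    mergeStep (⟨t, blk t (H - 1)⟩ :: levelList t H) = levelList t (H + 1) := by
  induction H using Nat.strong_induction_on generalizing t with
  | _ H ih =>
    rcases Nat.lt_or_ge 1 H with h1 | h1
    · rcases Nat.mod_two_eq_zero_or_one H with hb | hb
      · rw [levelList_even h1 hb, levelList_odd (H := H + 1) (by omega) (by omega), mergeStep, if_pos rfl]
        rw [show (H + 1) / 2 = H / 2 by omega, blk, show 2 * (H / 2 - 1) = H - 2 by omega,
          show H - 2 + 1 = H - 1 by omega]
      · have := ih (H / 2) (by omega) (t + 1) (by omega)
        rw [levelList_odd h1 hb, levelList_even (H := H + 1) (by omega) (by omega), mergeStep,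
          if_neg (by simp), this]
        rw [show (H + 1) / 2 = H / 2 + 1 by omega, show H + 1 - 2 = H - 1 by omega]
    · obtain rfl : H = 1 := by omega
      rw [levelList_one, levelList_even (by omega) (by omega), levelList_one, mergeStep]
      simp

theorem mountainsRL_eq (n : ℕ) : mountainsRL n = levelList 0 (n + 1) := by
  induction n with
  | zero => rw [mountainsRL, levelList, if_pos (by norm_num)]
  | succ n ih =>
    rw [mountainsRL, ih, ← mergeStep_levelList 0 (n + 1) (by omega)]
    rfl

/-! ### The double bagging as a fold over the mountains -/

/-- The mountain with index `q` is the last one of its range. -/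
def Closes (N q : ℕ) : Prop :=
  q = 0 ∨ (N >>> q) % 2 = 1 ∧ ¬ ((N >>> (q + 1)) % 2 = 1 ∧ (N >>> (q - 1)) % 2 = 1)

instance (N q : ℕ) : Decidable (Closes N q) := by unfold Closes; infer_instance

/-- The state of the bagging after the mountains of index at least `q`: the bag of the complete
ranges, and the bag of the current incomplete range. -/
def st (N q : ℕ) : MTree × MTree :=
  if N >>> q ≤ 1 then (.empty, .empty) else
    if Closes N q then (.node (st N (q + 1)).1 (.node (st N (q + 1)).2 (mtn N q)), .empty)
    else ((st N (q + 1)).1, .node (st N (q + 1)).2 (mtn N q))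
termination_by N >>> q
decreasing_by all_goals (rw [shr_succ]; omega)

/-- The belt of the complete ranges. -/
def bel (N q : ℕ) : MTree := (st N q).1

/-- The chain of the current range. -/
def chn (N q : ℕ) : MTree := (st N q).2

theorem bel_top {N q : ℕ} (h : N >>> q ≤ 1) : bel N q = .empty := by rw [bel, st, if_pos h]

theorem chn_top {N q : ℕ} (h : N >>> q ≤ 1) : chn N q = .empty := by rw [chn, st, if_pos h]

theorem bel_close {N q : ℕ} (h : 2 ≤ N >>> q) (hc : Closes N q) :
    bel N q = .node (bel N (q + 1)) (.node (chn N (q + 1)) (mtn N q)) := by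
  rw [bel, st, if_neg (by omega), if_pos hc]; rfl

theorem chn_close {N q : ℕ} (hc : Closes N q) : chn N q = .empty := by
  by_cases h : N >>> q ≤ 1
  · exact chn_top h
  · rw [chn, st, if_neg h, if_pos hc]

theorem bel_open {N q : ℕ} (hc : ¬ Closes N q) : bel N q = bel N (q + 1) := by
  by_cases h : N >>> q ≤ 1
  · rw [bel_top h, bel_top]; rw [shr_succ]; omega
  · rw [bel, st, if_neg h, if_neg hc]; rfl

theorem chn_open {N q : ℕ} (h : 2 ≤ N >>> q) (hc : ¬ Closes N q) :
    chn N q = .node (chn N (q + 1)) (mtn N q) := by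
  rw [chn, st, if_neg (by omega), if_neg hc]; rfl

/-- The fold that `splitRanges` and `bag` amount to, on an arbitrary list of mountains. -/
def bagFold : MTree → MTree → Option Mountain → List Mountain → MTree
  | B, _, _, [] => B
  | B, C, _, [M] => .node B (.node C M.tree)
  | B, C, left, M :: M' :: rest =>
      if M.height = M'.height + 2 ∨ left.map Mountain.height = some M.height then
        bagFold (.node B (.node C M.tree)) .empty (some M) (M' :: rest)
      else bagFold B (.node C M.tree) (some M) (M' :: rest)

theorem splitRanges_ne_nil (left : Option Mountain) (M : Mountain) (L : List Mountain) :
    splitRanges left (M :: L) ≠ [] := by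
  cases L with
  | nil => simp [splitRanges]
  | cons M' rest =>
    rw [splitRanges]
    split
    · simp
    · split <;> simp

theorem bagFold_eq (B C : MTree) (left : Option Mountain) (L : List Mountain)
    {R : List Mountain} {Rs : List (List Mountain)} (h : splitRanges left L = R :: Rs) :
    bagFold B C left L = ((R.map Mountain.tree).foldl MTree.node C ::
      Rs.map fun R => bag (R.map Mountain.tree)).foldl MTree.node B := by
  induction L generalizing B C left R Rs with
  | nil => simp [splitRanges] at h
  | cons M L ih =>
    cases L with
    | nil =>
      simp only [splitRanges, List.cons.injEq] at h
      obtain ⟨rfl, rfl⟩ := h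
      simp [bagFold]
    | cons M' rest =>
      obtain ⟨R', Rs', hs⟩ := List.exists_cons_of_ne_nil (splitRanges_ne_nil (some M) M' rest)
      rw [splitRanges, hs] at h
      rw [bagFold]
      split at h
      · rename_i hc
        simp only [List.cons.injEq] at h
        obtain ⟨rfl, rfl⟩ := h
        rw [if_pos hc, ih _ _ _ hs]
        simp [bag]
      · rename_i hc
        simp only [List.cons.injEq] at h
        obtain ⟨rfl, rfl⟩ := h
        rw [if_neg hc, ih _ _ _ hs]
        simp

theorem bag_splitRanges (L : List Mountain) :
    bag ((splitRanges none L).map fun R => bag (R.map Mountain.tree)) =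
      bagFold .empty .empty none L := by
  cases L with
  | nil => simp [splitRanges, bagFold, bag]
  | cons M L =>
    obtain ⟨R', Rs', hs⟩ := List.exists_cons_of_ne_nil (splitRanges_ne_nil none M L)
    rw [bagFold_eq _ _ _ _ hs, hs]
    simp [bag]

/-- The mountain with index `q`, with its height. -/
def mtnH (N q : ℕ) : Mountain := ⟨q + (N >>> q) % 2, mtn N q⟩

theorem levelList_shr {N K : ℕ} (hK : N >>> K = 1) (d q : ℕ) (hq : q + d = K) :
    levelList q (N >>> q) = (List.range' q d).map (mtnH N) := by
  induction d generalizing q with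
  | zero =>
    obtain rfl : q = K := by omega
    rw [hK, levelList_one]; rfl
  | succ d ih =>
    have h2 : 2 ≤ N >>> q := by
      have h := Nat.shiftRight_add N q (d + 1)
      rw [hq, hK, Nat.shiftRight_eq_div_pow] at h
      by_contra h'
      rw [Nat.div_eq_of_lt] at h
      · omega
      · have : 2 ^ 1 ≤ 2 ^ (d + 1) := Nat.pow_le_pow_right (by norm_num) (by omega)
        omega
    rw [levelList, if_neg (by omega), ← shr_succ, ih (q + 1) (by omega), List.range'_succ,
      List.map_cons]
    rfl

theorem shr_log {N : ℕ} (hN : 1 ≤ N) : N >>> Nat.log 2 N = 1 := by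
  rw [Nat.shiftRight_eq_div_pow, Nat.div_eq_iff (by positivity)]
  have h1 := Nat.pow_log_le_self 2 (x := N) (by omega)
  have h2 := Nat.lt_pow_succ_log_self (b := 2) (by norm_num) N
  rw [pow_succ] at h2
  omega

theorem two_le_shr {N q : ℕ} (h : q < Nat.log 2 N) : 2 ≤ N >>> q := by
  rw [Nat.shiftRight_eq_div_pow, Nat.le_div_iff_mul_le (by positivity), ← pow_succ']
  exact (Nat.pow_le_pow_right (by norm_num) h).trans
    (Nat.pow_log_le_self 2 (by rintro rfl; simp at h))

theorem lt_log_of_two_le_shr {N q : ℕ} (h : 2 ≤ N >>> q) : q < Nat.log 2 N := by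
  rw [Nat.shiftRight_eq_div_pow, Nat.le_div_iff_mul_le (by positivity), ← pow_succ'] at h
  exact Nat.le_log_of_pow_le (by norm_num) h

theorem mountains_eq (n : ℕ) :
    mountains n = (List.range (Nat.log 2 (n + 1))).reverse.map (mtnH (n + 1)) := by
  rw [mountains, mountainsRL_eq, ← Nat.shiftRight_zero (n := n + 1),
    levelList_shr (shr_log (by simp)) (Nat.log 2 (n + 1)) 0 (by simp), List.map_reverse,
    List.range_eq_range']
  simp

/-- The range ends of the mountain list, in terms of the bits. -/
theorem range_end_iff {N q : ℕ} (hq : q + 1 < Nat.log 2 N) :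
    ((mtnH N (q + 1)).height = (mtnH N q).height + 2 ∨
      (if q + 2 < Nat.log 2 N then some (mtnH N (q + 2)) else none).map Mountain.height =
        some (mtnH N (q + 1)).height) ↔ Closes N (q + 1) := by
  have hb0 := Nat.mod_two_eq_zero_or_one (N >>> q)
  have hb1 := Nat.mod_two_eq_zero_or_one (N >>> (q + 1))
  have hb2 := Nat.mod_two_eq_zero_or_one (N >>> (q + 2))
  simp only [Closes, mtnH, Nat.add_sub_cancel, show q + 1 + 1 = q + 2 from rfl]
  split
  · simp only [Option.map_some, Option.some.injEq]; omega
  · have h1 : N >>> (q + 2) = 1 := by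
      rw [← shr_log (N := N) (Nat.one_le_iff_ne_zero.2 fun h0 => by simp [h0] at hq)]
      congr 1; omega
    simp only [Option.map_none, h1]
    simp
    omega

/-- Below the index `q`, the list fold continues the bagging from the state at `q`. -/
theorem bagFold_range (N q : ℕ) (hq : q ≤ Nat.log 2 N) :
    bagFold (bel N q) (chn N q) (if q < Nat.log 2 N then some (mtnH N q) else none)
      ((List.range q).reverse.map (mtnH N)) = bel N 0 := by
  induction q with
  | zero => simp [bagFold]
  | succ q ih =>
    have h2 := two_le_shr (N := N) (q := q) (by omega)
    have ih := ih (by omega)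
    rw [if_pos (by omega)] at ih
    rw [List.range_succ, List.reverse_append, List.reverse_singleton, List.singleton_append,
      List.map_cons]
    cases q with
    | zero =>
      have hc : Closes N 0 := Or.inl rfl
      rw [bel_close h2 hc]
      simp [bagFold, mtnH]
    | succ q =>
      rw [List.range_succ, List.reverse_append, List.reverse_singleton, List.singleton_append,
        List.map_cons] at ih ⊢
      rw [bagFold, ← ih]
      have hre := range_end_iff (N := N) (q := q) (by omega)
      by_cases hc : Closes N (q + 1)
      · rw [if_pos (hre.2 hc), bel_close h2 hc, chn_close hc]; rfl
      · rw [if_neg (mt hre.1 hc), bel_open hc, chn_open h2 hc]; rfl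

theorem mmb_eq (n : ℕ) : mmb n = bel (n + 1) 0 := by
  have h := bagFold_range (n + 1) (Nat.log 2 (n + 1)) le_rfl
  rw [bel_top (shr_log (by simp)).le, chn_top (shr_log (by simp)).le, if_neg (lt_irrefl _)] at h
  rw [mmb, bag_splitRanges, mountains_eq, h]

theorem leaves_mtn {N q : ℕ} (h : 2 ≤ N >>> q) :
    (mtn N q).leaves = List.range' (2 ^ (q + 1) * (N >>> (q + 1) - 1) + 1)
      (2 ^ q * (N >>> q - 1) - 2 ^ (q + 1) * (N >>> (q + 1) - 1)) ∧
    2 ^ (q + 1) * (N >>> (q + 1) - 1) ≤ 2 ^ q * (N >>> q - 1) := by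
  have hp := Nat.two_pow_pos q
  have hp' := Nat.two_pow_pos (q + 1)
  obtain ⟨G, hG⟩ : ∃ G, N >>> (q + 1) = G + 1 := ⟨N >>> (q + 1) - 1, by rw [shr_succ]; omega⟩
  have hs := shr_succ N q
  rcases Nat.mod_two_eq_zero_or_one (N >>> q) with hb | hb
  · have hH : N >>> q = 2 * G + 2 := by omega
    rw [mtn_even hb, leaves_blk, hG, hH]
    have e : 2 ^ q * (2 * G + 2 - 1) = 2 ^ (q + 1) * (G + 1 - 1) + 2 ^ q := by
      rw [show 2 * G + 2 - 1 = 2 * G + 1 by omega, Nat.add_sub_cancel]; ring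
    rw [e]
    refine ⟨?_, by omega⟩
    congr 1
    · rw [Nat.add_sub_cancel, Nat.add_sub_cancel]; ring
    · omega
  · have hH : N >>> q = 2 * G + 3 := by omega
    rw [mtn_odd hb, leaves_blk, hG, hH]
    have e : 2 ^ q * (2 * G + 3 - 1) = 2 ^ (q + 1) * (G + 1 - 1) + 2 ^ (q + 1) := by
      rw [show 2 * G + 3 - 1 = 2 * G + 2 by omega, Nat.add_sub_cancel]; ring
    rw [e]
    refine ⟨?_, by omega⟩
    congr 1
    · rw [show (2 * G + 3) / 2 - 1 = G by omega, Nat.add_sub_cancel]; ring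
    · omega

/-- The state of the bagging at `q` contains the leaves of the mountains of index at least `q`. -/
theorem leaves_st (N q : ℕ) :
    (bel N q).leaves ++ (chn N q).leaves = List.range' 1 (2 ^ q * (N >>> q - 1)) := by
  induction hn : N >>> q using Nat.strong_induction_on generalizing q with
  | _ H ih =>
    subst hn
    by_cases h : N >>> q ≤ 1
    · rw [bel_top h, chn_top h, Nat.sub_eq_zero_of_le h]; simp [leaves]
    · have ih := ih (N >>> (q + 1)) (by rw [shr_succ]; omega) (q + 1) rfl
      obtain ⟨h1, h2⟩ := leaves_mtn (N := N) (q := q) (by omega)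
      have : (bel N q).leaves ++ (chn N q).leaves =
          ((bel N (q + 1)).leaves ++ (chn N (q + 1)).leaves) ++ (mtn N q).leaves := by
        by_cases hc : Closes N q
        · rw [bel_close (by omega) hc, chn_close hc]; simp [leaves]
        · rw [bel_open hc, chn_open (by omega) hc]; simp [leaves]
      rw [this, ih, h1, Nat.add_comm (_ * _) 1, List.range'_append_1]
      congr 1
      omega

theorem leaves_mmb (n : ℕ) : (mmb n).leaves = List.range' 1 n := by
  have h := leaves_st (n + 1) 0
  rw [chn_close (Or.inl rfl)] at h
  simpa [mmb_eq, leaves] using h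

/-! ### Trees with distinct leaves -/

section

variable {ℓ : ℕ} {A : Hashing ℓ} {x y : ℕ → List Bool}

theorem nodes_trans {s t u : MTree} (h1 : s ∈ t.nodes) (h2 : t ∈ u.nodes) : s ∈ u.nodes := by
  induction u with
  | empty => simp [nodes] at h2
  | leaf i => simp only [nodes, List.mem_singleton] at h2; exact h2 ▸ h1
  | node l r ihl ihr =>
    simp only [nodes, List.mem_append, List.mem_singleton] at h2 ⊢
    rcases h2 with (h2 | h2) | h2
    · exact Or.inl (Or.inl (ihl h2))
    · exact Or.inl (Or.inr (ihr h2))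
    · subst h2
      simpa [nodes, or_assoc] using h1

theorem leaves_subset {s t : MTree} (h : s ∈ t.nodes) : s.leaves ⊆ t.leaves := by
  induction t with
  | empty => simp [nodes] at h
  | leaf i => simp only [nodes, List.mem_singleton] at h; simp [h]
  | node l r ihl ihr =>
    simp only [nodes, List.mem_append, List.mem_singleton] at h
    rcases h with (h | h) | h
    · exact fun i hi => by simp [leaves, ihl h hi]
    · exact fun i hi => by simp [leaves, ihr h hi]
    · simp [h]

theorem sizeOf_le_of_mem_nodes {s t : MTree} (h : s ∈ t.nodes) : sizeOf s ≤ sizeOf t := by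
  induction t with
  | empty => simp [nodes] at h
  | leaf i => simp only [nodes, List.mem_singleton] at h; simp [h]
  | node l r ihl ihr =>
    simp only [nodes, List.mem_append, List.mem_singleton] at h
    simp only [MTree.node.sizeOf_spec]
    rcases h with (h | h) | h
    · have := ihl h; omega
    · have := ihr h; omega
    · subst h; simp

theorem self_mem_nodes {t : MTree} (h : t ≠ .empty) : t ∈ t.nodes := by
  cases t <;> simp_all [nodes]

/-- In a tree with distinct leaves, a right child has only one parent. -/
theorem parent_unique {a b c t : MTree} (ht : t.leaves.Nodup) (hc : c.leaves ≠ [])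
    (h1 : node a c ∈ t.nodes) (h2 : node b c ∈ t.nodes) : a = b := by
  induction t with
  | empty => simp [nodes] at h1
  | leaf i => simp [nodes] at h1
  | node l r ihl ihr =>
    obtain ⟨i, hi⟩ := List.exists_mem_of_ne_nil _ hc
    simp only [leaves, List.nodup_append] at ht
    obtain ⟨hl, hr, hd⟩ := ht
    have hsub : ∀ {d u : MTree}, node d c ∈ u.nodes → i ∈ u.leaves := fun h =>
      leaves_subset h (by simp [leaves, hi])
    have hsz : ∀ {d : MTree}, node d c ∉ c.nodes := fun h => by
      have := sizeOf_le_of_mem_nodes h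
      simp only [MTree.node.sizeOf_spec] at this
      omega
    simp only [nodes, List.mem_append, List.mem_singleton] at h1 h2
    rcases h1 with (h1 | h1) | h1 <;> rcases h2 with (h2 | h2) | h2
    · exact ihl hl h1 h2
    · exact absurd rfl (hd _ (hsub h1) _ (hsub h2))
    · obtain ⟨rfl, rfl⟩ := MTree.node.inj h2
      exact absurd rfl (hd _ (hsub h1) _ hi)
    · exact absurd rfl (hd _ (hsub h2) _ (hsub h1))
    · exact ihr hr h1 h2
    · obtain ⟨rfl, rfl⟩ := MTree.node.inj h2
      exact absurd h1 hsz
    · obtain ⟨rfl, rfl⟩ := MTree.node.inj h1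
      exact absurd rfl (hd _ (hsub h2) _ hi)
    · obtain ⟨rfl, rfl⟩ := MTree.node.inj h1
      exact absurd h2 hsz
    · exact (MTree.node.inj (h1.trans h2.symm)).1

/-! ### Membership proofs: correctness and soundness -/

theorem cat_inj {a b c d : Digest ℓ} : cat a b = cat c d ↔ a = c ∧ b = d := by
  constructor
  · intro h
    obtain ⟨h1, h2⟩ := List.append_inj h (by simp)
    exact ⟨List.Vector.toList_injective h1, List.Vector.toList_injective h2⟩
  · rintro ⟨rfl, rfl⟩; rfl

theorem climb_append (h : Digest ℓ) (π ρ : List (Bool × Digest ℓ)) :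
    climb A h (π ++ ρ) = climb A (climb A h π) ρ := by
  induction π generalizing h with
  | nil => rfl
  | cons p π ih => simp [climb, ih]

theorem climb_siblings {i : ℕ} {t : MTree} (hi : i ∈ t.leaves) :
    climb A (A.H (x i)) ((siblings i t).map fun p => (p.1, p.2.hash A x)) = t.hash A x := by
  induction t with
  | empty => simp [leaves] at hi
  | leaf j => simp only [leaves, List.mem_singleton] at hi; subst hi; rfl
  | node l r ihl ihr =>
    rw [siblings]
    split
    · rename_i h
      simp [climb_append, ihl h, climb, joinStr, MTree.hash]
    · rename_i h
      have hr : i ∈ r.leaves := by simpa [leaves, h] using hi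
      simp [climb_append, ihr hr, climb, joinStr, MTree.hash]

theorem memValid_memProof (A : Hashing ℓ) (x : ℕ → List Bool) {n i : ℕ} (h1 : 1 ≤ i) (h2 : i ≤ n) :
    MemValid A n i (A.H (x i)) (memProof A x n i) (commitment A x n) := by
  refine ⟨by simp [memProof], ?_⟩
  rw [commitment, ← climb_siblings (A := A) (x := x) (i := i) (t := mmb n)
    (by rw [leaves_mmb, List.mem_range'_1]; omega)]
  congr 1
  rw [oriented, memProof, path, List.zip_map']

theorem climb_collision {a b : Digest ℓ} {ds : List Bool} {π ρ : List (Digest ℓ)}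
    (hπ : π.length = ds.length) (hρ : ρ.length = ds.length) (hab : a ≠ b)
    (h : climb A a (ds.zip π) = climb A b (ds.zip ρ)) :
    Collides A (climbInputs A a (ds.zip π)) (climbInputs A b (ds.zip ρ)) := by
  induction ds generalizing a b π ρ with
  | nil => simp [climb] at h; exact absurd h hab
  | cons e ds ih =>
    cases π with
    | nil => simp at hπ
    | cons p π =>
    cases ρ with
    | nil => simp at hρ
    | cons q ρ =>
    simp only [List.length_cons, Nat.add_right_cancel_iff] at hπ hρ
    simp only [List.zip_cons_cons, climb] at h
    simp only [List.zip_cons_cons, climbInputs]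
    have hne : joinStr a (e, p) ≠ joinStr b (e, q) := by
      unfold joinStr
      cases e <;> simp [cat_inj, hab]
    by_cases hH : A.H (joinStr a (e, p)) = A.H (joinStr b (e, q))
    · exact ⟨_, List.mem_cons_self, _, List.mem_cons_self, hne, hH⟩
    · obtain ⟨u, hu, v, hv, huv⟩ := ih hπ hρ hH h
      exact ⟨u, List.mem_cons_of_mem _ hu, v, List.mem_cons_of_mem _ hv, huv⟩

theorem membership_sound {n i : ℕ} {z z' : List Bool} {π π' : List (Digest ℓ)} {d : Digest ℓ}
    (h : MemValid A n i (A.H z) π d) (h' : MemValid A n i (A.H z') π' d) (hz : z ≠ z') :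
    Collides A (memTranscript A n i z π) (memTranscript A n i z' π') := by
  by_cases hH : A.H z = A.H z'
  · exact ⟨z, List.mem_cons_self, z', List.mem_cons_self, hz, hH⟩
  · obtain ⟨u, hu, v, hv, huv⟩ := climb_collision (A := A) (by simpa using h.1) (by simpa using h'.1)
      hH (h.2.trans h'.2.symm)
    exact ⟨u, List.mem_cons_of_mem _ hu, v, List.mem_cons_of_mem _ hv, huv⟩

/-! ### Increment proofs: trees that are composed of given nodes -/

/-- The tree `t` is composed of the trees in the list, in this order, without a tree both of whose
children are missing. -/
inductive Built : List MTree → MTree → Prop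
  | empty : Built [] .empty
  | base {t : MTree} : t.leaves ≠ [] → Built [t] t
  | node {C D : List MTree} {l r : MTree} : Built C l → Built D r → C ++ D ≠ [] →
      Built (C ++ D) (.node l r)

theorem Built.leaves {C : List MTree} {t : MTree} (h : Built C t) :
    C.flatMap MTree.leaves = t.leaves := by
  induction h with
  | empty => rfl
  | base => simp
  | node _ _ _ ih1 ih2 => simp [MTree.leaves, ih1, ih2]

theorem Built.mem_nodes {C : List MTree} {t : MTree} (h : Built C t) : ∀ u ∈ C, u ∈ t.nodes := by
  induction h with
  | empty => simp
  | base h => simpa using self_mem_nodes (by rintro rfl; simp [MTree.leaves] at h)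
  | node _ _ _ ih1 ih2 =>
    intro u hu
    rcases List.mem_append.1 hu with hu | hu
    · simp [nodes, ih1 u hu]
    · simp [nodes, ih2 u hu]

theorem Built.leaves_ne_nil {C : List MTree} {t : MTree} (h : Built C t) :
    ∀ u ∈ C, u.leaves ≠ [] := by
  induction h with
  | empty => simp
  | base h => simpa using h
  | node _ _ _ ih1 ih2 =>
    intro u hu
    rcases List.mem_append.1 hu with hu | hu
    · exact ih1 u hu
    · exact ih2 u hu

theorem Built.opt {t : MTree} (h : t = .empty ∨ t.leaves ≠ []) :
    Built (if t = .empty then [] else [t]) t := by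
  split
  · rename_i h'; exact h' ▸ Built.empty
  · rename_i h'; exact Built.base (h.resolve_left h')

theorem isIncrementCover_of_built {m n : ℕ} (hmn : m ≤ n) {Cold Cnew : List MTree}
    (h1 : Built Cold (mmb m)) (h2 : Built (Cold ++ Cnew) (mmb n)) :
    IsIncrementCover m n (Cold ++ Cnew) ∧ oldPart m (Cold ++ Cnew) = Cold := by
  have hl1 := h1.leaves
  have hl2 := h2.leaves
  rw [leaves_mmb] at hl1 hl2
  have hnew : Cnew.flatMap MTree.leaves = List.range' (1 + m) (n - m) := by
    rw [List.flatMap_append, hl1, show n = m + (n - m) by omega, ← List.range'_append_1] at hl2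
    simpa using List.append_cancel_left hl2
  have hold : oldPart m (Cold ++ Cnew) = Cold := by
    rw [oldPart, List.filter_append, List.filter_eq_self.2, List.filter_eq_nil_iff.2,
      List.append_nil]
    · intro u hu
      obtain ⟨i, hi⟩ := List.exists_mem_of_ne_nil _
        (h2.leaves_ne_nil u (List.mem_append_right _ hu))
      have : i ∈ List.range' (1 + m) (n - m) := hnew ▸ List.mem_flatMap.2 ⟨u, hu, hi⟩
      rw [List.mem_range'_1] at this
      simp only [decide_eq_true_eq, not_forall]
      exact ⟨i, hi, by omega⟩
    · intro u hu
      simp only [decide_eq_true_eq]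
      intro i hi
      have : i ∈ List.range' 1 m := hl1 ▸ List.mem_flatMap.2 ⟨u, hu, hi⟩
      rw [List.mem_range'_1] at this
      omega
  refine ⟨⟨h2.mem_nodes, hl2, ?_, ?_⟩, hold⟩
  · rw [hold]; exact h1.mem_nodes
  · rw [hold]; exact hl1

/-- Distinct members of an independent node set have disjoint leaves. -/
theorem eq_of_common_leaf {C : List MTree} (hC : (C.flatMap MTree.leaves).Nodup) {u v : MTree}
    (hu : u ∈ C) (hv : v ∈ C) {i : ℕ} (hi : i ∈ u.leaves) (hj : i ∈ v.leaves) : u = v := by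
  induction C with
  | nil => simp at hu
  | cons w C ih =>
    simp only [List.flatMap_cons, List.nodup_append, List.mem_flatMap] at hC
    obtain ⟨-, hC, hd⟩ := hC
    rcases List.mem_cons.1 hu with hu | hu <;> rcases List.mem_cons.1 hv with hv | hv
    · rw [hu, hv]
    · exact absurd rfl (hd i (hu ▸ hi) i ⟨v, hv, hj⟩)
    · exact absurd rfl (hd i (hv ▸ hj) i ⟨u, hu, hi⟩)
    · exact ih hC hu hv

/-- An independent node set: the leaves below its members are distinct, and there are some. -/
structure Indep (C : List MTree) : Prop where
  leaves_nodup : (C.flatMap MTree.leaves).Nodup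
  leaves_ne_nil : ∀ u ∈ C, u.leaves ≠ []

theorem Built.indep {C : List MTree} {t : MTree} (h : Built C t) (ht : t.leaves.Nodup) :
    Indep C := ⟨h.leaves ▸ ht, h.leaves_ne_nil⟩

theorem Indep.nodup {C : List MTree} (h : Indep C) : C.Nodup := by
  obtain ⟨h1, h2⟩ := h
  induction C with
  | nil => simp
  | cons u C ih =>
    simp only [List.flatMap_cons, List.nodup_append, List.mem_flatMap] at h1
    refine List.nodup_cons.2 ⟨fun hu => ?_, ih h1.2.1 fun v hv => h2 v (List.mem_cons_of_mem _ hv)⟩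
    obtain ⟨i, hi⟩ := List.exists_mem_of_ne_nil _ (h2 u List.mem_cons_self)
    exact h1.2.2 i hi i ⟨u, hu, hi⟩ rfl

/-- A tree with a member of an independent set below one of its children is not a member. -/
theorem Indep.node_not_mem {C : List MTree} (h : Indep C) {l r u : MTree} (hu : u ∈ C)
    (hlr : u ∈ l.nodes ∨ u ∈ r.nodes) : MTree.node l r ∉ C := by
  intro hn
  obtain ⟨i, hi⟩ := List.exists_mem_of_ne_nil _ (h.leaves_ne_nil u hu)
  have hs : u ∈ (MTree.node l r).nodes := by simp only [nodes, List.mem_append]; tauto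
  have := eq_of_common_leaf h.leaves_nodup hu hn hi (leaves_subset hs hi)
  subst this
  rcases hlr with h' | h' <;>
  · have := sizeOf_le_of_mem_nodes h'
    simp only [MTree.node.sizeOf_spec] at this
    omega

/-- The hash of a tree that is composed of members of `C`, when the `j`-th member of `C` has the
hash `π[j]`, and missing hashes are replaced by the default. -/
inductive Comp {ℓ : ℕ} (A : Hashing ℓ) (C : List MTree) (π : List (Digest ℓ)) :
    MTree → Digest ℓ → Prop
  | empty : Comp A C π .empty A.dflt
  | base {t : MTree} {j : ℕ} : C[j]? = some t → Comp A C π t (π.getD j A.dflt)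
  | node {l r : MTree} {a b : Digest ℓ} : Comp A C π l a → Comp A C π r b →
      (l ≠ .empty ∨ r ≠ .empty) → Comp A C π (.node l r) (A.H (cat a b))

theorem lookup_zip {C : List MTree} (hC : C.Nodup) {π : List (Digest ℓ)}
    (hπ : π.length = C.length) {j : ℕ} {t : MTree} (h : C[j]? = some t) (d : Digest ℓ) :
    (C.zip π).lookup t = some (π.getD j d) := by
  induction C generalizing π j with
  | nil => simp at h
  | cons u C ih =>
    cases π with
    | nil => simp at hπ
    | cons p π =>
      rw [List.zip_cons_cons, List.lookup_cons]
      rw [List.nodup_cons] at hC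
      cases j with
      | zero =>
        simp only [List.getElem?_cons_zero, Option.some.injEq] at h
        simp [h]
      | succ j =>
        simp only [List.getElem?_cons_succ] at h
        have : t ≠ u := by
          rintro rfl
          exact hC.1 (List.mem_of_getElem? h)
        simp only [List.length_cons, Nat.add_right_cancel_iff] at hπ
        rw [beq_false_of_ne this]
        simpa using ih hC.2 hπ h

theorem lookup_zip_eq_none {C : List MTree} {t : MTree} (h : t ∉ C) (π : List (Digest ℓ)) :
    (C.zip π).lookup t = none := by
  rw [List.lookup_eq_none_iff]
  rintro ⟨u, d⟩ hu
  have := (List.of_mem_zip hu).1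
  exact bne_iff_ne.2 fun e => h (e ▸ this)

theorem derive_node {C : List MTree} {π : List (Digest ℓ)} {l r : MTree}
    (h : MTree.node l r ∉ C) :
    derive A C π (.node l r) = A.H (cat (derive A C π l) (derive A C π r)) := by
  rw [derive, lookup_zip_eq_none h]; rfl

theorem derive_of_comp {C : List MTree} (hC : Indep C) {π : List (Digest ℓ)}
    (hπ : π.length = C.length) {t : MTree} {d : Digest ℓ} (h : Comp A C π t d) :
    derive A C π t = d ∧ (t = .empty ∨ ∃ u ∈ C, u ∈ t.nodes) := by
  induction h with
  | empty => exact ⟨rfl, Or.inl rfl⟩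
  | @base t j h =>
    have ht := List.mem_of_getElem? h
    have hne : t ≠ .empty := by rintro rfl; exact hC.leaves_ne_nil _ ht rfl
    refine ⟨?_, Or.inr ⟨t, ht, self_mem_nodes hne⟩⟩
    have := lookup_zip hC.nodup hπ h A.dflt
    cases t with
    | empty => exact absurd rfl hne
    | leaf i => rw [derive, this]; rfl
    | node l r => rw [derive, this]; rfl
  | @node l r a b _ _ hlr ih1 ih2 =>
    have : ∃ u ∈ C, u ∈ l.nodes ∨ u ∈ r.nodes := by
      rcases hlr with h | h
      · obtain ⟨u, hu, hu'⟩ := ih1.2.resolve_left h; exact ⟨u, hu, Or.inl hu'⟩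
      · obtain ⟨u, hu, hu'⟩ := ih2.2.resolve_left h; exact ⟨u, hu, Or.inr hu'⟩
    obtain ⟨u, hu, hu'⟩ := this
    refine ⟨?_, Or.inr ⟨u, hu, by simp only [nodes, List.mem_append]; tauto⟩⟩
    rw [derive_node (hC.node_not_mem hu hu'), ih1.1, ih2.1]

theorem Built.ne_empty {C : List MTree} {t : MTree} (h : Built C t) (hC : C ≠ []) :
    t ≠ .empty := by
  cases h with
  | empty => exact absurd rfl hC
  | base h => rintro rfl; exact h rfl
  | node => simp

theorem Built.comp_map {C D : List MTree} {t : MTree} (h : Built D t) (hD : D ⊆ C) :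
    Comp A C (C.map (MTree.hash A x)) t (t.hash A x) := by
  induction h with
  | empty => exact Comp.empty
  | @base t _ =>
    obtain ⟨j, hj⟩ := List.getElem?_of_mem (hD (List.mem_singleton_self t))
    have := Comp.base (A := A) (π := C.map (MTree.hash A x)) hj
    simpa [List.getD, hj] using this
  | @node D1 D2 l r h1 h2 hne ih1 ih2 =>
    refine Comp.node (ih1 fun u hu => hD (by simp [hu])) (ih2 fun u hu => hD (by simp [hu])) ?_
    by_cases h : D1 = []
    · exact Or.inr (h2.ne_empty (by simpa [h] using hne))
    · exact Or.inl (h1.ne_empty h)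

theorem incValid_map {C D : List MTree} {m n : ℕ} (h1 : Built D (mmb m)) (h2 : Built C (mmb n))
    (hD : D ⊆ C) :
    IncValid A C m n (commitment A x m) (commitment A x n) (C.map (MTree.hash A x)) := by
  have hC : Indep C := h2.indep (by rw [leaves_mmb]; exact List.nodup_range')
  exact ⟨by simp, (derive_of_comp hC (by simp) (h1.comp_map hD)).1,
    (derive_of_comp hC (by simp) (h2.comp_map fun _ h => h)).1⟩

/-- In the absence of collisions, the hashes of the members of `C` are determined by the hash of
a tree that is composed of some of them. -/
theorem derive_eq_hash {C D : List MTree} (hC : Indep C) {π : List (Digest ℓ)} {t : MTree}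
    (h : Built D t) (hD : D ⊆ C) {S : List (List Bool)} (hS : ¬ Collides A S S)
    (hS1 : deriveInputs A C π t ⊆ S) (hS2 : t.inputs A x ⊆ S)
    (ht : derive A C π t = t.hash A x) : ∀ u ∈ D, derive A C π u = u.hash A x := by
  induction h with
  | empty => simp
  | base => simpa using ht
  | @node D1 D2 l r h1 h2 hne ih1 ih2 =>
    obtain ⟨u, hu⟩ := List.exists_mem_of_ne_nil _ hne
    have hn : MTree.node l r ∉ C := hC.node_not_mem (hD hu)
      ((List.mem_append.1 hu).imp (h1.mem_nodes u) (h2.mem_nodes u))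
    rw [derive_node hn, MTree.hash] at ht
    rw [deriveInputs, if_neg hn] at hS1
    rw [inputs] at hS2
    have : cat (derive A C π l) (derive A C π r) = cat (l.hash A x) (r.hash A x) := by
      by_contra h
      exact hS ⟨_, hS1 (by simp), _, hS2 (by simp), h, ht⟩
    rw [cat_inj] at this
    intro v hv
    rcases List.mem_append.1 hv with hv | hv
    · exact ih1 (fun u hu => hD (by simp [hu])) (fun a ha => hS1 (by simp [ha]))
        (fun a ha => hS2 (by simp [ha])) this.1 v hv
    · exact ih2 (fun u hu => hD (by simp [hu])) (fun a ha => hS1 (by simp [ha]))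
        (fun a ha => hS2 (by simp [ha])) this.2 v hv

theorem eq_of_hash_eq {S : List (List Bool)} (hS : ¬ Collides A S S) {t : MTree}
    (h1 : t.inputs A x ⊆ S) (h2 : t.inputs A y ⊆ S) (h : t.hash A x = t.hash A y) :
    ∀ i ∈ t.leaves, x i = y i := by
  induction t with
  | empty => simp [leaves]
  | leaf i =>
    simp only [leaves, List.mem_singleton, forall_eq]
    by_contra hne
    exact hS ⟨_, h1 (by simp [inputs]), _, h2 (by simp [inputs]), hne, h⟩
  | node l r ihl ihr =>
    rw [inputs] at h1 h2
    have : cat (l.hash A x) (r.hash A x) = cat (l.hash A y) (r.hash A y) := by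
      by_contra hne
      exact hS ⟨_, h1 (by simp), _, h2 (by simp), hne, h⟩
    rw [cat_inj] at this
    intro i hi
    rcases List.mem_append.1 hi with hi | hi
    · exact ihl (fun a ha => h1 (by simp [ha])) (fun a ha => h2 (by simp [ha])) this.1 i hi
    · exact ihr (fun a ha => h1 (by simp [ha])) (fun a ha => h2 (by simp [ha])) this.2 i hi

theorem inputs_subset {s t : MTree} (h : s ∈ t.nodes) : s.inputs A x ⊆ t.inputs A x := by
  induction t with
  | empty => simp [nodes] at h
  | leaf i => simp only [nodes, List.mem_singleton] at h; simp [h]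
  | node l r ihl ihr =>
    simp only [nodes, List.mem_append, List.mem_singleton] at h
    rcases h with (h | h) | h
    · exact fun i hi => by simp [inputs, ihl h hi]
    · exact fun i hi => by simp [inputs, ihr h hi]
    · simp [h]

theorem increment_sound {C D : List MTree} {m n : ℕ} {π : List (Digest ℓ)}
    (h1 : Built D (mmb m)) (h2 : Built C (mmb n)) (hD : D ⊆ C)
    (h : IncValid A C m n (commitment A x m) (commitment A y n) π)
    (hxy : ∃ i, 1 ≤ i ∧ i ≤ m ∧ x i ≠ y i) :
    Collides A (incTranscript A C m n x y π) (incTranscript A C m n x y π) := by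
  by_contra hS
  have hC : Indep C := h2.indep (by rw [leaves_mmb]; exact List.nodup_range')
  obtain ⟨i, hi1, him, hne⟩ := hxy
  have hi : i ∈ (mmb m).leaves := by rw [leaves_mmb, List.mem_range'_1]; omega
  rw [← h1.leaves, List.mem_flatMap] at hi
  obtain ⟨u, hu, hiu⟩ := hi
  have e1 := derive_eq_hash hC h1 hD hS (fun a ha => by simp [incTranscript, ha])
    (fun a ha => by simp [incTranscript, ha]) h.2.1 u hu
  have e2 := derive_eq_hash hC h2 (fun _ h => h) hS (fun a ha => by simp [incTranscript, ha])
    (fun a ha => by simp [incTranscript, ha]) h.2.2 u (hD hu)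
  refine hne (eq_of_hash_eq hS (fun a ha => ?_) (fun a ha => ?_) (e1.symm.trans e2) i hiu)
  · have := inputs_subset (h1.mem_nodes u hu) ha
    simp [incTranscript, this]
  · have := inputs_subset (h2.mem_nodes u (hD hu)) ha
    simp [incTranscript, this]

/-- The path of a leaf starts with its path in a member `u` of the composing list, and every
nonempty sibling after that contains another member. -/
theorem Built.siblings {C : List MTree} {t : MTree} (h : Built C t) {i : ℕ} (hi : i ∈ t.leaves) :
    ∃ u ∈ C, i ∈ u.leaves ∧ ∃ rest, siblings i t = siblings i u ++ rest ∧
      (rest.filter fun p => p.2 ≠ .empty).length + 1 ≤ C.length := by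
  induction h with
  | empty => simp [MTree.leaves] at hi
  | @base t _ => exact ⟨t, by simp, hi, [], by simp⟩
  | @node D1 D2 l r h1 h2 hne ih1 ih2 =>
    rw [MTree.siblings]
    split
    · rename_i h
      obtain ⟨u, hu, hiu, rest, hr, hl⟩ := ih1 h
      refine ⟨u, by simp [hu], hiu, rest ++ [(false, r)], by simp [hr], ?_⟩
      by_cases he : r = .empty
      · simp [he] at hl ⊢; omega
      · have : 1 ≤ D2.length := by
          cases h2 with
          | empty => exact absurd rfl he
          | base => simp
          | node _ _ hne' => exact List.length_pos_iff.2 hne'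
        simp [he] at hl ⊢; omega
    · rename_i h
      have hi' : i ∈ r.leaves := by simpa [MTree.leaves, h] using hi
      obtain ⟨u, hu, hiu, rest, hr, hl⟩ := ih2 hi'
      refine ⟨u, by simp [hu], hiu, rest ++ [(true, l)], by simp [hr], ?_⟩
      by_cases he : l = .empty
      · simp [he] at hl ⊢; omega
      · have : 1 ≤ D1.length := by
          cases h1 with
          | empty => exact absurd rfl he
          | base => simp
          | node _ _ hne' => exact List.length_pos_iff.2 hne'
        simp [he] at hl ⊢; omega

end

/-! ### The effect of a carry on the bagging -/

theorem shr_add_eq {M N q : ℕ} (h : N >>> q = M >>> q) {r : ℕ} (hr : q ≤ r) :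
    N >>> r = M >>> r := by
  obtain ⟨d, rfl⟩ := Nat.exists_eq_add_of_le hr
  rw [Nat.shiftRight_add, Nat.shiftRight_add, h]

/-- The state of the bagging at `q` depends only on the bits at the positions `q - 1` and above. -/
theorem st_congr {M N r q : ℕ} (h : N >>> r = M >>> r) (hr : r < q) : st N q = st M q := by
  induction hn : N >>> q using Nat.strong_induction_on generalizing q with
  | _ H ih =>
    subst hn
    have e0 := shr_add_eq h hr.le
    have e1 := shr_add_eq h (show r ≤ q + 1 by omega)
    have e2 := shr_add_eq h (show r ≤ q - 1 by omega)
    have hm : mtn N q = mtn M q := by rw [mtn, mtn, e0]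
    have hc : Closes N q ↔ Closes M q := by rw [Closes, Closes, e0, e1, e2]
    by_cases h1 : N >>> q ≤ 1
    · rw [st.eq_1 N q, st.eq_1 M q, if_pos h1, if_pos (by rw [← e0]; exact h1)]
    · have := ih (N >>> (q + 1)) (by rw [shr_succ]; omega) (q := q + 1) (by omega) rfl
      rw [st.eq_1 N q, st.eq_1 M q, if_neg h1,
        if_neg (c := M >>> q ≤ 1) (by rw [← e0]; exact h1), this, hm]
      exact if_congr hc rfl rfl

theorem bel_congr {M N r q : ℕ} (h : N >>> r = M >>> r) (hr : r < q) : bel N q = bel M q := by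
  rw [bel, bel, st_congr h hr]

theorem chn_congr {M N r q : ℕ} (h : N >>> r = M >>> r) (hr : r < q) : chn N q = chn M q := by
  rw [chn, chn, st_congr h hr]

/-- The lowest bit of a positive number, as it is computed with bitwise operations. -/
theorem lowbit (x : ℕ) (hx : 1 ≤ x) : ∃ j, x - (x &&& (x - 1)) = 2 ^ j ∧ (x >>> j) % 2 = 1 ∧
    ∀ t < j, (x >>> t) % 2 = 0 := by
  induction x using Nat.strong_induction_on with
  | _ x ih =>
    rcases Nat.mod_two_eq_zero_or_one x with hb | hb
    · obtain ⟨j, h1, h2, h3⟩ := ih (x / 2) (by omega) (by omega)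
      refine ⟨j + 1, ?_, ?_, ?_⟩
      · have e : (x &&& (x - 1)) = 2 * (x / 2 &&& (x / 2 - 1)) := by
          have hd : (x &&& (x - 1)) / 2 = x / 2 &&& (x - 1) / 2 := by
            have := Nat.shiftRight_and_distrib (a := x) (b := x - 1) (i := 1)
            simpa [Nat.shiftRight_one] using this
          have hm : (x &&& (x - 1)) % 2 = 0 := by
            have := Nat.and_mod_two_pow (a := x) (b := x - 1) (n := 1)
            rw [pow_one, hb] at this
            simpa using this
          rw [show (x - 1) / 2 = x / 2 - 1 by omega] at hd
          omega
        have hle : x / 2 &&& (x / 2 - 1) ≤ x / 2 := Nat.and_le_left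
        rw [e, pow_succ]
        omega
      · rwa [Nat.add_comm, Nat.shiftRight_add, Nat.shiftRight_one]
      · intro t ht
        cases t with
        | zero => simpa using hb
        | succ t =>
          rw [Nat.add_comm, Nat.shiftRight_add, Nat.shiftRight_one]
          exact h3 t (by omega)
    · refine ⟨0, ?_, by simpa using hb, by simp⟩
      have hd : (x &&& (x - 1)) / 2 = x / 2 &&& (x - 1) / 2 := by
        have := Nat.shiftRight_and_distrib (a := x) (b := x - 1) (i := 1)
        simpa [Nat.shiftRight_one] using this
      have hm : (x &&& (x - 1)) % 2 = 0 := by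
        have := Nat.and_mod_two_pow (a := x) (b := x - 1) (n := 1)
        rw [pow_one, show (x - 1) % 2 = 0 by omega] at this
        simpa using this
      rw [show (x - 1) / 2 = x / 2 by omega, Nat.and_self] at hd
      rw [pow_zero]
      omega

/-- From the level `L` on, `N` is the binary successor of `M`, and the carry ends at the
position `P`. -/
structure Carry (M N L P : ℕ) : Prop where
  le : L ≤ P
  succ : ∀ q, L ≤ q → q ≤ P → N >>> q = M >>> q + 1
  odd : ∀ q, L ≤ q → q < P → (M >>> q) % 2 = 1
  even : (M >>> P) % 2 = 0
  above : ∀ q, P < q → N >>> q = M >>> q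

theorem exists_carry {M N L : ℕ} (h : N >>> L = M >>> L + 1) :
    ∃ P, Carry M N L P ∧ N >>> L - (N >>> L &&& M >>> L) = 2 ^ (P - L) := by
  obtain ⟨j, h1, h2, h3⟩ := lowbit (N >>> L) (by rw [h]; exact Nat.succ_pos _)
  have key : ∀ t, t ≤ j → N >>> (L + t) = M >>> (L + t) + 1 := by
    intro t
    induction t with
    | zero => intro _; exact h
    | succ t ih =>
      intro ht
      have e := ih (by omega)
      have := h3 t (by omega)
      rw [← Nat.shiftRight_add] at this
      rw [← Nat.add_assoc, shr_succ, shr_succ]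
      omega
  rw [← Nat.shiftRight_add] at h2
  refine ⟨L + j, ⟨by omega, ?_, ?_, ?_, ?_⟩, ?_⟩
  · intro q hq1 hq2
    obtain ⟨t, rfl⟩ := Nat.exists_eq_add_of_le hq1
    exact key t (by omega)
  · intro q hq1 hq2
    obtain ⟨t, rfl⟩ := Nat.exists_eq_add_of_le hq1
    have h4 := key t (by omega)
    have h5 := h3 t (by omega)
    rw [← Nat.shiftRight_add] at h5
    omega
  · have := key j le_rfl
    omega
  · intro q hq
    have := key j le_rfl
    have e : N >>> (L + j + 1) = M >>> (L + j + 1) := by rw [shr_succ, shr_succ]; omega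
    exact shr_add_eq e hq
  · rw [h, Nat.add_sub_cancel] at h1
    rw [h, h1, Nat.add_sub_cancel_left]

namespace Carry

variable {M N L P : ℕ}

theorem shr_old (hc : Carry M N L P) : M >>> P = 2 * M >>> (P + 1) := by
  have := hc.even; rw [shr_succ]; omega

theorem shr_new (hc : Carry M N L P) : N >>> P = 2 * M >>> (P + 1) + 1 := by
  rw [hc.succ P hc.le le_rfl, hc.shr_old]

theorem above_succ (hc : Carry M N L P) : N >>> (P + 1) = M >>> (P + 1) := hc.above _ (by omega)

theorem four_le (hc : Carry M N L P) {q : ℕ} (h1 : L ≤ q) (h2 : q + 2 ≤ P) :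
    4 ≤ N >>> q ∧ 3 ≤ M >>> q := by
  obtain ⟨d, rfl⟩ := Nat.exists_eq_add_of_le h2
  have hs := hc.shr_new
  have e : N >>> (q + 2 + d) = N >>> q / 2 / 2 / 2 ^ d := by
    rw [Nat.shiftRight_add, shr_succ, shr_succ, Nat.shiftRight_eq_div_pow (_ / 2 / 2)]
  have : N >>> q / 2 / 2 / 2 ^ d ≤ N >>> q / 2 / 2 := Nat.div_le_self _ _
  have := hc.succ q h1 (by omega)
  omega

theorem closes_old_succ (hc : Carry M N L P) :
    Closes M (P + 1) ↔ (M >>> (P + 1)) % 2 = 1 := by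
  have := hc.even
  simp [Closes, this]

theorem closes_new_succ (hc : Carry M N L P) :
    Closes N (P + 1) ↔ (M >>> (P + 1)) % 2 = 1 ∧ (M >>> (P + 2)) % 2 = 0 := by
  have h1 := hc.shr_new
  have h2 := hc.above (P + 1) (by omega)
  have h3 := hc.above (P + 2) (by omega)
  simp only [Closes, Nat.add_sub_cancel, h1, h2, show P + 1 + 1 = P + 2 from rfl, h3]
  omega

/-- Above the carry, the two baggings differ only in that the old one may have closed a range that
the new one continues. -/
theorem st_old_succ (hc : Carry M N L P) :
    (((M >>> (P + 1)) % 2 = 1 ∧ (M >>> (P + 2)) % 2 = 1) →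
      bel M (P + 1) = .node (bel N (P + 1)) (chn N (P + 1)) ∧ chn M (P + 1) = .empty ∧
      chn N (P + 1) = .node (chn N (P + 2)) (mtn N (P + 1))) ∧
    (¬ ((M >>> (P + 1)) % 2 = 1 ∧ (M >>> (P + 2)) % 2 = 1) →
      bel M (P + 1) = bel N (P + 1) ∧ chn M (P + 1) = chn N (P + 1)) := by
  have hco := hc.closes_old_succ
  have hcn := hc.closes_new_succ
  have h1 := hc.above (P + 1) (by omega)
  have eb : bel N (P + 2) = bel M (P + 2) := bel_congr h1 (by omega)
  have ec : chn N (P + 2) = chn M (P + 2) := chn_congr h1 (by omega)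
  have em : mtn N (P + 1) = mtn M (P + 1) := by rw [mtn, mtn, h1]
  have hs := shr_succ M (P + 1)
  rw [show P + 1 + 1 = P + 2 from rfl] at hs
  constructor
  · rintro ⟨h2, h3⟩
    have hge : 2 ≤ M >>> (P + 1) := by
      by_contra h0
      rw [Nat.div_eq_of_lt (not_le.1 h0)] at hs
      rw [hs] at h3
      exact absurd h3 (by norm_num)
    have hn : ¬ Closes N (P + 1) := fun hn => by have := (hcn.1 hn).2; omega
    rw [bel_close hge (hco.2 h2), chn_close (hco.2 h2), bel_open hn,
      chn_open (N := N) (by omega) hn, eb, ec, em]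
    exact ⟨rfl, rfl, rfl⟩
  · intro h
    by_cases hge : 2 ≤ M >>> (P + 1)
    · by_cases h2 : (M >>> (P + 1)) % 2 = 1
      · have hn : Closes N (P + 1) := hcn.2 (by omega)
        rw [bel_close hge (hco.2 h2), chn_close (hco.2 h2), bel_close (by omega) hn, chn_close hn,
          eb, ec, em]
        exact ⟨rfl, rfl⟩
      · have hn : ¬ Closes N (P + 1) := by rw [hcn]; omega
        have ho : ¬ Closes M (P + 1) := by rw [hco]; omega
        rw [bel_open hn, bel_open ho, chn_open hge ho, chn_open (by omega) hn, eb, ec, em]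
        exact ⟨rfl, rfl⟩
    · rw [bel_top (by omega), bel_top (by omega), chn_top (by omega), chn_top (by omega)]
      exact ⟨rfl, rfl⟩

theorem closes_new (hc : Carry M N L P) (h : L < P) : Closes N P := by
  have h1 := hc.shr_new
  have h2 := hc.succ (P - 1) (by omega) (by omega)
  have h3 := hc.odd (P - 1) (by omega) (by omega)
  exact Or.inr ⟨by omega, by omega⟩

theorem not_closes_new (hc : Carry M N L P) {q : ℕ} (h0 : 1 ≤ q) (h1 : L ≤ q) (h2 : q < P) :
    ¬ Closes N q := by
  have h3 := hc.succ q h1 h2.le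
  have h4 := hc.odd q h1 h2
  rw [Closes]; omega

theorem not_closes_old (hc : Carry M N L P) (h : 1 ≤ P) : ¬ Closes M P := by
  have := hc.even
  rw [Closes]; omega

theorem closes_old (hc : Carry M N L P) (h : L < P) : Closes M (P - 1) := by
  have h1 := hc.odd (P - 1) (by omega) (by omega)
  have h2 := hc.even
  exact Or.inr ⟨by omega, by rw [show P - 1 + 1 = P by omega]; omega⟩

theorem not_closes_old_run (hc : Carry M N L P) {q : ℕ} (h1 : L < q) (h2 : q + 1 < P) :
    ¬ Closes M q := by
  have h3 := hc.odd q (by omega) (by omega)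
  have h4 := hc.odd (q + 1) (by omega) (by omega)
  have h5 := hc.odd (q - 1) (by omega) (by omega)
  rw [Closes]; omega

theorem mtn_old (hc : Carry M N L P) : mtn M P = blk P (2 * M >>> (P + 1) - 2) := by
  rw [mtn_even hc.even, hc.shr_old]

theorem mtn_old_pred (hc : Carry M N L P) (h : L < P) :
    mtn M (P - 1) = blk P (2 * M >>> (P + 1) - 1) := by
  rw [mtn_odd (hc.odd (P - 1) (by omega) (by omega)), ← shr_succ, show P - 1 + 1 = P by omega,
    hc.shr_old]

/-- The merge: the two mountains of equal height become the two halves of a new one. -/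
theorem mtn_new (hc : Carry M N L P) (hG : 1 ≤ M >>> (P + 1)) : mtn N P =
    .node (blk P (2 * M >>> (P + 1) - 2)) (blk P (2 * M >>> (P + 1) - 1)) := by
  rw [mtn_odd (by rw [hc.shr_new]; omega), hc.shr_new, blk]
  rw [show 2 * ((2 * M >>> (P + 1) + 1) / 2 - 1) = 2 * M >>> (P + 1) - 2 by omega,
    show 2 * M >>> (P + 1) - 2 + 1 = 2 * M >>> (P + 1) - 1 by omega]

theorem mtn_shift (hc : Carry M N L P) {q : ℕ} (h1 : L ≤ q) (h2 : q + 1 < P) :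
    mtn N (q + 1) = mtn M q := by
  have h3 := hc.odd q h1 (by omega)
  have h4 := hc.odd (q + 1) (by omega) h2
  have h5 := hc.succ (q + 1) (by omega) h2.le
  rw [mtn_odd h3, mtn_even (by omega), ← shr_succ, h5]
  rfl

theorem mtn_low (hc : Carry M N L P) (h : L < P) : mtn N L = blk L (M >>> L - 1) := by
  have h3 := hc.odd L le_rfl h
  have h5 := hc.succ L le_rfl h.le
  rw [mtn_even (by omega), h5]
  rfl

theorem bel_new (hc : Carry M N L P) (h : L < P) (hG : 1 ≤ M >>> (P + 1)) :
    bel N P = .node (bel N (P + 1)) (.node (chn N (P + 1)) (mtn N P)) :=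
  bel_close (by rw [hc.shr_new]; omega) (hc.closes_new h)

theorem bel_old_pred (hc : Carry M N L P) (h : L < P) (hG : 1 ≤ M >>> (P + 1)) :
    bel M (P - 1) = .node (bel M (P + 1)) (.node (.node (chn M (P + 1)) (mtn M P)) (mtn M (P - 1))) := by
  have ho := hc.not_closes_old (by omega)
  have h2 := hc.shr_old
  have h3 := shr_succ M (P - 1)
  rw [show P - 1 + 1 = P by omega] at h3
  rw [bel_close (by omega) (hc.closes_old h), show P - 1 + 1 = P by omega, bel_open ho,
    chn_open (by omega) ho]

/-- The range to the right of the merge is shifted by one mountain index. -/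
theorem chn_shift (hc : Carry M N L P) (d q : ℕ) (h1 : L < q) (h2 : q + 1 + d = P) :
    chn M q = chn N (q + 1) ∧ bel M q = bel M (P - 1) ∧ bel N (q + 1) = bel N P := by
  induction d generalizing q with
  | zero =>
    obtain rfl : P = q + 1 := by omega
    refine ⟨?_, rfl, rfl⟩
    rw [chn_close (q := q) (hc.closes_old (by omega)), chn_close (hc.closes_new (by omega))]
  | succ d ih =>
    obtain ⟨i1, i2, i3⟩ := ih (q + 1) (by omega) (by omega)
    have hn := hc.not_closes_new (q := q + 1) (by omega) (by omega) (by omega)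
    have ho := hc.not_closes_old_run (q := q) (by omega) (by omega)
    have h4 := hc.four_le (q := q) (by omega) (by omega)
    have h5 := shr_succ N q
    rw [chn_open (by omega) ho, chn_open (N := N) (by omega) hn, bel_open ho, bel_open hn, i1, i2,
      i3, hc.mtn_shift (by omega) (by omega)]
    exact ⟨rfl, rfl, rfl⟩

/-- The chain of the range to the right of the merge, before the new block is added to it. -/
theorem chn_new_low (hc : Carry M N L P) (h : L + 2 ≤ P) :
    chn N (L + 1) = .node (chn M (L + 1)) (mtn M L) ∧ bel N (L + 1) = bel N P ∧
      bel M (L + 1) = bel M (P - 1) := by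
  obtain ⟨d, rfl⟩ := Nat.exists_eq_add_of_le h
  obtain ⟨i1, i2, i3⟩ := hc.chn_shift d (L + 1) (by omega) (by omega)
  have hn := hc.not_closes_new (q := L + 1) (by omega) (by omega) (by omega)
  have h2 := hc.succ (L + 1) (by omega) (by omega)
  have h3 := hc.odd (L + 1) (by omega) (by omega)
  have h4 : 1 ≤ M >>> (L + 1) := by
    by_contra h0
    rw [Nat.lt_one_iff.1 (not_le.1 h0)] at h3
    exact absurd h3 (by norm_num)
  exact ⟨by rw [chn_open (by omega) hn, i1, hc.mtn_shift le_rfl (by omega)],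
    by rw [bel_open hn, i3], i2⟩

end Carry

/-! ### Symbolic execution of programs -/

section

variable {ℓ : ℕ}

/-- The value of an expression, when no bound is violated. -/
def Expr.val (s : St ℓ) : Expr → ℕ
  | .const v => v
  | .cell a => s.words (a.val s)
  | .op o a b => o.apply (a.val s) (b.val s)
  | .log2 a => Nat.log 2 (a.val s)
  | .sameHash a b => if s.digs (a.val s) = s.digs (b.val s) then 1 else 0

/-- A sufficient condition for the evaluation of an expression to stay within the bounds. Only
for the operations whose result can exceed both arguments the result has to be checked. -/
def Expr.Ok (E : Env ℓ) (s : St ℓ) : Expr → Prop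
  | .const v => v < E.bound
  | .cell a => a.Ok E s ∧ a.val s < E.space ∧ s.words (a.val s) < E.bound
  | .op o a b => a.Ok E s ∧ b.Ok E s ∧
      match o with
      | .add => a.val s + b.val s < E.bound
      | .mul => a.val s * b.val s < E.bound
      | .shl => a.val s <<< b.val s < E.bound
      | .or => a.val s ||| b.val s < E.bound
      | .xor => a.val s ^^^ b.val s < E.bound
      | _ => True
  | .log2 a => a.Ok E s
  | .sameHash a b => a.Ok E s ∧ b.Ok E s ∧ a.val s < E.space ∧ b.val s < E.space

theorem Expr.Ok.eval {E : Env ℓ} {s : St ℓ} (h1 : 1 < E.bound) {e : Expr} (h : e.Ok E s) :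
    Eval E s e (e.val s) ∧ e.val s < E.bound := by
  induction e with
  | const v => exact ⟨Eval.const h, h⟩
  | cell a ih => exact ⟨Eval.cell (ih h.1).1 h.2.1 h.2.2, h.2.2⟩
  | op o a b iha ihb =>
    obtain ⟨ha, hb, ho⟩ := h
    have iha := iha ha
    have ihb := ihb hb
    have : o.apply (a.val s) (b.val s) < E.bound := by
      cases o
      case add => exact ho
      case mul => exact ho
      case shl => exact ho
      case or => exact ho
      case xor => exact ho
      case sub => exact (Nat.sub_le _ _).trans_lt iha.2
      case div => exact (Nat.div_le_self _ _).trans_lt iha.2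
      case mod => exact (Nat.mod_le _ _).trans_lt iha.2
      case and => exact Nat.and_le_left.trans_lt iha.2
      case shr => exact (Nat.shiftRight_le _ _).trans_lt iha.2
      case lt => simp only [Op.apply]; split <;> omega
      case eq => simp only [Op.apply]; split <;> omega
    exact ⟨Eval.op iha.1 ihb.1 this, this⟩
  | log2 a ih =>
    have ih := ih h
    exact ⟨Eval.log2 ih.1, (Nat.log_le_self _ _).trans_lt ih.2⟩
  | sameHash a b iha ihb =>
    obtain ⟨ha, hb, hp, hq⟩ := h
    rw [Expr.val]
    split
    · rename_i he
      exact ⟨Eval.same (iha ha).1 (ihb hb).1 hp hq he h1, h1⟩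
    · rename_i he
      exact ⟨Eval.differ (iha ha).1 (ihb hb).1 hp hq he h1, by omega⟩

/-- Replace the rest of the incoming message. -/
def St.setInbox (s : St ℓ) (μ : List (Digest ℓ)) : St ℓ := { s with inbox := μ }

/-- Publish a hash value. -/
def St.push (s : St ℓ) (d : Digest ℓ) : St ℓ := { s with outbox := s.outbox ++ [d] }

/-- The state after receiving a hash value into the cell `p`, with the success flag at `q`. -/
def St.receive (s : St ℓ) (p q : ℕ) : St ℓ :=
  match s.inbox with
  | [] => s.setWord q 0
  | d :: ds => ((s.setDig p d).setWord q 1).setInbox ds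

section projections

variable (s : St ℓ) (p q v : ℕ) (d : Digest ℓ) (μ : List (Digest ℓ))

@[simp] theorem words_setWord : (s.setWord p v).words q = if q = p then v else s.words q := by
  simp [St.setWord, Function.update_apply]
@[simp] theorem digs_setWord : (s.setWord p v).digs = s.digs := rfl
@[simp] theorem inbox_setWord : (s.setWord p v).inbox = s.inbox := rfl
@[simp] theorem outbox_setWord : (s.setWord p v).outbox = s.outbox := rfl
@[simp] theorem digs_setDig : (s.setDig p d).digs q = if q = p then d else s.digs q := by
  simp [St.setDig, Function.update_apply]
@[simp] theorem words_setDig : (s.setDig p d).words = s.words := rfl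
@[simp] theorem inbox_setDig : (s.setDig p d).inbox = s.inbox := rfl
@[simp] theorem outbox_setDig : (s.setDig p d).outbox = s.outbox := rfl
@[simp] theorem words_setInbox : (s.setInbox μ).words = s.words := rfl
@[simp] theorem digs_setInbox : (s.setInbox μ).digs = s.digs := rfl
@[simp] theorem inbox_setInbox : (s.setInbox μ).inbox = μ := rfl
@[simp] theorem outbox_setInbox : (s.setInbox μ).outbox = s.outbox := rfl
@[simp] theorem words_push : (s.push d).words = s.words := rfl
@[simp] theorem digs_push : (s.push d).digs = s.digs := rfl
@[simp] theorem inbox_push : (s.push d).inbox = s.inbox := rfl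
@[simp] theorem outbox_push : (s.push d).outbox = s.outbox ++ [d] := rfl

end projections

/-- The number of steps of a loop-free program is at most its cost. -/
def Cmd.cost : Cmd → ℕ
  | .set a e => 1 + a.size + e.size
  | .copy a b => 1 + a.size + b.size
  | .null a => 1 + a.size
  | .hash a b c => 1 + a.size + b.size + c.size
  | .recv a b => 1 + a.size + b.size
  | .emit a => 1 + a.size
  | .seq P Q => P.cost + Q.cost
  | .ite e P Q => 1 + e.size + P.cost + Q.cost
  | .loop _ _ => 0

/-- A precondition under which a loop-free program halts within the bounds and with the
postcondition `Q`. -/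
def Cmd.Pre (E : Env ℓ) : Cmd → (St ℓ → Prop) → St ℓ → Prop
  | .set a e, Q, s => a.Ok E s ∧ a.val s < E.space ∧ e.Ok E s ∧ Q (s.setWord (a.val s) (e.val s))
  | .copy a b, Q, s => a.Ok E s ∧ a.val s < E.space ∧ b.Ok E s ∧ b.val s < E.space ∧
      Q (s.setDig (a.val s) (s.digs (b.val s)))
  | .null a, Q, s => a.Ok E s ∧ a.val s < E.space ∧ Q (s.setDig (a.val s) E.A.dflt)
  | .hash a b c, Q, s => a.Ok E s ∧ a.val s < E.space ∧ b.Ok E s ∧ b.val s < E.space ∧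
      c.Ok E s ∧ c.val s < E.space ∧
      Q (s.setDig (a.val s) (E.A.H (cat (s.digs (b.val s)) (s.digs (c.val s)))))
  | .recv a b, Q, s => a.Ok E s ∧ a.val s < E.space ∧ b.Ok E s ∧ b.val s < E.space ∧
      Q (s.receive (a.val s) (b.val s))
  | .emit a, Q, s => a.Ok E s ∧ a.val s < E.space ∧ Q (s.push (s.digs (a.val s)))
  | .seq P R, Q, s => P.Pre E (fun s' => R.Pre E Q s') s
  | .ite e P R, Q, s => e.Ok E s ∧ (e.val s ≠ 0 → P.Pre E Q s) ∧ (e.val s = 0 → R.Pre E Q s)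
  | .loop _ _, _, _ => False

theorem Cmd.Pre.mono {E : Env ℓ} {P : Cmd} {s : St ℓ} {Q Q' : St ℓ → Prop} (h : P.Pre E Q s)
    (hQ : ∀ s', Q s' → Q' s') : P.Pre E Q' s := by
  induction P generalizing s Q Q' with
  | set | copy | null | hash | recv | emit => simp only [Cmd.Pre] at h ⊢; tauto
  | seq P R ihP ihR => exact ihP h fun s' h' => ihR h' hQ
  | ite e P R ihP ihR => exact ⟨h.1, fun h0 => ihP (h.2.1 h0) hQ, fun h0 => ihR (h.2.2 h0) hQ⟩
  | loop => exact h.elim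

theorem RunsIn.mono {E : Env ℓ} {P : Cmd} {s : St ℓ} {T T' : ℕ} {Q Q' : St ℓ → Prop}
    (h : RunsIn E P s T Q) (hT : T ≤ T') (hQ : ∀ s', Q s' → Q' s') : RunsIn E P s T' Q' := by
  obtain ⟨t, s', h1, h2, h3⟩ := h
  exact ⟨t, s', h1, h2.trans hT, hQ _ h3⟩

theorem RunsIn.seq {E : Env ℓ} {P R : Cmd} {s : St ℓ} {T U : ℕ} {Q Q' : St ℓ → Prop}
    (h : RunsIn E P s T Q) (h' : ∀ s', Q s' → RunsIn E R s' U Q') :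
    RunsIn E (.seq P R) s (T + U) Q' := by
  obtain ⟨t, s', h1, h2, h3⟩ := h
  obtain ⟨u, s'', h4, h5, h6⟩ := h' s' h3
  exact ⟨t + u, s'', Exec.seq h1 h4, by omega, h6⟩

theorem runsIn_of_pre {E : Env ℓ} (h1 : 1 < E.bound) {P : Cmd} {s : St ℓ} {Q : St ℓ → Prop}
    (h : P.Pre E Q s) : RunsIn E P s P.cost Q := by
  induction P generalizing s Q with
  | set a e =>
    obtain ⟨ha, hp, he, hQ⟩ := h
    exact ⟨_, _, Exec.set ⟨(ha.eval h1).1, hp⟩ (he.eval h1).1, le_rfl, hQ⟩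
  | copy a b =>
    obtain ⟨ha, hp, hb, hq, hQ⟩ := h
    exact ⟨_, _, Exec.copy ⟨(ha.eval h1).1, hp⟩ ⟨(hb.eval h1).1, hq⟩, le_rfl, hQ⟩
  | null a =>
    obtain ⟨ha, hp, hQ⟩ := h
    exact ⟨_, _, Exec.null ⟨(ha.eval h1).1, hp⟩, le_rfl, hQ⟩
  | hash a b c =>
    obtain ⟨ha, hp, hb, hq, hc, hr, hQ⟩ := h
    exact ⟨_, _, Exec.hash ⟨(ha.eval h1).1, hp⟩ ⟨(hb.eval h1).1, hq⟩ ⟨(hc.eval h1).1, hr⟩,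
      le_rfl, hQ⟩
  | recv a b =>
    obtain ⟨ha, hp, hb, hq, hQ⟩ := h
    cases hi : s.inbox with
    | nil =>
      rw [St.receive, hi] at hQ
      exact ⟨_, _, Exec.recvNone ⟨(ha.eval h1).1, hp⟩ ⟨(hb.eval h1).1, hq⟩ h1 hi, le_rfl, hQ⟩
    | cons d ds =>
      rw [St.receive, hi] at hQ
      exact ⟨_, _, Exec.recv ⟨(ha.eval h1).1, hp⟩ ⟨(hb.eval h1).1, hq⟩ h1 hi, le_rfl, hQ⟩
  | emit a =>
    obtain ⟨ha, hp, hQ⟩ := h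
    exact ⟨_, _, Exec.emit ⟨(ha.eval h1).1, hp⟩, le_rfl, hQ⟩
  | seq P R ihP ihR => exact (ihP h).seq fun s' h' => ihR h'
  | ite e P R ihP ihR =>
    obtain ⟨he, hP, hR⟩ := h
    have hv := (he.eval h1).1
    by_cases h0 : e.val s = 0
    · obtain ⟨t, s', h4, h5, h6⟩ := ihR (hR h0)
      rw [h0] at hv
      exact ⟨_, s', Exec.iteFalse hv h4, by simp only [Cmd.cost]; omega, h6⟩
    · obtain ⟨t, s', h4, h5, h6⟩ := ihP (hP h0)
      exact ⟨_, s', Exec.iteTrue hv h0 h4, by simp only [Cmd.cost]; omega, h6⟩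
  | loop e P _ => exact h.elim

/-- A loop with the invariant `I k`, where `k` is the number of remaining iterations. -/
theorem RunsIn.loop {E : Env ℓ} (h1 : 1 < E.bound) {e : Expr} {P : Cmd} {T : ℕ}
    (I : ℕ → St ℓ → Prop)
    (hstep : ∀ k s, I (k + 1) s → e.Ok E s ∧ e.val s ≠ 0 ∧ RunsIn E P s T (I k))
    (hexit : ∀ s, I 0 s → e.Ok E s ∧ e.val s = 0) (k : ℕ) (s : St ℓ) (h : I k s) :
    RunsIn E (.loop e P) s (k * (1 + e.size + T) + (1 + e.size)) (I 0) := by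
  induction k generalizing s with
  | zero =>
    obtain ⟨he, h0⟩ := hexit s h
    have hv := (he.eval h1).1
    rw [h0] at hv
    exact ⟨_, s, Exec.loopFalse hv, by omega, h⟩
  | succ k ih =>
    obtain ⟨he, h0, t, s', h2, h3, h4⟩ := hstep k s h
    obtain ⟨u, s'', h5, h6, h7⟩ := ih s' h4
    refine ⟨_, s'', Exec.loopTrue (he.eval h1).1 h0 h2 h5, ?_, h7⟩
    rw [Nat.succ_mul]
    omega

/-! ### Notation for expressions -/

instance (n : ℕ) : OfNat Expr n := ⟨.const n⟩
instance : Add Expr := ⟨.op .add⟩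
instance : Sub Expr := ⟨.op .sub⟩
instance : Mul Expr := ⟨.op .mul⟩
instance : Div Expr := ⟨.op .div⟩
instance : Mod Expr := ⟨.op .mod⟩
instance : HAnd Expr Expr Expr := ⟨.op .and⟩
instance : HXor Expr Expr Expr := ⟨.op .xor⟩
instance : HShiftLeft Expr Expr Expr := ⟨.op .shl⟩
instance : HShiftRight Expr Expr Expr := ⟨.op .shr⟩

/-- The word variable that is kept in the cell `k`. -/
def var (k : ℕ) : Expr := .cell (.const k)

/-- Assignment to a word variable. -/
def assign (k : ℕ) (e : Expr) : Cmd := .set (.const k) e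

/-- The comparison `<` of words. -/
def ltE (a b : Expr) : Expr := .op .lt a b

/-- The comparison `=` of words. -/
def eqE (a b : Expr) : Expr := .op .eq a b

/-- Sequential composition. -/
instance : Append Cmd := ⟨Cmd.seq⟩

section simp_lemmas

variable (E : Env ℓ) (s : St ℓ) (a b : Expr) (n k : ℕ)

@[simp] theorem val_ofNat : Expr.val s (ofNat(n) : Expr) = n := rfl
@[simp] theorem val_const : Expr.val s (.const n) = n := rfl
@[simp] theorem val_cell : Expr.val s (.cell a) = s.words (a.val s) := rfl
@[simp] theorem val_log2 : Expr.val s (.log2 a) = Nat.log 2 (a.val s) := rfl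
@[simp] theorem val_same : Expr.val s (.sameHash a b) =
    if s.digs (a.val s) = s.digs (b.val s) then 1 else 0 := rfl
@[simp] theorem val_add : Expr.val s (a + b) = a.val s + b.val s := rfl
@[simp] theorem val_sub : Expr.val s (a - b) = a.val s - b.val s := rfl
@[simp] theorem val_mul : Expr.val s (a * b) = a.val s * b.val s := rfl
@[simp] theorem val_div : Expr.val s (a / b) = a.val s / b.val s := rfl
@[simp] theorem val_mod : Expr.val s (a % b) = a.val s % b.val s := rfl
@[simp] theorem val_and : Expr.val s (a &&& b) = a.val s &&& b.val s := rfl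
@[simp] theorem val_xor : Expr.val s (a ^^^ b) = a.val s ^^^ b.val s := rfl
@[simp] theorem val_shl : Expr.val s (a <<< b) = a.val s <<< b.val s := rfl
@[simp] theorem val_shr : Expr.val s (a >>> b) = a.val s >>> b.val s := rfl
@[simp] theorem val_lt : Expr.val s (ltE a b) = if a.val s < b.val s then 1 else 0 := rfl
@[simp] theorem val_eq : Expr.val s (eqE a b) = if a.val s = b.val s then 1 else 0 := rfl
@[simp] theorem val_var : Expr.val s (var k) = s.words k := rfl

@[simp] theorem ok_ofNat : Expr.Ok E s (ofNat(n) : Expr) ↔ n < E.bound := Iff.rfl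
@[simp] theorem ok_const : Expr.Ok E s (.const n) ↔ n < E.bound := Iff.rfl
@[simp] theorem ok_log2 : Expr.Ok E s (.log2 a) ↔ a.Ok E s := Iff.rfl
@[simp] theorem ok_same : Expr.Ok E s (.sameHash a b) ↔
    a.Ok E s ∧ b.Ok E s ∧ a.val s < E.space ∧ b.val s < E.space := Iff.rfl
@[simp] theorem ok_add : Expr.Ok E s (a + b) ↔
    a.Ok E s ∧ b.Ok E s ∧ a.val s + b.val s < E.bound := Iff.rfl
@[simp] theorem ok_mul : Expr.Ok E s (a * b) ↔
    a.Ok E s ∧ b.Ok E s ∧ a.val s * b.val s < E.bound := Iff.rfl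
@[simp] theorem ok_xor : Expr.Ok E s (a ^^^ b) ↔
    a.Ok E s ∧ b.Ok E s ∧ a.val s ^^^ b.val s < E.bound := Iff.rfl
@[simp] theorem ok_shl : Expr.Ok E s (a <<< b) ↔
    a.Ok E s ∧ b.Ok E s ∧ a.val s <<< b.val s < E.bound := Iff.rfl
@[simp] theorem ok_sub : Expr.Ok E s (a - b) ↔ a.Ok E s ∧ b.Ok E s := by
  simp [HSub.hSub, Sub.sub, Expr.Ok]
@[simp] theorem ok_div : Expr.Ok E s (a / b) ↔ a.Ok E s ∧ b.Ok E s := by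
  simp [HDiv.hDiv, Div.div, Expr.Ok]
@[simp] theorem ok_mod : Expr.Ok E s (a % b) ↔ a.Ok E s ∧ b.Ok E s := by
  simp [HMod.hMod, Expr.Ok]
@[simp] theorem ok_and : Expr.Ok E s (a &&& b) ↔ a.Ok E s ∧ b.Ok E s := by
  simp [HAnd.hAnd, Expr.Ok]
@[simp] theorem ok_shr : Expr.Ok E s (a >>> b) ↔ a.Ok E s ∧ b.Ok E s := by
  simp [HShiftRight.hShiftRight, Expr.Ok]
@[simp] theorem ok_lt : Expr.Ok E s (ltE a b) ↔ a.Ok E s ∧ b.Ok E s := by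
  simp [ltE, Expr.Ok]
@[simp] theorem ok_eq : Expr.Ok E s (eqE a b) ↔ a.Ok E s ∧ b.Ok E s := by
  simp [eqE, Expr.Ok]
@[simp] theorem ok_var : Expr.Ok E s (var k) ↔
    k < E.bound ∧ k < E.space ∧ s.words k < E.bound := Iff.rfl

variable (Q : St ℓ → Prop) (P R : Cmd) (c : Expr)

@[simp] theorem pre_assign : (assign k a).Pre E Q s ↔
    k < E.bound ∧ k < E.space ∧ a.Ok E s ∧ Q (s.setWord k (a.val s)) := Iff.rfl
@[simp] theorem pre_copy : (Cmd.copy a b).Pre E Q s ↔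
    a.Ok E s ∧ a.val s < E.space ∧ b.Ok E s ∧ b.val s < E.space ∧
      Q (s.setDig (a.val s) (s.digs (b.val s))) := Iff.rfl
@[simp] theorem pre_null : (Cmd.null a).Pre E Q s ↔
    a.Ok E s ∧ a.val s < E.space ∧ Q (s.setDig (a.val s) E.A.dflt) := Iff.rfl
@[simp] theorem pre_hash : (Cmd.hash a b c).Pre E Q s ↔
    a.Ok E s ∧ a.val s < E.space ∧ b.Ok E s ∧ b.val s < E.space ∧ c.Ok E s ∧ c.val s < E.space ∧
      Q (s.setDig (a.val s) (E.A.H (cat (s.digs (b.val s)) (s.digs (c.val s))))) := Iff.rfl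
@[simp] theorem pre_recv : (Cmd.recv a b).Pre E Q s ↔
    a.Ok E s ∧ a.val s < E.space ∧ b.Ok E s ∧ b.val s < E.space ∧
      Q (s.receive (a.val s) (b.val s)) := Iff.rfl
@[simp] theorem pre_emit : (Cmd.emit a).Pre E Q s ↔
    a.Ok E s ∧ a.val s < E.space ∧ Q (s.push (s.digs (a.val s))) := Iff.rfl
@[simp] theorem pre_append : (P ++ R).Pre E Q s ↔ P.Pre E (fun s' => R.Pre E Q s') s := Iff.rfl
@[simp] theorem pre_ite : (Cmd.ite a P R).Pre E Q s ↔
    a.Ok E s ∧ (a.val s ≠ 0 → P.Pre E Q s) ∧ (a.val s = 0 → R.Pre E Q s) := Iff.rfl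

end simp_lemmas

/-! ### The mask of the range ends -/

theorem testBit_iff {x q : ℕ} : x.testBit q = true ↔ (x >>> q) % 2 = 1 := by
  rw [Nat.testBit_eq_decide_div_mod_eq, Nat.shiftRight_eq_div_pow, decide_eq_true_eq]

/-- The positions of the mountains that are the last ones of their ranges, as a bit mask. -/
def endMask (N : ℕ) : ℕ := (N ^^^ (N &&& ((N <<< 1) &&& (N >>> 1)))) % 2 ^ Nat.log 2 N

theorem endMask_bit {N q : ℕ} (hq : 1 ≤ q) :
    (endMask N >>> q) % 2 = 1 ↔ q < Nat.log 2 N ∧ Closes N q := by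
  rw [← testBit_iff, endMask, Nat.testBit_mod_two_pow]
  simp only [Bool.and_eq_true, decide_eq_true_eq, Nat.testBit_xor, Nat.testBit_and,
    Nat.testBit_shiftLeft, Nat.testBit_shiftRight]
  rw [Closes, ← testBit_iff, ← testBit_iff, ← testBit_iff, Nat.add_comm 1 q]
  have : (q = 0) = False := by simp; omega
  simp only [this, false_or, hq, decide_true, Bool.true_and]
  cases N.testBit q <;> cases N.testBit (q + 1) <;> cases N.testBit (q - 1) <;> simp

theorem xor_and_le (N m : ℕ) : N ^^^ (N &&& m) ≤ N := by
  have : N ^^^ (N &&& m) = N &&& (N ^^^ (N &&& m)) := by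
    apply Nat.eq_of_testBit_eq
    intro i
    simp only [Nat.testBit_xor, Nat.testBit_and]
    cases N.testBit i <;> cases m.testBit i <;> rfl
  rw [this]
  exact Nat.and_le_left

theorem bel_eq_of_not_closes {N Q : ℕ} (d : ℕ) (h : ∀ q, Q ≤ q → q < Q + d → ¬ Closes N q) :
    bel N Q = bel N (Q + d) := by
  induction d with
  | zero => rfl
  | succ d ih =>
    rw [ih fun q h1 h2 => h q h1 (by omega), bel_open (h (Q + d) (by omega) (by omega))]
    rfl

/-- The belt is found at the lowest range end, if there is one. -/
theorem bel_endMask {N Q : ℕ} (hN : 1 ≤ N) (hQ : 1 ≤ Q) :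
    (endMask N >>> Q = 0 → bel N Q = .empty) ∧
    (endMask N >>> Q ≠ 0 → ∃ j, endMask N >>> Q - (endMask N >>> Q &&& (endMask N >>> Q - 1)) =
      2 ^ j ∧ Closes N (Q + j) ∧ Q + j < Nat.log 2 N ∧ bel N Q = bel N (Q + j)) := by
  constructor
  · intro h
    have hn : ∀ q, Q ≤ q → q < Nat.log 2 N → ¬ Closes N q := by
      intro q h1 h2 hc
      have := (endMask_bit (N := N) (q := q) (by omega)).2 ⟨h2, hc⟩
      obtain ⟨d, rfl⟩ := Nat.exists_eq_add_of_le h1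
      rw [Nat.shiftRight_add, h, Nat.zero_shiftRight] at this
      exact absurd this (by norm_num)
    by_cases hk : Q ≤ Nat.log 2 N
    · obtain ⟨d, hd⟩ := Nat.exists_eq_add_of_le hk
      rw [bel_eq_of_not_closes d fun q h1 h2 => hn q h1 (by omega), ← hd,
        bel_top (shr_log hN).le]
    · refine bel_top ?_
      by_contra h'
      exact hk (lt_log_of_two_le_shr (not_le.1 h')).le
  · intro h
    obtain ⟨j, h1, h2, h3⟩ := lowbit _ (Nat.one_le_iff_ne_zero.2 h)
    rw [← Nat.shiftRight_add, endMask_bit (by omega)] at h2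
    refine ⟨j, h1, h2.2, h2.1, bel_eq_of_not_closes j fun q h4 h5 hc => ?_⟩
    obtain ⟨d, rfl⟩ := Nat.exists_eq_add_of_le h4
    have := h3 d (by omega)
    rw [← Nat.shiftRight_add] at this
    have := (endMask_bit (N := N) (q := Q + d) (by omega)).2 ⟨by omega, hc⟩
    omega

end

/-! ### The program of the manager -/

section

variable {ℓ : ℕ}

/-- The memory slot of a mountain: twice its height, plus the parity of its block. Two mountains of
equal height are the two halves of a block, so that they get different slots; and a mountain keeps
its slot when its index changes. -/
def slot (N q : ℕ) : ℕ := 2 * q + (N >>> q) % 2 * (2 + (N >>> q / 2 + 1) % 2)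

/-- With the word cell `5` for `N >>> (j + 1)`, the word cell `7` for the range ends above `j` among
`N + 1` items, and `j` in the word cell `3`: the belt of the complete ranges above `j`. -/
def beltPart : Cmd :=
  .ite (var 7)
    (assign 8 (.log2 (var 7 - (var 7 &&& (var 7 - 1))) + (var 3 + 1)) ++
      .copy 4 (3 * var 8 + 10))
    (.null 4)

/-- The chain of the incomplete range above `j`. -/
def chainPart : Cmd :=
  .ite (ltE (var 5) 2) (.null 3)
    (.ite (var 7 % 2) (.null 3)
      (.copy 3 (3 * (2 * (var 3 + 1) + var 5 % 2 * (2 + (var 5 / 2 + 1) % 2)) + 9)))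

/-- The new nodes of the part of the append that creates the merged mountain, when the chain and the
belt of the mountains to its left are in the hash cells `3` and `4`. -/
def mergeTail : Cmd :=
  .ite (var 3) (.hash 2 (3 * (2 * var 3) + 8) (3 * (2 * var 3 + 1) + 8))
    (.emit 1 ++ .hash 2 8 1) ++
  .emit 2 ++ .hash 3 3 2 ++ .emit 3 ++
  assign 9 (3 * (2 * (var 3 + 1) + (var 5 + 1) % 2) + 8) ++
  .copy (var 9) 2 ++ .copy (var 9 + 1) 3 ++
  .hash 4 4 3 ++ .emit 4 ++
  .ite (var 3) (.copy (3 * var 3 + 10) 4) (.copy 0 4)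

/-- The part of the append that creates the merged mountain and closes its range. The word cells
`1, 2, 3` contain `N = n + 1`, `N + 1` and the position of the lowest zero bit of `N`. The hash
cells `3` and `4` are for the chain and the belt. -/
def mergePart : Cmd :=
  assign 5 (var 1 >>> (var 3 + 1)) ++
  assign 6 ((var 2 ^^^ (var 2 &&& ((var 2 <<< Expr.const 1) &&& (var 2 >>> Expr.const 1)))) %
    (Expr.const 1 <<< Expr.log2 (var 2))) ++
  assign 7 (var 6 >>> (var 3 + 1)) ++
  beltPart ++ chainPart ++ mergeTail

/-- The part of the append that adds the new leaf as a mountain of its own. -/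
def leafPart : Cmd :=
  .emit 1 ++
  .ite (ltE (var 3) 2) (.null 3) (.copy 3 (3 * (2 + (var 1 / 2 + 1) % 2) + 9)) ++
  .hash 3 3 1 ++ .emit 3 ++ .copy 8 1 ++ .copy 9 3 ++ .hash 0 4 3 ++ .emit 0

/-- The append. The word cell `0` contains the number of items. The hash of a mountain is in the
cell `3 * slot + 8`, the hash of the chain up to it in the cell `3 * slot + 9`, and the hash of the
belt up to the mountain with index `q`, if it is the last one of its range, in `3 * q + 10`; these
three kinds of cells have different residues modulo `3`. -/
def appendCmd : Cmd :=
  assign 1 (var 0 + 1) ++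
  assign 2 (var 1 + 1) ++
  assign 3 (.log2 (var 2 - (var 2 &&& var 1))) ++
  assign 0 (var 1) ++
  .recv 1 4 ++
  .ite (var 1 >>> (var 3 + 1)) mergePart (.null 4) ++
  .ite (var 3) leafPart (assign 4 0)

/-- The invariant of the manager's memory, for `N - 1` items. -/
structure ManagerInv (A : Hashing ℓ) (x : ℕ → List Bool) (N : ℕ) (s : St ℓ) : Prop where
  count : s.words 0 + 1 = N
  peak : ∀ q, 2 ≤ N >>> q → s.digs (3 * slot N q + 8) = (mtn N q).hash A x
  chain : ∀ q, 2 ≤ N >>> q →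
    s.digs (3 * slot N q + 9) = (MTree.node (chn N (q + 1)) (mtn N q)).hash A x
  belt : ∀ q, 1 ≤ q → 2 ≤ N >>> q → Closes N q → s.digs (3 * q + 10) = (bel N q).hash A x

/-- The state after the prologue of the append. -/
structure AppendMid (A : Hashing ℓ) (x : ℕ → List Bool) (N j : ℕ) (s : St ℓ) : Prop where
  w0 : s.words 0 = N
  w1 : s.words 1 = N
  w2 : s.words 2 = N + 1
  w3 : s.words 3 = j
  d1 : s.digs 1 = A.H (x N)
  out : s.outbox = []
  peak : ∀ q, 2 ≤ N >>> q → s.digs (3 * slot N q + 8) = (mtn N q).hash A x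
  chain : ∀ q, 2 ≤ N >>> q →
    s.digs (3 * slot N q + 9) = (MTree.node (chn N (q + 1)) (mtn N q)).hash A x
  belt : ∀ q, 1 ≤ q → 2 ≤ N >>> q → Closes N q → s.digs (3 * q + 10) = (bel N q).hash A x

variable {A : Hashing ℓ} {x : ℕ → List Bool} {N j : ℕ} {E : Env ℓ}

/-- Above the carry, the ranges that are closed in the new bagging are so in the old one. -/
theorem Carry.belt_above {M N L P q : ℕ} (hc : Carry M N L P) (hq : P < q) (h : Closes N q) :
    Closes M q ∧ bel N q = bel M q := by
  rcases Nat.lt_or_ge (P + 1) q with h1 | h1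
  · have e := hc.above (P + 1) (by omega)
    refine ⟨?_, bel_congr e h1⟩
    rw [Closes, hc.above q hq, hc.above (q + 1) (by omega), hc.above (q - 1) (by omega)] at h
    exact h
  · obtain rfl : q = P + 1 := by omega
    have h2 := hc.closes_new_succ.1 h
    exact ⟨hc.closes_old_succ.2 h2.1, ((hc.st_old_succ.2 (by omega)).1).symm⟩

theorem shiftLeft_log_le {N : ℕ} (hN : 1 ≤ N) : 1 <<< Nat.log 2 N ≤ N := by
  rw [Nat.shiftLeft_eq, one_mul]; exact Nat.pow_log_le_self 2 (by omega)

theorem beltPart_pre (hE : 1000 * (N + 2) ≤ E.bound) (hS : 100 * (Nat.log 2 N + 2) ≤ E.space)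
    (hA : E.A = A) (hc : Carry N (N + 1) 0 j) {s : St ℓ} (w3 : s.words 3 = j)
    (w7 : s.words 7 = endMask (N + 1) >>> (j + 1))
    (hbelt : ∀ q, 1 ≤ q → 2 ≤ N >>> q → Closes N q → s.digs (3 * q + 10) = (bel N q).hash A x)
    (hj : j + 1 ≤ Nat.log 2 N) {Q : St ℓ → Prop}
    (hQ : ∀ s' : St ℓ, (∀ k, k ≠ 8 → s'.words k = s.words k) → (∀ k, k ≠ 4 → s'.digs k = s.digs k) →
      s'.outbox = s.outbox → s'.digs 4 = (bel (N + 1) (j + 1)).hash A x → Q s') :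
    beltPart.Pre E Q s := by
  have hw : endMask (N + 1) >>> (j + 1) ≤ N + 1 := by
    refine (Nat.shiftRight_le _ _).trans ((Nat.mod_le _ _).trans (xor_and_le _ _))
  have hlogle : Nat.log 2 N ≤ N := Nat.log_le_self _ _
  obtain ⟨h1, h2⟩ := bel_endMask (N := N + 1) (Q := j + 1) (by omega) (by omega)
  simp only [beltPart, pre_ite, pre_append, pre_assign, pre_copy, pre_null, ok_var, val_var, w7]
  refine ⟨by omega, fun h => ?_, fun h => ?_⟩
  · obtain ⟨i, h3, h4, h5, h6⟩ := h2 h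
    have hlog : Nat.log 2 (N + 1) ≤ Nat.log 2 N + 1 := by
      rw [← Nat.log_mul_base (by norm_num) (by rintro rfl; simp at hj)]
      exact Nat.log_mono_right (by have : N ≠ 0 := (by rintro rfl; simp at hj); omega)
    have h7 : Nat.log 2 (2 ^ i) = i := Nat.log_pow (by norm_num) i
    obtain ⟨h8, h9⟩ := hc.belt_above (by omega) h4
    have h10 := hbelt (j + 1 + i) (by omega)
      (by rw [← hc.above _ (by omega)]; exact two_le_shr h5) h8
    simp [w3, w7, h3, h7]
    refine ⟨by omega, by omega, by omega, by omega, by omega, by omega, by omega, ?_⟩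
    refine hQ _ (by simp +contextual) (by simp +contextual) (by simp) ?_
    simp [h6, h9, ← h10]
    congr 1; omega
  · simp only [ok_ofNat, val_ofNat]
    refine ⟨by omega, by omega, hQ _ (by simp) (by simp +contextual) (by simp) ?_⟩
    simp [hA, h1 h, MTree.hash]

theorem chainPart_pre (hE : 1000 * (N + 2) ≤ E.bound) (hS : 100 * (Nat.log 2 N + 2) ≤ E.space)
    (hA : E.A = A) (hc : Carry N (N + 1) 0 j) {s : St ℓ} (w3 : s.words 3 = j)
    (w5 : s.words 5 = N >>> (j + 1)) (w7 : s.words 7 = endMask (N + 1) >>> (j + 1))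
    (hchain : ∀ q, 2 ≤ N >>> q →
      s.digs (3 * slot N q + 9) = (MTree.node (chn N (q + 1)) (mtn N q)).hash A x)
    (hj : j + 1 ≤ Nat.log 2 N) {Q : St ℓ → Prop}
    (hQ : ∀ s' : St ℓ, s'.words = s.words → (∀ k, k ≠ 3 → s'.digs k = s.digs k) →
      s'.outbox = s.outbox → s'.digs 3 = (chn (N + 1) (j + 1)).hash A x → Q s') :
    chainPart.Pre E Q s := by
  have hw : endMask (N + 1) >>> (j + 1) ≤ N + 1 := by
    refine (Nat.shiftRight_le _ _).trans ((Nat.mod_le _ _).trans (xor_and_le _ _))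
  have hw5 : N >>> (j + 1) ≤ N := Nat.shiftRight_le _ _
  have hlogle : Nat.log 2 N ≤ N := Nat.log_le_self _ _
  have e1 := hc.above (j + 1) (by omega)
  have null_case : (chn (N + 1) (j + 1) = .empty) → Q (s.setDig 3 E.A.dflt) := fun h =>
    hQ _ (by simp) (by simp +contextual) (by simp) (by simp [hA, h, MTree.hash])
  simp only [chainPart, pre_ite, pre_append, pre_assign, pre_copy, pre_null, ok_ofNat, val_ofNat,
    ok_lt, val_lt, ok_mod, val_mod, ok_add, ok_sub, ok_div, ok_mul, val_add, val_sub, val_mul,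
    val_div, ok_var, val_var, w3, w5, w7]
  refine ⟨by omega, fun h => ⟨by omega, by omega, null_case ?_⟩, fun h => ⟨by omega, fun h' =>
    ⟨by omega, by omega, null_case ?_⟩, fun h' => ?_⟩⟩
  · have : N >>> (j + 1) < 2 := by by_contra h0; simp [h0] at h
    exact chn_top (by omega)
  · exact chn_close ((endMask_bit (by omega)).1 (by omega)).2
  · have h2 : 2 ≤ N >>> (j + 1) := by by_contra h0; simp [not_le.1 h0] at h
    have hn : ¬ Closes (N + 1) (j + 1) := fun hcl => by
      have := (endMask_bit (by omega)).2 ⟨lt_log_of_two_le_shr (by rw [e1]; exact h2), hcl⟩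
      omega
    have h3 := hchain (j + 1) h2
    have e2 : chn (N + 1) (j + 1) = .node (chn N (j + 2)) (mtn N (j + 1)) := by
      rw [chn_open (by omega) hn, chn_congr e1 (by omega), mtn, mtn, e1]
    have hsl : slot N (j + 1) =
      2 * (j + 1) + N >>> (j + 1) % 2 * (2 + (N >>> (j + 1) / 2 + 1) % 2) := rfl
    have hb : N >>> (j + 1) % 2 * (2 + (N >>> (j + 1) / 2 + 1) % 2) ≤ 3 := by
      rcases Nat.mod_two_eq_zero_or_one (N >>> (j + 1)) with h0 | h0 <;> rw [h0] <;> omega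
    rw [hsl] at h3
    refine ⟨by omega, by omega, by omega, by omega, hQ _ (by simp) (by simp +contextual) (by simp) ?_⟩
    simp only [digs_setDig, if_true, e2, h3]

theorem slot_le (N q : ℕ) : 2 * q ≤ slot N q ∧ slot N q ≤ 2 * q + 3 := by
  unfold slot
  rcases Nat.mod_two_eq_zero_or_one (N >>> q) with h0 | h0 <;> rw [h0] <;> omega

theorem slot_even {N q : ℕ} (h : (N >>> q) % 2 = 0) : slot N q = 2 * q := by
  rw [slot, h]; omega

theorem slot_odd {N q : ℕ} (h : (N >>> q) % 2 = 1) :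
    slot N q = 2 * q + 2 + (N >>> (q + 1) + 1) % 2 := by
  rw [slot, h, shr_succ]; omega

theorem mergeTail_pre (hE : 1000 * (N + 2) ≤ E.bound) (hS : 100 * (Nat.log 2 N + 2) ≤ E.space)
    (hA : E.A = A) {s : St ℓ} {G : ℕ} (w3 : s.words 3 = j) (w5 : s.words 5 = G) (hG : G ≤ N)
    (hj : j + 1 ≤ Nat.log 2 N) (hout : s.outbox = []) {a b B C : Digest ℓ}
    (ha : s.digs (3 * (2 * j) + 8) = a)
    (hb : (if j = 0 then s.digs 1 else s.digs (3 * (2 * j + 1) + 8)) = b)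
    (hB : s.digs 4 = B) (hC : s.digs 3 = C) {σ : ℕ} (hσ : σ = 2 * (j + 1) + (G + 1) % 2)
    {Q : St ℓ → Prop}
    (hQ : ∀ s' : St ℓ, (∀ k, k ≠ 9 → s'.words k = s.words k) →
      (∀ k, k ≠ 0 → k ≠ 2 → k ≠ 3 → k ≠ 4 → k ≠ 3 * σ + 8 → k ≠ 3 * σ + 9 → k ≠ 3 * j + 10 →
        s'.digs k = s.digs k) →
      s'.digs 4 = A.H (cat B (A.H (cat C (A.H (cat a b))))) →
      s'.digs (3 * σ + 8) = A.H (cat a b) →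
      s'.digs (3 * σ + 9) = A.H (cat C (A.H (cat a b))) →
      (j = 0 → s'.digs 0 = A.H (cat B (A.H (cat C (A.H (cat a b)))))) →
      (1 ≤ j → s'.digs (3 * j + 10) = A.H (cat B (A.H (cat C (A.H (cat a b)))))) →
      s'.outbox = (if j = 0 then [s.digs 1] else []) ++
        [A.H (cat a b), A.H (cat C (A.H (cat a b))), A.H (cat B (A.H (cat C (A.H (cat a b)))))] →
      Q s') :
    mergeTail.Pre E Q s := by
  have hlogle : Nat.log 2 N ≤ N := Nat.log_le_self _ _
  subst hA
  rcases Nat.eq_zero_or_pos j with rfl | h0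
  · rw [if_pos rfl] at hb
    simp only [mul_zero, zero_add] at ha hσ hQ
    simp [mergeTail, w3, w5, hout, ha, hb, hB, hC, ← hσ]
    and_intros
    any_goals omega
    refine hQ _ (by simp +contextual) (by simp +contextual) ?_ ?_ ?_ ?_ ?_ ?_
    · simp
    · simp
    · simp
    · simp
    · simp
    · simp [hout, hb]
  · rw [if_neg (by omega)] at hb
    simp [mergeTail, w3, w5, hout, ha, hb, hB, hC, ← hσ, show j ≠ 0 by omega]
    and_intros
    any_goals omega
    refine hQ _ (by simp +contextual) (by simp +contextual) ?_ ?_ ?_ ?_ ?_ ?_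
    · simp
    · simp; omega
    · simp; omega
    · omega
    · simp
    · simp [hout, show j ≠ 0 by omega]

theorem mergePart_pre (hE : 1000 * (N + 2) ≤ E.bound) (hS : 100 * (Nat.log 2 N + 2) ≤ E.space)
    (hA : E.A = A) (hc : Carry N (N + 1) 0 j) (hG : 1 ≤ N >>> (j + 1)) {s : St ℓ}
    (h : AppendMid A x N j s) {Q : St ℓ → Prop}
    (hQ : ∀ s' : St ℓ, s'.words 0 = N → s'.words 1 = N → s'.words 3 = j →
      (∀ k, k ≠ 0 → k ≠ 2 → k ≠ 3 → k ≠ 4 → k ≠ 3 * slot (N + 1) j + 8 →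
        k ≠ 3 * slot (N + 1) j + 9 → k ≠ 3 * j + 10 → s'.digs k = s.digs k) →
      s'.digs 4 = (bel (N + 1) j).hash A x →
      s'.digs (3 * slot (N + 1) j + 8) = (mtn (N + 1) j).hash A x →
      s'.digs (3 * slot (N + 1) j + 9) =
        (MTree.node (chn (N + 1) (j + 1)) (mtn (N + 1) j)).hash A x →
      (j = 0 → s'.digs 0 = (bel (N + 1) j).hash A x) →
      (1 ≤ j → s'.digs (3 * j + 10) = (bel (N + 1) j).hash A x) →
      s'.outbox = (if j = 0 then [A.H (x N)] else []) ++
        [(mtn (N + 1) j).hash A x, (MTree.node (chn (N + 1) (j + 1)) (mtn (N + 1) j)).hash A x,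
          (bel (N + 1) j).hash A x] → Q s') :
    mergePart.Pre E Q s := by
  obtain ⟨w0, w1, w2, w3, d1, hout, hpeak, hchain, hbelt⟩ := h
  have h2 : 2 ≤ N >>> j := by rw [hc.shr_old]; omega
  have hj : j + 1 ≤ Nat.log 2 N := lt_log_of_two_le_shr h2
  have hm : (N + 1) ^^^ ((N + 1) &&& (((N + 1) <<< 1) &&& ((N + 1) >>> 1))) ≤ N + 1 :=
    xor_and_le _ _
  have hlog := shiftLeft_log_le (N := N + 1) (by omega)
  have hlogle : Nat.log 2 N ≤ N := Nat.log_le_self _ _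
  have hshl : (N + 1) <<< 1 = 2 * (N + 1) := by rw [Nat.shiftLeft_eq, pow_one]; omega
  have hbel : bel (N + 1) j = .node (bel (N + 1) (j + 1))
      (.node (chn (N + 1) (j + 1)) (mtn (N + 1) j)) := by
    refine bel_close (by rw [hc.shr_new]; omega) ?_
    rcases Nat.eq_zero_or_pos j with rfl | h0
    · exact Or.inl rfl
    · exact hc.closes_new h0
  have hsl : slot (N + 1) j = 2 * (j + 1) + (N >>> (j + 1) + 1) % 2 := by
    rw [slot_odd (by rw [hc.shr_new]; omega), hc.above_succ]; ring
  have hmg : (mtn (N + 1) j).hash A x = A.H (cat ((mtn N j).hash A x)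
      ((blk j (2 * N >>> (j + 1) - 1)).hash A x)) := by
    rw [hc.mtn_new hG, hc.mtn_old]; rfl
  have hmask : endMask (N + 1) = ((N + 1) ^^^ ((N + 1) &&& (((N + 1) <<< 1) &&& ((N + 1) >>> 1)))) %
      (1 <<< Nat.log 2 (N + 1)) := by rw [endMask, Nat.shiftLeft_eq 1, one_mul]
  have hb : (if j = 0 then s.digs 1 else s.digs (3 * (2 * j + 1) + 8)) =
      (blk j (2 * N >>> (j + 1) - 1)).hash A x := by
    split
    · rename_i h0
      subst h0
      have := hc.shr_old
      simp only [Nat.shiftRight_zero] at this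
      rw [d1, ← this, blk, MTree.hash, Nat.sub_add_cancel (by omega)]
    · rename_i h0
      have h3 := hpeak (j - 1) (two_le_shr (by omega))
      rw [slot_odd (hc.odd (j - 1) (by omega) (by omega)), show j - 1 + 1 = j by omega,
        hc.mtn_old_pred (by omega)] at h3
      rw [← h3]
      have := hc.even
      congr 2; omega
  rw [hshl] at hm hmask
  have hem : endMask (N + 1) ≤ N + 1 := (Nat.mod_le _ _).trans (xor_and_le _ _)
  have hG' : N >>> (j + 1) ≤ N := Nat.shiftRight_le _ _
  have hw : (N + 1) >>> 1 ≤ N + 1 := Nat.shiftRight_le _ _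
  simp only [mergePart, pre_append]
  have hp := hpeak j h2
  rw [slot_even hc.even] at hp
  simp [w1, w2, w3, hshl, ← hmask]
  repeat refine ⟨by omega, ?_⟩
  refine beltPart_pre (x := x) hE hS hA hc ?_ ?_ ?_ hj
    fun s1 hw1 hd1 ho1 hd4 => ?_
  · simp [w3]
  · simp
  · simpa using hbelt
  refine chainPart_pre (x := x) hE hS hA hc (by simp [hw1, w3]) (by simp [hw1]) (by simp [hw1]) ?_ hj
    fun s2 hw2 hd2 ho2 hd3 => ?_
  · intro q hq
    have := (slot_le N q).1
    rw [hd1 _ (by omega)]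
    simpa using hchain q hq
  have hd : ∀ k, k ≠ 3 → k ≠ 4 → s2.digs k = s.digs k := fun k h3 h4 => by
    rw [hd2 k h3, hd1 k h4]; rfl
  refine mergeTail_pre hE hS hA (G := N >>> (j + 1)) (by simp [hw2, hw1, w3]) (by simp [hw2, hw1]) hG' hj
    (a := (mtn N j).hash A x) (b := (blk j (2 * N >>> (j + 1) - 1)).hash A x)
    (by simp [ho2, ho1, hout]) (by rw [hd _ (by omega) (by omega)]; exact hp)
    (by rw [hd 1 (by omega) (by omega), hd _ (by omega) (by omega)]; exact hb)
    ((hd2 4 (by omega)).trans hd4) hd3 hsl fun s3 hw3 hd5 h4 hp' hc' h0 h1 ho => ?_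
  refine hQ s3 (by simp [hw3, hw2, hw1, w0]) (by simp [hw3, hw2, hw1, w1])
    (by simp [hw3, hw2, hw1, w3]) ?_ ?_ ?_ ?_ ?_ ?_ ?_
  · intro k k0 k2 k3 k4 k5 k6 k7
    rw [hd5 k k0 k2 k3 k4 k5 k6 k7, hd k k3 k4]
  all_goals simp only [hbel, MTree.hash, hmg]
  · exact h4
  · exact hp'
  · exact hc'
  · exact h0
  · exact h1
  · rw [ho, hd 1 (by omega) (by omega), d1]

theorem leafPart_pre (hE : 1000 * (N + 2) ≤ E.bound) (hS : 100 * (Nat.log 2 N + 2) ≤ E.space)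
    (hA : E.A = A) (hc : Carry N (N + 1) 0 j) (h0 : 1 ≤ j) (hN : 1 ≤ N) {s : St ℓ}
    (w1 : s.words 1 = N) (w3 : s.words 3 = j) (d1 : s.digs 1 = A.H (x N))
    (d4 : s.digs 4 = (bel (N + 1) 1).hash A x)
    (hchain : 2 ≤ j → s.digs (3 * slot N 0 + 9) = (MTree.node (chn N 1) (mtn N 0)).hash A x)
    {Q : St ℓ → Prop}
    (hQ : ∀ s' : St ℓ, s'.words = s.words →
      (∀ k, k ≠ 0 → k ≠ 3 → k ≠ 8 → k ≠ 9 → s'.digs k = s.digs k) →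
      s'.digs 8 = (mtn (N + 1) 0).hash A x →
      s'.digs 9 = (MTree.node (chn (N + 1) 1) (mtn (N + 1) 0)).hash A x →
      s'.digs 0 = (bel (N + 1) 0).hash A x →
      s'.outbox = s.outbox ++ [(mtn (N + 1) 0).hash A x,
        (MTree.node (chn (N + 1) 1) (mtn (N + 1) 0)).hash A x, (bel (N + 1) 0).hash A x] → Q s') :
    leafPart.Pre E Q s := by
  have hj : j ≤ N := by
    by_contra hlt
    have := hc.odd N (by omega) (by omega)
    rw [Nat.shiftRight_eq_div_pow, Nat.div_eq_of_lt (Nat.lt_two_pow_self)] at this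
    exact absurd this (by norm_num)
  have hl : (mtn (N + 1) 0).hash A x = A.H (x N) := by
    rw [hc.mtn_low (by omega), blk, MTree.hash]
    simp [Nat.sub_add_cancel hN]
  have hb : bel (N + 1) 0 = .node (bel (N + 1) 1) (.node (chn (N + 1) 1) (mtn (N + 1) 0)) :=
    bel_close (by simp; omega) (Or.inl rfl)
  have tail : ∀ s1 : St ℓ, s1.words = s.words → (∀ k, k ≠ 3 → s1.digs k = s.digs k) →
      s1.digs 3 = (chn (N + 1) 1).hash A x → s1.outbox = s.outbox ++ [A.H (x N)] →
      (Cmd.hash 3 3 1 ++ .emit 3 ++ .copy 8 1 ++ .copy 9 3 ++ .hash 0 4 3 ++ .emit 0).Pre E Q s1 := by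
    intro s1 hw1 hd1 hd3 ho1
    simp [hd1 1 (by omega), hd1 4 (by omega), hd3, d4, d1]
    repeat refine ⟨by omega, ?_⟩
    refine hQ _ (by simp [hw1]) (by simp +contextual [hd1]) ?_ ?_ ?_ ?_
    · simp [hl]
    · simp [MTree.hash, hl, hA]
    · simp [MTree.hash, hl, hA, hb]
    · simp [MTree.hash, hl, hA, hb, ho1]
  have hsl := hc.odd 0 le_rfl (by omega)
  have hsl := slot_odd hsl
  rw [zero_add, mul_zero, zero_add, Nat.shiftRight_one] at hsl
  have h3 : (∃ c, s.digs (3 * slot N 0 + 9) = c) := ⟨_, rfl⟩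
  change Cmd.Pre E (Cmd.emit 1 ++ _) (fun s1 => (Cmd.hash 3 3 1 ++ .emit 3 ++ .copy 8 1 ++
    .copy 9 3 ++ .hash 0 4 3 ++ .emit 0).Pre E Q s1) s
  rw [pre_append, pre_emit, pre_ite]
  simp only [words_push, w3, w1, ok_lt, ok_var, ok_ofNat, val_lt, val_var, val_ofNat, pre_null,
    pre_copy, ok_add, ok_mul, ok_mod, ok_div, val_add, val_mul, val_mod, val_div, digs_push]
  refine ⟨by omega, by omega, by omega, fun hlt => ⟨by omega, by omega, ?_⟩, fun hge => ?_⟩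
  · have : j = 1 := by by_contra hne; simp [show ¬ j < 2 by omega] at hlt
    subst this
    refine tail _ (by simp) (by simp +contextual) ?_ (by simp [d1])
    simp [chn_close (hc.closes_new (by omega)), MTree.hash, hA]
  · have : 2 ≤ j := by by_contra hne; simp [show j < 2 by omega] at hge
    have hc3 := hchain this
    rw [hsl] at hc3
    refine ⟨by omega, by omega, by omega, by omega, ?_⟩
    refine tail _ (by simp) (by simp +contextual) ?_ (by simp [d1])
    simp [hc3, (hc.chn_new_low (by omega)).1]

theorem slot_congr {M N q : ℕ} (h : N >>> q = M >>> q) : slot N q = slot M q := by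
  rw [slot, slot, h]

theorem mtn_congr {M N q : ℕ} (h : N >>> q = M >>> q) : mtn N q = mtn M q := by
  rw [mtn, mtn, h]

theorem ManagerInv.succ (hc : Carry N (N + 1) 0 j) (hN : 1 ≤ N) {s s' : St ℓ}
    (hpeak : ∀ q, 2 ≤ N >>> q → s.digs (3 * slot N q + 8) = (mtn N q).hash A x)
    (hchain : ∀ q, 2 ≤ N >>> q →
      s.digs (3 * slot N q + 9) = (MTree.node (chn N (q + 1)) (mtn N q)).hash A x)
    (hbelt : ∀ q, 1 ≤ q → 2 ≤ N >>> q → Closes N q → s.digs (3 * q + 10) = (bel N q).hash A x)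
    (hw : s'.words 0 = N)
    (hframe : ∀ k, 10 ≤ k → k ≠ 3 * slot (N + 1) j + 8 → k ≠ 3 * slot (N + 1) j + 9 →
      k ≠ 3 * j + 10 → s'.digs k = s.digs k)
    (hmerge : 1 ≤ N >>> (j + 1) → s'.digs (3 * slot (N + 1) j + 8) = (mtn (N + 1) j).hash A x ∧
      s'.digs (3 * slot (N + 1) j + 9) =
        (MTree.node (chn (N + 1) (j + 1)) (mtn (N + 1) j)).hash A x ∧
      (1 ≤ j → s'.digs (3 * j + 10) = (bel (N + 1) j).hash A x))
    (hleaf : 1 ≤ j → s'.digs 8 = (mtn (N + 1) 0).hash A x ∧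
      s'.digs 9 = (MTree.node (chn (N + 1) 1) (mtn (N + 1) 0)).hash A x) :
    ManagerInv A x (N + 1) s' := by
  have hsl : slot (N + 1) j = 2 * (j + 1) + (N >>> (j + 1) + 1) % 2 := by
    rw [slot_odd (by rw [hc.shr_new]; omega), hc.above_succ]; ring
  have hG : 2 ≤ (N + 1) >>> j → 1 ≤ N >>> (j + 1) := by rw [hc.shr_new]; omega
  -- the slots of the mountains to the left of the merge stay the same and differ from the new one
  have above : ∀ q, j < q → slot (N + 1) q = slot N q ∧ slot N q ≠ slot (N + 1) j ∧ 4 ≤ slot N q ∨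
      slot (N + 1) q = slot N q ∧ slot N q ≠ slot (N + 1) j ∧ j = 0 ∧ 2 ≤ slot N q := by
    intro q hq
    have h1 := slot_congr (hc.above q hq)
    have h2 := slot_le N q
    have h3 : slot N q ≠ slot (N + 1) j := by
      rcases Nat.lt_or_ge (j + 1) q with h | h
      · omega
      · obtain rfl : q = j + 1 := by omega
        rcases Nat.mod_two_eq_zero_or_one (N >>> (j + 1)) with hb | hb
        · rw [slot_even hb]; omega
        · rw [slot_odd hb]; omega
    omega
  have low : ∀ q, q + 1 < j → slot (N + 1) (q + 1) = slot N q ∧ slot N q = 2 * (q + 1) ∧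
      2 ≤ N >>> q := by
    intro q hq
    have h1 := hc.odd q (by omega) (by omega)
    have h2 := hc.odd (q + 1) (by omega) (by omega)
    have h3 := hc.succ (q + 1) (by omega) (by omega)
    have h4 := shr_succ N q
    rw [slot_odd h1, slot_even (by omega)]
    generalize N >>> (q + 1) = a at *
    omega
  have e0 : 1 ≤ j → slot (N + 1) 0 = 0 := fun h => by
    have h1 := hc.odd 0 (by omega) (by omega)
    have h3 := hc.succ 0 (by omega) (by omega)
    rw [slot_even (by omega)]
  refine ⟨by omega, fun q hq => ?_, fun q hq => ?_, fun q hq1 hq hcl => ?_⟩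
  · rcases lt_trichotomy j q with h | rfl | h
    · have := above q h
      rw [mtn_congr (hc.above q h), ← hpeak q (by rwa [← hc.above q h]), this.elim (·.1) (·.1)]
      exact hframe _ (by omega) (by omega) (by omega) (by omega)
    · exact (hmerge (hG hq)).1
    · cases q with
      | zero => rw [e0 h]; exact (hleaf h).1
      | succ q =>
        have := low q h
        rw [hc.mtn_shift (by omega) h, ← hpeak q this.2.2, this.1]
        exact hframe _ (by omega) (by omega) (by omega) (by omega)
  · rcases lt_trichotomy j q with h | rfl | h
    · have := above q h
      rw [mtn_congr (hc.above q h), chn_congr (hc.above q h) (by omega),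
        ← hchain q (by rwa [← hc.above q h]), this.elim (·.1) (·.1)]
      exact hframe _ (by omega) (by omega) (by omega) (by omega)
    · exact (hmerge (hG hq)).2.1
    · cases q with
      | zero => rw [e0 h]; exact (hleaf h).2
      | succ q =>
        have := low q h
        rw [hc.mtn_shift (by omega) h,
          ← (hc.chn_shift (j - (q + 2)) (q + 1) (by omega) (by omega)).1, ← hchain q this.2.2,
          this.1]
        exact hframe _ (by omega) (by omega) (by omega) (by omega)
  · rcases lt_trichotomy j q with h | rfl | h
    · obtain ⟨h1, h2⟩ := hc.belt_above h hcl
      rw [h2, ← hbelt q hq1 (by rwa [← hc.above q h]) h1]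
      exact hframe _ (by omega) (by omega) (by omega) (by omega)
    · exact (hmerge (hG hq)).2.2 hq1
    · exact absurd hcl (hc.not_closes_new hq1 (by omega) h)

end

/-! ### The new nodes -/

section

variable {ℓ : ℕ} {A : Hashing ℓ} {x : ℕ → List Bool} {N j : ℕ} {E : Env ℓ}

/-- The nodes of `t` that are not nodes of `o`. -/
def fresh (o t : MTree) : List MTree := t.nodes.filter fun u => u ∉ o.nodes

theorem fresh_of_subset {o t : MTree} (h : t.nodes ⊆ o.nodes) : fresh o t = [] := by
  rw [fresh, List.filter_eq_nil_iff]
  intro u hu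
  simpa using h hu

theorem fresh_node {o l r : MTree} (h : node l r ∉ o.nodes) :
    fresh o (node l r) = fresh o l ++ fresh o r ++ [node l r] := by
  simp [fresh, nodes, h]

theorem fresh_leaf {o : MTree} {i : ℕ} (h : leaf i ∉ o.nodes) : fresh o (leaf i) = [leaf i] := by
  simp [fresh, nodes, h]

theorem left_subset {l r o : MTree} (h : (node l r).nodes ⊆ o.nodes) : l.nodes ⊆ o.nodes :=
  fun u hu => h (by simp [nodes, hu])

theorem right_subset {l r o : MTree} (h : (node l r).nodes ⊆ o.nodes) : r.nodes ⊆ o.nodes :=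
  fun u hu => h (by simp [nodes, hu])

/-- The new nodes of an append, in the order of the tree: those of the merge, which has an effect
only if there is a mountain to the left, and those of the new mountain, if it is not merged. -/
def appended (N j : ℕ) : List MTree :=
  (if 1 ≤ N >>> (j + 1) then (if j = 0 then [leaf N] else []) ++
    [mtn (N + 1) j, node (chn (N + 1) (j + 1)) (mtn (N + 1) j), bel (N + 1) j] else []) ++
  (if j = 0 then [] else [mtn (N + 1) 0, node (chn (N + 1) 1) (mtn (N + 1) 0), bel (N + 1) 0])

theorem Carry.above_subset {M L P : ℕ} (hc : Carry M N L P) {o : MTree}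
    (hb : (bel M (P + 1)).nodes ⊆ o.nodes) (hch : (chn M (P + 1)).nodes ⊆ o.nodes) :
    (bel N (P + 1)).nodes ⊆ o.nodes ∧ (chn N (P + 1)).nodes ⊆ o.nodes := by
  by_cases h : (M >>> (P + 1)) % 2 = 1 ∧ (M >>> (P + 2)) % 2 = 1
  · rw [(hc.st_old_succ.1 h).1] at hb
    exact ⟨left_subset hb, right_subset hb⟩
  · rw [← (hc.st_old_succ.2 h).1, ← (hc.st_old_succ.2 h).2]
    exact ⟨hb, hch⟩

theorem newNodes_eq (hc : Carry N (N + 1) 0 j) (hN : 1 ≤ N) : newNodes N = appended N j := by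
  have hnew : ∀ t : MTree, N ∈ t.leaves → t ∉ (bel N 0).nodes := by
    intro t ht h
    have h1 := leaves_subset h ht
    have h2 := leaves_mmb (N - 1)
    rw [mmb_eq, Nat.sub_add_cancel hN] at h2
    rw [h2, List.mem_range'_1] at h1
    omega
  have hO : newNodes N = fresh (bel N 0) (bel (N + 1) 0) := by
    rw [newNodes, fresh, mmb_eq, mmb_eq, Nat.sub_add_cancel hN]
  have hbel : bel (N + 1) 0 = node (bel (N + 1) 1) (node (chn (N + 1) 1) (mtn (N + 1) 0)) :=
    bel_close (by simp; omega) (Or.inl rfl)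
  have hold : 2 ≤ N → bel N 0 = node (bel N 1) (node (chn N 1) (mtn N 0)) := fun h =>
    bel_close (by simp; omega) (Or.inl rfl)
  rcases Nat.eq_zero_or_pos j with rfl | h0
  · have he := hc.even
    have hG : 1 ≤ N >>> 1 := by rw [Nat.shiftRight_zero] at he; simp [Nat.shiftRight_one]; omega
    have hm := hc.mtn_new hG
    have h3 : 2 * N >>> 1 = N := by rw [Nat.shiftRight_zero] at he; simp [Nat.shiftRight_one]; omega
    have ho := hc.mtn_old
    simp only [zero_add, h3] at hm ho
    rw [← ho] at hm
    have hl : blk 0 (N - 1) = leaf N := by rw [blk, Nat.sub_add_cancel hN]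
    rw [hl] at hm
    have hNl : N ∈ (mtn (N + 1) 0).leaves := by simp [hm, leaves]
    rw [Nat.shiftRight_zero] at he
    have hold := hold (by omega)
    obtain ⟨h1, h2⟩ := hc.above_subset (o := bel N 0)
      (by rw [hold]; exact left_subset (List.Subset.refl _))
      (by rw [hold]; exact left_subset (right_subset (List.Subset.refl _)))
    have h4 : (mtn N 0).nodes ⊆ (bel N 0).nodes := by
      rw [hold]; exact right_subset (right_subset (List.Subset.refl _))
    rw [hO, appended, if_pos hG, hbel, fresh_node (hnew _ (by simp [leaves, hNl])),
      fresh_node (hnew _ (by simp [leaves, hNl])), fresh_of_subset h1, fresh_of_subset h2]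
    conv_lhs => rw [hm, fresh_node (hnew _ (by simp [leaves])), fresh_of_subset h4,
      fresh_leaf (hnew _ (by simp [leaves]))]
    simp [hm]
  · have hl : mtn (N + 1) 0 = leaf N := by
      rw [hc.mtn_low h0, blk, Nat.shiftRight_zero, Nat.sub_add_cancel hN]
    have hchain : (chn (N + 1) 1).nodes ⊆ (bel N 0).nodes := by
      rcases Nat.lt_or_ge 1 j with h | h
      · have h4 := hc.odd 1 (by omega) (by omega)
        rw [Nat.shiftRight_one] at h4
        rw [hold (by omega), (hc.chn_new_low (by omega)).1]
        exact right_subset (List.Subset.refl _)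
      · obtain rfl : j = 1 := by omega
        rw [chn_close (hc.closes_new (by omega))]
        simp [nodes]
    have hb : bel (N + 1) 1 = bel (N + 1) j := by
      rcases Nat.lt_or_ge 1 j with h | h
      · exact (hc.chn_new_low (by omega)).2.1
      · obtain rfl : j = 1 := by omega
        rfl
    rw [hO, appended, if_neg (show j ≠ 0 by omega), if_neg (show j ≠ 0 by omega)]
    conv_lhs =>
      rw [hbel, hl, fresh_node (hnew _ (by simp [leaves])), fresh_node (hnew _ (by simp [leaves])),
        fresh_leaf (hnew _ (by simp [leaves])), fresh_of_subset hchain]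
    rw [← hl, ← hbel]
    suffices fresh (bel N 0) (bel (N + 1) 1) = if 1 ≤ N >>> (j + 1) then [] ++
        [mtn (N + 1) j, node (chn (N + 1) (j + 1)) (mtn (N + 1) j), bel (N + 1) j] else [] by
      rw [this]; simp
    split
    · rename_i hG
      have hbo := hc.bel_old_pred h0 hG
      have hbN : (bel N (j - 1)).nodes ⊆ (bel N 0).nodes := by
        rcases Nat.lt_or_ge 1 j with h | h
        · have h4 := hc.odd 1 (by omega) (by omega)
          rw [Nat.shiftRight_one] at h4
          rw [hold (by omega), ← (hc.chn_new_low (by omega)).2.2]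
          exact left_subset (List.Subset.refl _)
        · obtain rfl : j = 1 := by omega
          exact fun _ h => h
      rw [hbo] at hbN
      have s1 := left_subset hbN
      have s2 := right_subset hbN
      have s3 := left_subset s2
      have s4 := right_subset s2
      have s5 := left_subset s3
      have s6 := right_subset s3
      obtain ⟨t1, t2⟩ := hc.above_subset s1 s5
      have hm := hc.mtn_new hG
      rw [← hc.mtn_old, ← hc.mtn_old_pred h0] at hm
      -- the right half of the new mountain has had a different parent
      have hmo : mtn (N + 1) j ∉ (bel N 0).nodes := by
        intro h
        rw [hm] at h
        have hn : (bel N 0).leaves.Nodup := by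
          have h2 := leaves_mmb (N - 1)
          rw [mmb_eq, Nat.sub_add_cancel hN] at h2
          rw [h2]; exact List.nodup_range'
        have hne : (mtn N (j - 1)).leaves ≠ [] := by
          rw [hc.mtn_old_pred h0, leaves_blk]
          simp
        have := parent_unique hn hne h (s2 (self_mem_nodes (by simp)))
        have := congrArg sizeOf this
        simp at this
      have hmn : ∀ t, mtn (N + 1) j ∈ t.nodes → t ∉ (bel N 0).nodes := fun t h h' =>
        hmo (nodes_trans h h')
      have hms := self_mem_nodes (mtn_ne_empty (N + 1) j)
      rw [hb, hc.bel_new h0 hG, fresh_node (hmn _ (by simp [nodes, hms])),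
        fresh_node (hmn _ (by simp [nodes, hms])), fresh_of_subset t1, fresh_of_subset t2]
      conv_lhs => rw [hm, fresh_node (hm ▸ hmo), fresh_of_subset s6, fresh_of_subset s4]
      simp [hm]
    · rename_i hG
      rw [hb, bel_top (N := N + 1) (by rw [hc.shr_new]; omega)]
      exact fresh_of_subset (by simp [nodes])

/-! ### Appends -/

theorem appendCmd_pre (hE : 1000 * (N + 2) ≤ E.bound) (hS : 100 * (Nat.log 2 N + 2) ≤ E.space)
    (hA : E.A = A) (hN : 1 ≤ N) {s : St ℓ} (h : ManagerInv A x N s) (hin : s.inbox = [A.H (x N)])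
    (hout : s.outbox = []) :
    appendCmd.Pre E (fun s' => ManagerInv A x (N + 1) s' ∧ s'.digs 0 = (bel (N + 1) 0).hash A x ∧
      s'.outbox = (newNodes N).map (MTree.hash A x)) s := by
  obtain ⟨j, hc, hpow⟩ := exists_carry (M := N) (N := N + 1) (L := 0) (by simp)
  simp only [Nat.shiftRight_zero, Nat.sub_zero] at hpow
  have hj : j ≤ N := by
    rcases Nat.eq_zero_or_pos j with rfl | h0
    · omega
    by_contra hlt
    have := hc.odd N (by omega) (by omega)
    rw [Nat.shiftRight_eq_div_pow, Nat.div_eq_of_lt (Nat.lt_two_pow_self)] at this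
    exact absurd this (by norm_num)
  have hlog : Nat.log 2 (2 ^ j) = j := Nat.log_pow (by norm_num) j
  obtain ⟨hw0, hpeak, hchain, hbelt⟩ := h
  rw [newNodes_eq hc hN]
  set s1 : St ℓ := (((((((s.setWord 1 N).setWord 2 (N + 1)).setWord 3 j).setWord 0 N).setDig 1
    (A.H (x N))).setWord 4 1).setInbox []) with hs1
  have prologue : ∀ Q : St ℓ → Prop, Q s1 → Cmd.Pre E (assign 1 (var 0 + 1) ++
      assign 2 (var 1 + 1) ++ assign 3 (.log2 (var 2 - (var 2 &&& var 1))) ++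
      assign 0 (var 1) ++ .recv 1 4) Q s := by
    intro Q hQ
    simp [St.receive, hw0, hpow, hlog, hin]
    repeat refine ⟨by omega, ?_⟩
    exact hQ
  have hm : AppendMid A x N j s1 := by
    refine ⟨by simp [hs1], by simp [hs1], by simp [hs1], by simp [hs1], by simp [hs1],
      by simp [hs1, hout], fun q hq => ?_, fun q hq => ?_, fun q h1 hq hcl => ?_⟩
    · simpa [hs1] using hpeak q hq
    · simpa [hs1] using hchain q hq
    · simpa [hs1] using hbelt q h1 hq hcl
  have hsl := slot_le (N + 1) j
  -- the part of the leaf, after the merge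
  have key : ∀ s2 : St ℓ, s2.words 0 = N → s2.words 1 = N → s2.words 3 = j →
      (∀ k, k ≠ 0 → k ≠ 2 → k ≠ 3 → k ≠ 4 → k ≠ 3 * slot (N + 1) j + 8 →
        k ≠ 3 * slot (N + 1) j + 9 → k ≠ 3 * j + 10 → s2.digs k = s1.digs k) →
      s2.digs 4 = (bel (N + 1) j).hash A x →
      (1 ≤ N >>> (j + 1) → s2.digs (3 * slot (N + 1) j + 8) = (mtn (N + 1) j).hash A x ∧
        s2.digs (3 * slot (N + 1) j + 9) =
          (MTree.node (chn (N + 1) (j + 1)) (mtn (N + 1) j)).hash A x ∧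
        (j = 0 → s2.digs 0 = (bel (N + 1) j).hash A x) ∧
        (1 ≤ j → s2.digs (3 * j + 10) = (bel (N + 1) j).hash A x)) →
      s2.outbox = ((if 1 ≤ N >>> (j + 1) then (if j = 0 then [leaf N] else []) ++ [mtn (N + 1) j,
        node (chn (N + 1) (j + 1)) (mtn (N + 1) j), bel (N + 1) j] else [] : List MTree)).map
          (MTree.hash A x) →
      Cmd.Pre E (.ite (var 3) leafPart (assign 4 0)) (fun s' => ManagerInv A x (N + 1) s' ∧
        s'.digs 0 = (bel (N + 1) 0).hash A x ∧
        s'.outbox = (appended N j).map (MTree.hash A x)) s2 := by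
    intro s2 v0 v1 v3 hd h4 hG ho
    rw [pre_ite]
    refine ⟨by simp [v3]; omega, fun hne => ?_, fun he => ?_⟩
    · have h0 : 1 ≤ j := by simp [v3] at hne; omega
      refine leafPart_pre (x := x) hE hS hA hc h0 hN v1 v3 ?_ ?_ (fun h2 => ?_)
        fun s3 hw hd3 h8 h9 hr ho3 => ?_
      · rw [hd 1 (by omega) (by omega) (by omega) (by omega) (by omega) (by omega) (by omega)]
        exact hm.d1
      · rw [h4]
        rcases Nat.lt_or_ge 1 j with h2 | h2
        · rw [(hc.chn_new_low (by omega)).2.1]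
        · obtain rfl : j = 1 := by omega
          rfl
      · have h5 := hc.odd 1 (by omega) (by omega)
        rw [Nat.shiftRight_one] at h5
        have := slot_le N 0
        rw [hd _ (by omega) (by omega) (by omega) (by omega) (by omega) (by omega) (by omega)]
        exact hm.chain 0 (by simp; omega)
      · refine ⟨ManagerInv.succ hc hN hm.peak hm.chain hm.belt (by rw [hw, v0]) ?_ ?_ ?_, hr, ?_⟩
        · intro k k1 k2 k3 k4
          rw [hd3 k (by omega) (by omega) (by omega) (by omega),
            hd k (by omega) (by omega) (by omega) (by omega) k2 k3 k4]
        · intro hg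
          obtain ⟨g1, g2, g3, g4⟩ := hG hg
          rw [hd3 _ (by omega) (by omega) (by omega) (by omega),
            hd3 _ (by omega) (by omega) (by omega) (by omega)]
          refine ⟨g1, g2, fun h => ?_⟩
          rw [hd3 _ (by omega) (by omega) (by omega) (by omega)]
          exact g4 h
        · exact fun _ => ⟨h8, h9⟩
        · rw [ho3, ho, appended, if_neg (c := j = 0) (t := ([] : List MTree)) (by omega)]
          simp
    · obtain rfl : j = 0 := by simpa [v3] using he
      have hG1 : 1 ≤ N >>> (0 + 1) := by
        have := hc.even
        rw [Nat.shiftRight_zero] at this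
        rw [zero_add, Nat.shiftRight_one]; omega
      obtain ⟨g1, g2, g3, g4⟩ := hG hG1
      rw [pre_assign]
      refine ⟨by omega, by omega, by simp; omega, ManagerInv.succ hc hN hm.peak hm.chain hm.belt
        (by simp [v0]) ?_ ?_ (by omega), ?_, ?_⟩
      · intro k k1 k2 k3 k4
        exact hd k (by omega) (by omega) (by omega) (by omega) k2 k3 k4
      · exact fun _ => ⟨g1, g2, by omega⟩
      · exact g3 rfl
      · simp [ho, appended]
  refine prologue (fun s1 => Cmd.Pre E (.ite (var 1 >>> (var 3 + 1)) mergePart (.null 4))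
    (fun s2 => Cmd.Pre E (.ite (var 3) leafPart (assign 4 0)) _ s2) s1) ?_
  simp only [pre_ite (a := var 1 >>> (var 3 + 1)), ok_shr, ok_var, ok_add, ok_ofNat, val_shr, val_var,
    val_add, val_ofNat, hm.w1, hm.w3, pre_null]
  refine ⟨by omega, fun hne => ?_, fun he => ?_⟩
  · have hG1 : 1 ≤ N >>> (j + 1) := Nat.one_le_iff_ne_zero.2 hne
    refine mergePart_pre (x := x) hE hS hA hc hG1 hm fun s2 v0 v1 v3 hd h4 hp hch h0 hb ho => ?_
    refine key s2 v0 v1 v3 hd h4 (fun _ => ⟨hp, hch, h0, hb⟩) ?_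
    rw [ho, if_pos hG1]
    split <;> simp [MTree.hash]
  · refine ⟨by omega, by omega, ?_⟩
    refine key _ ?_ ?_ ?_ ?_ ?_ ?_ ?_
    · exact hm.w0
    · exact hm.w1
    · exact hm.w3
    · simp +contextual
    · rw [bel_top (N := N + 1) (by rw [hc.shr_new, he])]
      simp [MTree.hash, hA]
    · omega
    · rw [if_neg (by omega)]
      simpa using hm.out

theorem env_bounds (A : Hashing ℓ) {c : ℕ} (hc : 1000 ≤ c) (n : ℕ) :
    1000 * (n + 2) ≤ (env A c n).bound ∧ 100 * (Nat.log 2 n + 2) ≤ (env A c n).space := by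
  constructor
  · change 1000 * (n + 2) ≤ (n + 2) ^ c
    calc 1000 * (n + 2) ≤ 2 ^ 10 * (n + 2) := by omega
      _ ≤ (n + 2) ^ 10 * (n + 2) := Nat.mul_le_mul_right _ (Nat.pow_le_pow_left (by omega) _)
      _ = (n + 2) ^ 11 := by ring
      _ ≤ (n + 2) ^ c := Nat.pow_le_pow_right (by omega) (by omega)
  · change 100 * (Nat.log 2 n + 2) ≤ c * (Nat.log 2 n + 1)
    calc 100 * (Nat.log 2 n + 2) ≤ 1000 * (Nat.log 2 n + 1) := by omega
      _ ≤ _ := Nat.mul_le_mul_right _ hc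

theorem managerInv_init (A : Hashing ℓ) (x : ℕ → List Bool) : ManagerInv A x 1 (St.init A) := by
  have h : ∀ q, ¬ 2 ≤ 1 >>> q := fun q hq => by
    have := Nat.shiftRight_le 1 q
    omega
  exact ⟨rfl, fun q hq => absurd hq (h q), fun q hq => absurd hq (h q),
    fun q _ hq => absurd hq (h q)⟩

theorem appends (A : Hashing ℓ) {P : Protocol} (hP : P.append = appendCmd) {c : ℕ} (hc : 1000 ≤ c) :
    Appends A P c fun _ => c := by
  intro x
  have step : ∀ n (s : {s : St ℓ // ManagerInv A x (n + 1) s}),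
      ∃ s' : {s : St ℓ // ManagerInv A x (n + 1 + 1) s}, ∃ t ≤ c,
        Exec (env A c (n + 1)) P.append (s.1.next (A.H (x (n + 1)))) t s'.1 ∧
        s'.1.digs 0 = commitment A x (n + 1) ∧
        s'.1.outbox = (newNodes (n + 1)).map (MTree.hash A x) := by
    rintro n ⟨s, hs⟩
    obtain ⟨h1, h2⟩ := env_bounds A hc (n + 1)
    obtain ⟨t, s', h3, h4, h5, h6, h7⟩ := runsIn_of_pre (by omega) (appendCmd_pre (x := x) h1 h2 rfl
      (by omega) (s := s.next (A.H (x (n + 1)))) ⟨hs.1, hs.2, hs.3, hs.4⟩ rfl rfl)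
    refine ⟨⟨s', h5⟩, t, h4.trans ?_, by rw [hP]; exact h3, ?_, h7⟩
    · exact le_trans (by decide) hc
    · rw [h6, commitment, mmb_eq]; rfl
  choose g hg using step
  exact ⟨fun n => (Nat.rec (motive := fun n => {s : St ℓ // ManagerInv A x (n + 1) s})
    ⟨St.init A, managerInv_init A x⟩ g n).1, rfl, fun n => hg n _⟩

end

/-! ### The nodes of an increment proof -/

/-- The list of a tree, which may be missing. -/
def opt (t : MTree) : List MTree := if t = .empty then [] else [t]

/-- The mountains with indices below `q`, from left to right. -/
def peaks (N : ℕ) : ℕ → List MTree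
  | 0 => []
  | q + 1 => (if 2 ≤ N >>> q then [mtn N q] else []) ++ peaks N q

/-- The nodes for the mountains above the level `L`, where the two lists differ by a carry. -/
def farNodes (M N L P : ℕ) : List MTree :=
  opt (bel N (P + 1)) ++ opt (chn N (P + 1)) ++
    ((if 2 ≤ M >>> P then [mtn M P] ++ (if L < P then [mtn M (P - 1)] else []) else []) ++
      (if L + 2 ≤ P then [chn N (L + 1)] else []))

/-- Whether the block after the next one is needed at the level `t`. -/
def Used (M N L t : ℕ) : Prop :=
  (M >>> t) % 2 = 0 ∧ (t + 1 < L ∨ (N >>> (L - 1)) % 2 = 1)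

instance (M N L t : ℕ) : Decidable (Used M N L t) := by unfold Used; infer_instance

/-- The new blocks at the levels `t, …, t + d - 1`. -/
def newBlocks (M N L : ℕ) : ℕ → ℕ → List MTree
  | _, 0 => []
  | t, d + 1 => (if Used M N L t then [blk t (M >>> t + 1)] else []) ++ newBlocks M N L (t + 1) d

/-- The new nodes of an increment proof. -/
def nearNodes (M N L : ℕ) : List MTree :=
  leaf M :: (if 1 ≤ L then leaf (M + 1) :: (newBlocks M N L 0 L ++ peaks N (L - 1)) else [])

/-- The block that contains the items after the first new one, up to the level `t`; at the level
`L` it is a mountain of the new list. -/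
def growing (M N L t : ℕ) : MTree :=
  if t < L ∨ (N >>> (L - 1)) % 2 = 1 then blk t (M >>> t) else blk (t - 1) (M >>> (t - 1))

/-- The level `L` is the lowest one at which the numbers of blocks differ by at most one. -/
structure Split (M N L P : ℕ) : Prop where
  carry : Carry M N L P
  min : 1 ≤ L → M >>> (L - 1) + 2 ≤ N >>> (L - 1)

theorem shr_half (M t : ℕ) : M >>> t = 2 * M >>> (t + 1) + M >>> t % 2 := by
  rw [shr_succ]; omega

namespace Split

variable {M N L P : ℕ}

theorem bits (h : Split M N L P) (hL : 1 ≤ L) :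
    N >>> (L - 1) = 2 * M >>> L + 2 + (N >>> (L - 1)) % 2 ∧
      ((M >>> (L - 1)) % 2 = 1 → (N >>> (L - 1)) % 2 = 1) := by
  have h1 := h.carry.succ L le_rfl h.carry.le
  have h2 := h.min hL
  have h3 := shr_half M (L - 1)
  have h4 := shr_half N (L - 1)
  rw [Nat.sub_add_cancel hL] at h3 h4
  omega

theorem growing_odd (h : Split M N L P) {t : ℕ} (ht : t < L) (hb : (M >>> t) % 2 = 1) :
    growing M N L (t + 1) = node (blk t (M >>> t - 1)) (growing M N L t) := by
  have h3 := shr_half M t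
  have hc : t + 1 < L ∨ (N >>> (L - 1)) % 2 = 1 := by
    by_cases h1 : t + 1 < L
    · exact Or.inl h1
    · obtain rfl : L = t + 1 := by omega
      exact Or.inr ((h.bits (by omega)).2 hb)
  rw [growing, growing, if_pos hc, if_pos (Or.inl ht), blk]
  rw [show M >>> t = 2 * M >>> (t + 1) + 1 by omega]
  rfl

theorem growing_even {t : ℕ} (ht : t < L) (hb : (M >>> t) % 2 = 0) :
    growing M N L (t + 1) = if Used M N L t then
      node (growing M N L t) (blk t (M >>> t + 1)) else growing M N L t := by
  have h3 := shr_half M t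
  by_cases hu : Used M N L t
  · rw [if_pos hu, growing, growing, if_pos hu.2, if_pos (Or.inl ht), blk,
      show 2 * M >>> (t + 1) = M >>> t by omega]
  · rw [if_neg hu, growing, growing, if_neg (c := t + 1 < L ∨ _) (fun h => hu ⟨hb, h⟩),
      if_pos (Or.inl ht)]
    rfl

theorem mtn_growing (h : Split M N L P) (hL : 1 ≤ L) : mtn N (L - 1) = growing M N L L := by
  obtain ⟨h1, h2⟩ := h.bits hL
  have h3 := shr_half M (L - 1)
  rw [Nat.sub_add_cancel hL] at h3
  rcases Nat.mod_two_eq_zero_or_one (N >>> (L - 1)) with hb | hb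
  · have hM : (M >>> (L - 1)) % 2 = 0 := by omega
    rw [mtn_even hb, growing, if_neg (by omega)]
    congr 1; omega
  · rw [mtn_odd hb, growing, if_pos (Or.inr hb), Nat.sub_add_cancel hL]
    congr 1; omega

end Split

/-- The block that contains the first new item. -/
theorem blk_old_odd {M t : ℕ} (hb : (M >>> t) % 2 = 1) : blk (t + 1) (M >>> (t + 1) - 1) = mtn M t := by
  rw [mtn_odd hb, shr_succ]

theorem blk_old_even {M t : ℕ} (h : 2 ≤ M >>> t) (hb : (M >>> t) % 2 = 0) :
    blk (t + 1) (M >>> (t + 1) - 1) = node (mtn M t) (blk t (M >>> t - 1)) := by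
  have h3 := shr_half M t
  rw [mtn_even hb, blk, show 2 * (M >>> (t + 1) - 1) = M >>> t - 2 by omega]
  congr 2; omega

/-! ### The increment proof is a cover -/

theorem blk_leaves_ne (h a : ℕ) : (blk h a).leaves ≠ [] := by simp [leaves_blk]

theorem mtn_leaves_ne (N q : ℕ) : (mtn N q).leaves ≠ [] := by
  rw [mtn]; split <;> exact blk_leaves_ne _ _

theorem built_blk (h a : ℕ) : Built [blk h a] (blk h a) := .base (blk_leaves_ne h a)

theorem built_mtn (N q : ℕ) : Built [mtn N q] (mtn N q) := .base (mtn_leaves_ne N q)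

theorem st_eq {N q : ℕ} (h : 2 ≤ N >>> q) : bel N q = (if Closes N q then
    node (bel N (q + 1)) (node (chn N (q + 1)) (mtn N q)) else bel N (q + 1)) ∧
    chn N q = if Closes N q then .empty else node (chn N (q + 1)) (mtn N q) := by
  split
  · rename_i hc; exact ⟨bel_close h hc, chn_close hc⟩
  · rename_i hc; exact ⟨bel_open hc, chn_open h hc⟩

theorem leaves_bel_chn (N q : ℕ) : (bel N q = .empty ∨ (bel N q).leaves ≠ []) ∧
    (chn N q = .empty ∨ (chn N q).leaves ≠ []) := by
  induction hn : N >>> q using Nat.strong_induction_on generalizing q with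
  | _ H ih =>
    subst hn
    by_cases h : N >>> q ≤ 1
    · exact ⟨Or.inl (bel_top h), Or.inl (chn_top h)⟩
    · obtain ⟨h1, h2⟩ := st_eq (not_le.1 h)
      have h3 := mtn_leaves_ne N q
      obtain ⟨i1, i2⟩ := ih (N >>> (q + 1)) (by rw [shr_succ]; omega) (q + 1) rfl
      rw [h1, h2]
      split
      · exact ⟨Or.inr (by simp [leaves, h3]), Or.inl rfl⟩
      · exact ⟨i1, Or.inr (by simp [leaves, h3])⟩

/-- The state of a bagging is composed from a list of nodes. -/
def BuiltSt (C : List MTree) (b c : MTree) : Prop :=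
  ∃ D E, C = D ++ E ∧ Built D b ∧ Built E c

theorem Built.eq_nil {C : List MTree} (h : Built C .empty) : C = [] := by
  cases h with
  | empty => rfl
  | base h => exact absurd rfl h

theorem BuiltSt.step {C D : List MTree} {N q : ℕ} (hq : 2 ≤ N >>> q) (hD : D ≠ [])
    (h : BuiltSt C (bel N (q + 1)) (chn N (q + 1))) (hm : Built D (mtn N q)) :
    BuiltSt (C ++ D) (bel N q) (chn N q) := by
  obtain ⟨C1, C2, rfl, h1, h2⟩ := h
  obtain ⟨e1, e2⟩ := st_eq hq
  rw [e1, e2]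
  split
  · refine ⟨C1 ++ (C2 ++ D), [], by simp, .node h1 (.node h2 hm (by simp [hD])) (by simp [hD]), .empty⟩
  · exact ⟨C1, C2 ++ D, by simp, h1, .node h2 hm (by simp [hD])⟩

theorem BuiltSt.peaks {C : List MTree} {N q : ℕ} (h : BuiltSt C (bel N q) (chn N q)) :
    BuiltSt (C ++ peaks N q) (bel N 0) (chn N 0) := by
  induction q generalizing C with
  | zero => simpa [MMB.peaks] using h
  | succ q ih =>
    rw [MMB.peaks]
    split
    · rename_i hq
      rw [← List.append_assoc]
      exact ih (h.step hq (by simp) (built_mtn N q))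
    · rename_i hq
      rw [List.nil_append]
      refine ih ?_
      have e : N >>> (q + 1) ≤ 1 := by rw [shr_succ]; omega
      rw [bel_top (by omega), chn_top (by omega)]
      rwa [bel_top e, chn_top e] at h

theorem BuiltSt.mmb {C : List MTree} {N : ℕ} (h : BuiltSt C (bel N 0) (chn N 0)) :
    Built C (bel N 0) := by
  obtain ⟨C1, C2, rfl, h1, h2⟩ := h
  rw [chn_close (Or.inl rfl)] at h2
  rw [h2.eq_nil, List.append_nil]
  exact h1

theorem built_opt_bel (N q : ℕ) : Built (opt (bel N q)) (bel N q) :=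
  Built.opt (leaves_bel_chn N q).1

theorem built_opt_chn (N q : ℕ) : Built (opt (chn N q)) (chn N q) :=
  Built.opt (leaves_bel_chn N q).2

theorem opt_empty : opt .empty = [] := rfl

section

variable {M N L P : ℕ}

/-- The old bagging above the carry, from the new one. -/
theorem Carry.builtSt_above (hc : Carry M N L P) :
    BuiltSt (opt (bel N (P + 1)) ++ opt (chn N (P + 1))) (bel M (P + 1)) (chn M (P + 1)) := by
  by_cases h : (M >>> (P + 1)) % 2 = 1 ∧ (M >>> (P + 2)) % 2 = 1
  · obtain ⟨h1, h2, h3⟩ := hc.st_old_succ.1 h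
    rw [h1, h2]
    refine ⟨_, [], (List.append_nil _).symm, .node (built_opt_bel _ _) (built_opt_chn _ _) ?_, .empty⟩
    rw [h3]; simp [opt]
  · obtain ⟨h1, h2⟩ := hc.st_old_succ.2 h
    rw [h1, h2]
    exact ⟨_, _, rfl, built_opt_bel _ _, built_opt_chn _ _⟩

theorem Carry.builtSt_old (hc : Carry M N L P) :
    BuiltSt (farNodes M N L P) (bel M L) (chn M L) := by
  -- the bagging above the range that is shifted
  have key : BuiltSt (opt (bel N (P + 1)) ++ opt (chn N (P + 1)) ++
      (if 2 ≤ M >>> P then [mtn M P] ++ (if L < P then [mtn M (P - 1)] else []) else []))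
      (bel M (if L < P then P - 1 else P)) (chn M (if L < P then P - 1 else P)) := by
    have h0 := hc.shr_old
    have h1 := hc.above_succ
    split
    · rename_i hG
      have := hc.builtSt_above.step hG (by simp) (built_mtn M P)
      split
      · rename_i hL
        have e : P - 1 + 1 = P := by omega
        have h2 := shr_succ M (P - 1)
        rw [e] at h2
        rw [← List.append_assoc]
        refine BuiltSt.step (by omega) (by simp) ?_ (built_mtn M (P - 1))
        rw [e]
        exact this
      · simpa using this
    · have e1 : N >>> (P + 1) ≤ 1 := by omega
      rw [bel_top e1, chn_top e1]
      have e2 : M >>> (if L < P then P - 1 else P) ≤ 1 := by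
        split
        · have h2 := shr_succ M (P - 1)
          rw [show P - 1 + 1 = P by omega] at h2
          omega
        · omega
      rw [bel_top e2, chn_top e2]
      exact ⟨[], [], rfl, .empty, .empty⟩
  rw [farNodes, ← List.append_assoc]
  by_cases h2 : L + 2 ≤ P
  · obtain ⟨h3, h4, h5⟩ := hc.chn_new_low h2
    simp only [if_pos (show L < P by omega)] at key ⊢
    obtain ⟨D1, D2, e, k1, k2⟩ := key
    rw [chn_close (hc.closes_old (by omega))] at k2
    rw [k2.eq_nil, List.append_nil] at e
    rw [if_pos h2, e]
    obtain ⟨s1, s2⟩ := st_eq (N := M) (q := L) (by have := (hc.four_le le_rfl h2).2; omega)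
    rw [s1, s2, h3, ← h3, h5]
    have hb := built_opt_chn N (L + 1)
    have ho : opt (chn N (L + 1)) = [chn N (L + 1)] := by rw [h3]; simp [opt]
    rw [ho] at hb
    split
    · exact ⟨_, [], (List.append_nil _).symm, .node k1 hb (by simp), .empty⟩
    · exact ⟨D1, _, rfl, k1, hb⟩
  · rw [if_neg h2, List.append_nil]
    have : (if L < P then P - 1 else P) = L := by have := hc.le; split <;> omega
    rwa [this] at key

/-- The new bagging at the level `L`, from the nodes above it and the block `Z` with the first new
item. -/
theorem Carry.builtSt_new (hc : Carry M N L P) (hg : 1 ≤ M >>> L) {D : List MTree} (hD : D ≠ [])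
    (hZ : Built D (blk L (M >>> L - 1))) :
    BuiltSt (farNodes M N L P ++ D) (bel N L) (chn N L) := by
  have hG := hc.shr_old
  have hs := hc.shr_new
  rcases Nat.lt_or_ge L P with hL | hL
  · have hm := hc.mtn_low hL
    refine BuiltSt.step (by have := hc.succ L le_rfl hL.le; omega) hD ?_ (hm ▸ hZ)
    -- the merged mountain ends a range
    have hb : Built (opt (bel N (P + 1)) ++ opt (chn N (P + 1)) ++
        (if 2 ≤ M >>> P then [mtn M P] ++ [mtn M (P - 1)] else [])) (bel N P) := by
      split
      · rw [hc.bel_new hL (by omega), hc.mtn_new (by omega), ← hc.mtn_old, ← hc.mtn_old_pred hL,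
          List.append_assoc]
        exact .node (built_opt_bel _ _) (.node (built_opt_chn _ _) (.node (built_mtn _ _)
          (built_mtn _ _) (by simp)) (by simp)) (by simp)
      · rename_i h2
        have h3 := hc.above_succ
        rw [bel_top (N := N) (q := P) (by omega), bel_top (by omega), chn_top (by omega)]
        exact .empty
    rw [farNodes, if_pos hL, ← List.append_assoc]
    by_cases h2 : L + 2 ≤ P
    · rw [if_pos h2, (hc.chn_new_low h2).2.1]
      have ho : opt (chn N (L + 1)) = [chn N (L + 1)] := by rw [(hc.chn_new_low h2).1]; simp [opt]
      exact ⟨_, _, rfl, hb, ho ▸ built_opt_chn N (L + 1)⟩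
    · obtain rfl : P = L + 1 := by omega
      rw [if_neg h2, chn_close (hc.closes_new hL)]
      exact ⟨_, [], rfl, hb, .empty⟩
  · obtain rfl : L = P := le_antisymm hc.le hL
    rw [farNodes, if_pos (by omega), if_neg (lt_irrefl _), if_neg (by omega), List.append_nil,
      List.append_nil, List.append_assoc]
    refine BuiltSt.step (by omega) (by simp) ⟨_, _, rfl, built_opt_bel _ _, built_opt_chn _ _⟩ ?_
    rw [hc.mtn_new (by omega), ← hc.mtn_old]
    refine .node (built_mtn _ _) ?_ (by simp)
    rwa [hG] at hZ

end

namespace Split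

variable {M N L P : ℕ}

theorem newBlocks_succ (t d : ℕ) : newBlocks M N L t (d + 1) =
    newBlocks M N L t d ++ (if Used M N L (t + d) then [blk (t + d) (M >>> (t + d) + 1)] else []) := by
  induction d generalizing t with
  | zero => simp [newBlocks]
  | succ d ih =>
    rw [newBlocks, ih, newBlocks, List.append_assoc, Nat.add_right_comm, Nat.add_assoc]

/-- The lowest `t` old mountains and new blocks compose the block of the first new item and the
block after it. -/
theorem built_blocks (h : Split M N L P) (hM : 2 ≤ M) (t : ℕ) (ht : t ≤ L) :
    let S := peaks M t ++ leaf M :: leaf (M + 1) :: newBlocks M N L 0 t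
    (1 ≤ M >>> t → ∃ D E, D ≠ [] ∧ S = D ++ E ∧ Built D (blk t (M >>> t - 1)) ∧
      (t ≤ L → 1 ≤ L → Built E (growing M N L t))) ∧
    (M >>> t = 0 → Built S (growing M N L t)) := by
  induction t with
  | zero =>
    refine ⟨fun _ => ⟨[leaf M], [leaf (M + 1)], by simp, by simp [peaks, newBlocks], ?_, fun _ hL => ?_⟩,
      fun h => ?_⟩
    · have := built_blk 0 (M - 1)
      rw [blk, Nat.sub_add_cancel (by omega)] at this
      simpa [blk, Nat.sub_add_cancel (show 1 ≤ M by omega)] using this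
    · rw [growing, if_pos (Or.inl (by omega))]
      exact built_blk 0 M
    · rw [Nat.shiftRight_zero] at h; omega
  | succ t ih =>
    have ih := ih (by omega)
    simp only at ih ⊢
    have h3 := shr_half M t
    have hL : 1 ≤ L := by omega
    rw [newBlocks_succ, Nat.zero_add, peaks]
    set S := peaks M t ++ leaf M :: leaf (M + 1) :: newBlocks M N L 0 t with hS
    have e : ∀ A B, (A ++ peaks M t) ++ leaf M :: leaf (M + 1) :: (newBlocks M N L 0 t ++ B) =
        A ++ S ++ B := by intro A B; simp [hS]
    rw [e]
    rcases Nat.mod_two_eq_zero_or_one (M >>> t) with hb | hb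
    · have hg := growing_even (N := N) (show t < L by omega) hb
      constructor
      · intro h1
        obtain ⟨D, E, hD, i1, i2, i3⟩ := ih.1 (by omega)
        have i3 := i3 (by omega) hL
        have h2 : 2 ≤ M >>> t := by omega
        rw [if_pos h2, i1, hg]
        refine ⟨[mtn M t] ++ D, E ++ (if Used M N L t then [blk t (M >>> t + 1)] else []),
          by simp, by simp, ?_, fun _ _ => ?_⟩
        · rw [blk_old_even h2 hb]
          exact .node (built_mtn _ _) i2 (by simp)
        · split
          · exact .node i3 (built_blk _ _) (by simp)
          · simpa using i3
      · intro h1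
        have i := ih.2 (by omega)
        rw [if_neg (by omega), hg, List.nil_append]
        split
        · exact .node i (built_blk _ _) (by simp)
        · simpa using i
    · have hg := h.growing_odd (show t < L by omega) hb
      obtain ⟨D, E, hD, i1, i2, i3⟩ := ih.1 (by omega)
      have i3 := i3 (by omega) hL
      rw [if_neg (c := Used M N L t) (fun hu => by have := hu.1; omega), List.append_nil, hg]
      have hn : Built S (node (blk t (M >>> t - 1)) (growing M N L t)) := by
        rw [i1]; exact .node i2 i3 (by simp [hD])
      constructor
      · intro h1
        rw [if_pos (by omega)]
        refine ⟨[mtn M t], S, by simp, rfl, ?_, fun _ _ => hn⟩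
        rw [blk_old_odd hb]
        exact built_mtn _ _
      · intro h1
        rw [if_neg (by omega), List.nil_append]
        exact hn

/-- The nodes of an increment proof compose the old and the new bagging. -/
theorem built (h : Split M N L P) (hM : 2 ≤ M) :
    Built (farNodes M N L P ++ peaks M L) (bel M 0) ∧
    Built (farNodes M N L P ++ peaks M L ++ nearNodes M N L) (bel N 0) := by
  have hc := h.carry
  refine ⟨hc.builtSt_old.peaks.mmb, ?_⟩
  rcases Nat.eq_zero_or_pos L with rfl | hL
  · have := hc.builtSt_new (D := [leaf M]) (by rw [Nat.shiftRight_zero]; omega) (by simp) (by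
      have := built_blk 0 (M - 1)
      simpa [blk, Nat.sub_add_cancel (show 1 ≤ M by omega)] using this)
    simpa [peaks, nearNodes] using this.mmb
  · have e : peaks M L ++ nearNodes M N L =
        (peaks M L ++ leaf M :: leaf (M + 1) :: newBlocks M N L 0 L) ++ peaks N (L - 1) := by
      rw [nearNodes, if_pos (show 1 ≤ L from hL)]; simp
    obtain ⟨i1, i2⟩ := h.built_blocks hM L le_rfl
    have h2 : 2 ≤ N >>> (L - 1) := (Nat.le_add_left 2 _).trans (h.min hL)
    rw [List.append_assoc, e, ← List.append_assoc]
    refine BuiltSt.mmb (BuiltSt.peaks ?_)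
    have eL : L - 1 + 1 = L := by omega
    by_cases hg : 1 ≤ M >>> L
    · obtain ⟨D, E, hD, hS, hZ, hY⟩ := i1 hg
      rw [hS, ← List.append_assoc]
      have hY := hY le_rfl hL
      refine BuiltSt.step h2 ?_ ?_ (h.mtn_growing hL ▸ hY)
      · rintro rfl
        have h0 := hY.leaves
        have h1 := mtn_leaves_ne N (L - 1)
        rw [h.mtn_growing hL, ← h0] at h1
        exact h1 rfl
      · rw [eL]
        exact hc.builtSt_new hg hD hZ
    · have hg0 : M >>> L = 0 := Nat.lt_one_iff.1 (not_le.1 hg)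
      have hY := i2 hg0
      refine BuiltSt.step h2 (by simp) ?_ (h.mtn_growing hL ▸ hY)
      have h0 : N >>> L = 1 := by rw [hc.succ L le_rfl hc.le, hg0]
      have hfar : farNodes M N L P = [] := by
        have hP : L = P := by
          by_contra hne
          have := hc.odd L le_rfl (lt_of_le_of_ne hc.le hne)
          rw [hg0] at this
          exact absurd this (by norm_num)
        subst hP
        have h4 := hc.above_succ
        have h5 := hc.shr_old
        rw [farNodes, bel_top (by omega), chn_top (by omega), if_neg (by omega), if_neg (by omega)]
        rfl
      rw [eL, bel_top h0.le, chn_top h0.le, hfar]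
      exact ⟨[], [], rfl, .empty, .empty⟩

end Split

/-! ### The size of an increment proof -/

theorem length_opt (t : MTree) : (opt t).length ≤ 1 := by
  unfold opt; split <;> simp

theorem length_peaks (N q : ℕ) : (peaks N q).length ≤ q := by
  induction q with
  | zero => simp [peaks]
  | succ q ih => rw [peaks]; split <;> simp <;> omega

theorem length_newBlocks (M N L t d : ℕ) : (newBlocks M N L t d).length ≤ d := by
  induction d generalizing t with
  | zero => simp [newBlocks]
  | succ d ih => have := ih (t + 1); rw [newBlocks]; split <;> simp <;> omega

theorem length_cover (M N L P : ℕ) :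
    (farNodes M N L P ++ peaks M L ++ nearNodes M N L).length ≤ 3 * L + 7 := by
  have h1 := length_opt (bel N (P + 1))
  have h2 := length_opt (chn N (P + 1))
  have h3 := length_peaks M L
  have h4 := length_peaks N (L - 1)
  have h5 := length_newBlocks M N L 0 L
  have h6 : (farNodes M N L P).length ≤ 5 := by
    simp only [farNodes, List.length_append]
    split <;> split <;> try split
    all_goals simp
    all_goals omega
  have h7 : (nearNodes M N L).length ≤ 2 + 2 * L := by
    rw [nearNodes]
    split <;> simp <;> omega
  simp only [List.length_append]
  omega

theorem exists_level (M N : ℕ) : ∃ L, N >>> L ≤ M >>> L + 1 :=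
  ⟨N, by rw [Nat.shiftRight_eq_div_pow, Nat.div_eq_of_lt Nat.lt_two_pow_self]; exact Nat.zero_le _⟩

/-- The lowest level at which the numbers of blocks differ by at most one. -/
def level (M N : ℕ) : ℕ := Nat.find (exists_level M N)

/-- The position at which the carry from `M` to `N` ends. -/
def carryEnd (M N : ℕ) : ℕ :=
  level M N + Nat.log 2 (N >>> level M N - (N >>> level M N &&& M >>> level M N))

theorem split {M N : ℕ} (h : M < N) : Split M N (level M N) (carryEnd M N) := by
  have h1 : N >>> level M N ≤ M >>> level M N + 1 := Nat.find_spec (exists_level M N)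
  have hmin : ∀ t < level M N, M >>> t + 2 ≤ N >>> t := fun t ht => by
    have := Nat.find_min (exists_level M N) ht
    omega
  have h2 : N >>> level M N = M >>> level M N + 1 := by
    rcases Nat.eq_zero_or_pos (level M N) with h0 | h0
    · rw [h0, Nat.shiftRight_zero, Nat.shiftRight_zero] at h1 ⊢; omega
    · have h3 := hmin (level M N - 1) (by omega)
      have h4 := shr_half M (level M N - 1)
      have h5 := shr_half N (level M N - 1)
      rw [Nat.sub_add_cancel h0] at h4 h5
      omega
  obtain ⟨P, hc, hp⟩ := exists_carry h2
  have : carryEnd M N = P := by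
    have := hc.le
    rw [carryEnd, hp, Nat.log_pow (by norm_num)]; omega
  exact ⟨this ▸ hc, fun h0 => hmin _ (by omega)⟩

/-- The level is logarithmic in the number of new items. -/
theorem level_le {M N : ℕ} (h : M < N) : level M N ≤ lg (N - M) := by
  rcases Nat.eq_zero_or_pos (level M N) with h0 | h0
  · omega
  · have h1 := (split h).min h0
    rw [Nat.shiftRight_eq_div_pow, Nat.shiftRight_eq_div_pow] at h1
    set p := 2 ^ (level M N - 1) with hp
    have hp0 : 0 < p := Nat.two_pow_pos _
    have h2 := Nat.div_mul_le_self N p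
    have h3 := Nat.lt_div_mul_add (a := M) hp0
    have h4 : (M / p + 2) * p ≤ N / p * p := Nat.mul_le_mul_right _ h1
    have h5 : p ≤ N - M := by
      rw [Nat.add_mul] at h4; omega
    have := Nat.le_log_of_pow_le (b := 2) (by norm_num) h5
    rw [lg]; omega

/-- The nodes of the increment proof from `m` to `n` items. -/
def coverNodes (m n : ℕ) : List MTree :=
  farNodes (m + 1) (n + 1) (level (m + 1) (n + 1)) (carryEnd (m + 1) (n + 1)) ++
    peaks (m + 1) (level (m + 1) (n + 1)) ++ nearNodes (m + 1) (n + 1) (level (m + 1) (n + 1))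

/-- The nodes of `coverNodes` that are nodes for `m` items. -/
def coverOld (m n : ℕ) : List MTree :=
  farNodes (m + 1) (n + 1) (level (m + 1) (n + 1)) (carryEnd (m + 1) (n + 1)) ++
    peaks (m + 1) (level (m + 1) (n + 1))

theorem built_cover {m n : ℕ} (hm : 1 ≤ m) (h : m < n) :
    Built (coverOld m n) (mmb m) ∧ Built (coverNodes m n) (mmb n) := by
  rw [mmb_eq, mmb_eq]
  exact (split (show m + 1 < n + 1 by omega)).built (by omega)

theorem length_coverNodes {m n : ℕ} (h : m < n) : (coverNodes m n).length ≤ 10 * lg (n - m) := by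
  have h1 := length_cover (m + 1) (n + 1) (level (m + 1) (n + 1)) (carryEnd (m + 1) (n + 1))
  have h2 := level_le (show m + 1 < n + 1 by omega)
  rw [show n + 1 - (m + 1) = n - m by omega] at h2
  have h3 : 1 ≤ lg (n - m) := by rw [lg]; omega
  rw [coverNodes]
  omega

theorem coverOld_subset (m n : ℕ) : coverOld m n ⊆ coverNodes m n :=
  fun _ h => List.mem_append_left _ h

theorem isIncrementCover_coverNodes {m n : ℕ} (hm : 1 ≤ m) (h : m < n) :
    IsIncrementCover m n (coverNodes m n) := by
  obtain ⟨h1, h2⟩ := built_cover hm h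
  exact (isIncrementCover_of_built h.le h1 h2).1

/-! ### Reading a message -/

section

variable {ℓ : ℕ} {E : Env ℓ}

/-- Receive the next hash value of the message, or the default value. The word cell `9` tells whether
all values have been received so far. -/
def fetchTo (dst : Expr) : Cmd := .null dst ++ .recv dst 10 ++ assign 9 (var 9 * var 10)

/-- After `k` values of the message `π` have been requested. -/
def Received (π : List (Digest ℓ)) (k : ℕ) (s : St ℓ) : Prop :=
  s.inbox = π.drop k ∧ s.words 9 = if k ≤ π.length then 1 else 0

theorem fetchTo_received (h1 : 20 < E.bound) (h2 : 20 < E.space) {π : List (Digest ℓ)} {k : ℕ}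
    {s : St ℓ} (h : Received π k s) {dst : Expr} {p : ℕ}
    (ho : dst.Ok E s) (hv : dst.val s = p) (ho' : dst.Ok E (s.setDig p E.A.dflt))
    (hv' : dst.val (s.setDig p E.A.dflt) = p) (hp : p < E.space) {Q : St ℓ → Prop}
    (hQ : ∀ s' : St ℓ, (∀ k, k ≠ 9 → k ≠ 10 → s'.words k = s.words k) →
      (∀ k, k ≠ p → s'.digs k = s.digs k) → s'.digs p = π.getD k E.A.dflt →
      Received π (k + 1) s' → Q s') :
    (fetchTo dst).Pre E Q s := by
  obtain ⟨h4, h5⟩ := h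
  have h6 : s.words 9 ≤ 1 := by rw [h5]; split <;> omega
  simp only [fetchTo, pre_append, pre_null, pre_recv, pre_assign, hv, hv', ok_ofNat, val_ofNat]
  refine ⟨ho, hp, ho', hp, by omega, by omega, by omega, by omega, ?_⟩
  have hr : (s.setDig p E.A.dflt).inbox = π.drop k := h4
  rcases Nat.lt_or_ge k π.length with hl | hl
  · have e1 : π.drop k = π[k] :: π.drop (k + 1) := List.drop_eq_getElem_cons hl
    rw [e1] at hr
    rw [if_pos hl.le] at h5
    have e2 : (s.setDig p E.A.dflt).receive p 10 =
        ((((s.setDig p E.A.dflt).setDig p π[k]).setWord 10 1).setInbox (π.drop (k + 1))) := by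
      rw [St.receive, hr]
    rw [e2]
    refine ⟨by simp [h5]; omega, hQ _ (by simp +contextual) (by simp +contextual) ?_
      ⟨by simp, by simp [h5]; omega⟩⟩
    simp [List.getD_eq_getElem?_getD, List.getElem?_eq_getElem hl]
  · have e1 : π.drop k = [] := List.drop_eq_nil_of_le hl
    rw [e1] at hr
    have e2 : (s.setDig p E.A.dflt).receive p 10 = (s.setDig p E.A.dflt).setWord 10 0 := by
      rw [St.receive, hr]
    rw [e2]
    refine ⟨by simp; omega, hQ _ (by simp +contextual) (by simp +contextual) ?_
      ⟨?_, by simp; omega⟩⟩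
    · simp [List.getD_eq_getElem?_getD, List.getElem?_eq_none hl]
    · rw [List.drop_eq_nil_of_le (by omega)]
      exact hr

/-- The values `π` for the nodes `C` are expected, and the nodes `rest` are still to come. -/
def Stream (C : List MTree) (π : List (Digest ℓ)) (rest : List MTree) (s : St ℓ) : Prop :=
  ∃ pre, C = pre ++ rest ∧ Received π pre.length s

theorem Stream.congr {C : List MTree} {π : List (Digest ℓ)} {rest : List MTree} {s s' : St ℓ}
    (h : Stream C π rest s) (hi : s'.inbox = s.inbox) (hw : s'.words 9 = s.words 9) :
    Stream C π rest s' := by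
  obtain ⟨pre, h1, h2, h3⟩ := h
  exact ⟨pre, h1, hi.trans h2, hw.trans h3⟩

theorem fetchTo_pre (h1 : 20 < E.bound) (h2 : 20 < E.space) {C : List MTree} {π : List (Digest ℓ)}
    {u : MTree} {rest : List MTree} {s : St ℓ} (h : Stream C π (u :: rest) s) {dst : Expr} {p : ℕ}
    (ho : dst.Ok E s) (hv : dst.val s = p) (ho' : dst.Ok E (s.setDig p E.A.dflt))
    (hv' : dst.val (s.setDig p E.A.dflt) = p) (hp : p < E.space) {Q : St ℓ → Prop}
    (hQ : ∀ s' : St ℓ, (∀ k, k ≠ 9 → k ≠ 10 → s'.words k = s.words k) →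
      (∀ k, k ≠ p → s'.digs k = s.digs k) → Comp E.A C π u (s'.digs p) → Stream C π rest s' → Q s') :
    (fetchTo dst).Pre E Q s := by
  obtain ⟨pre, h3, h4⟩ := h
  refine fetchTo_received h1 h2 h4 ho hv ho' hv' hp fun s' hw hd hc hr => hQ s' hw hd ?_
    ⟨pre ++ [u], by simp [h3], by simpa using hr⟩
  rw [hc]
  exact Comp.base (by rw [h3]; simp)

/-! ### Bagging one more mountain -/

/-- Whether a range ends after the mountain `q`, if the mask of the range ends is in the cell `w`. -/
def endsE (w : ℕ) (q : Expr) : Expr := (var w >>> q) % 2 + eqE q 0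

/-- Extend the belt and the chain in the cells `b` and `c` by the mountain in the cell `t`. -/
def bagCmd (b c : ℕ) (t ends : Expr) : Cmd :=
  .hash (.const c) (.const c) t ++
    .ite ends (.hash (.const b) (.const b) (.const c) ++ .null (.const c))
      (.copy (.const c) (.const c))

/-- The values of the belt and the chain at the mountain `q` are in the cells `b` and `c`. -/
def CompSt (A : Hashing ℓ) (C : List MTree) (π : List (Digest ℓ)) (N q b c : ℕ) (s : St ℓ) : Prop :=
  Comp A C π (bel N q) (s.digs b) ∧ Comp A C π (chn N q) (s.digs c)

theorem endMask_le (N : ℕ) : endMask N ≤ N := (Nat.mod_le _ _).trans (xor_and_le _ _)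

theorem val_endsE {s : St ℓ} {w N q : ℕ} {e : Expr} (hw : s.words w = endMask N) (he : e.val s = q)
    (hq : 2 ≤ N >>> q) : (endsE w e).val s ≠ 0 ↔ Closes N q := by
  simp only [endsE, val_add, val_mod, val_shr, val_var, val_eq, hw, he, val_ofNat]
  rcases Nat.eq_zero_or_pos q with rfl | h0
  · simp [Closes]
  · have := endMask_bit (N := N) (q := q) h0
    rw [if_neg (by omega)]
    have hl := lt_log_of_two_le_shr hq
    constructor
    · intro h; exact (this.1 (by omega)).2
    · intro h; have := this.2 ⟨hl, h⟩; omega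

theorem ok_endsE (h1 : 20 < E.bound) {s : St ℓ} {w : ℕ} {e : Expr} (hw : w < E.space)
    (hw' : w < E.bound) (hv : s.words w < E.bound) (he : e.Ok E s) : (endsE w e).Ok E s := by
  simp only [endsE, ok_add, ok_mod, ok_shr, ok_var, ok_eq, ok_ofNat, val_add, val_mod,
    val_ofNat]
  have h : (eqE e 0).val s ≤ 1 := by rw [val_eq]; split <;> omega
  refine ⟨⟨⟨⟨hw', hw, hv⟩, he⟩, by omega⟩, ⟨he, by omega⟩, by omega⟩

/-- To verify a program for a postcondition, it can be taken as unknown. -/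
theorem pre_of_forall {P : Cmd} {s : St ℓ} {I : St ℓ → Prop}
    (h : ∀ Q : St ℓ → Prop, (∀ s', I s' → Q s') → P.Pre E Q s) : P.Pre E I s := h _ fun _ h => h

theorem bagCmd_pre (h1 : 20 < E.bound) (h2 : 20 < E.space) {C : List MTree} {π : List (Digest ℓ)}
    {s : St ℓ} {N q b c : ℕ} {t ends : Expr} {p : ℕ} (hbc : b ≠ c) (hb : b ≤ 20) (hc : c ≤ 20)
    (ht : t.Ok E s) (hp : t.val s = p) (hps : p < E.space) (hends : ∀ d, ends.Ok E (s.setDig c d))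
    (hval : ∀ d, ends.val (s.setDig c d) ≠ 0 ↔ Closes N q) (hq : 2 ≤ N >>> q)
    (h : CompSt E.A C π N (q + 1) b c s) (hm : Comp E.A C π (mtn N q) (s.digs p)) {Q : St ℓ → Prop}
    (hQ : ∀ s' : St ℓ, s'.words = s.words → s'.inbox = s.inbox →
      (∀ k, k ≠ b → k ≠ c → s'.digs k = s.digs k) → CompSt E.A C π N q b c s' → Q s') :
    (bagCmd b c t ends).Pre E Q s := by
  obtain ⟨i1, i2⟩ := h
  obtain ⟨e1, e2⟩ := st_eq hq
  have hn := Comp.node i2 hm (Or.inr (mtn_ne_empty N q))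
  simp only [bagCmd, pre_append, pre_hash, pre_ite, pre_null, pre_copy, ok_const, val_const, hp]
  refine ⟨by omega, by omega, by omega, by omega, ht, hps, hends _, fun hv => ?_, fun hv => ?_⟩
  · have hcl := (hval _).1 hv
    refine ⟨by omega, by omega, by omega, by omega, by omega, by omega, by omega, by omega,
      hQ _ (by simp) (by simp) (by simp +contextual) ⟨?_, ?_⟩⟩
    · rw [e1, if_pos hcl]
      have := Comp.node i1 hn (Or.inr (by simp))
      simpa [hbc] using this
    · rw [e2, if_pos hcl]
      simpa using Comp.empty
  · have hcl : ¬ Closes N q := fun h => (hval _).2 h hv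
    refine ⟨by omega, by omega, by omega, by omega,
      hQ _ (by simp) (by simp) (by simp +contextual) ⟨?_, ?_⟩⟩
    · rw [e1, if_neg hcl]
      simpa [hbc] using i1
    · rw [e2, if_neg hcl]
      simpa using hn

/-! ### The loop over the lower mountains -/

/-- Receive the mountain `q` to the right of the one with the index in the word cell `11` into the cell
`20 + q`, if it exists, and extend the belt and the chain in the cells `b` and `c` by it. The word
cells `w` and `v` contain the number and the mask of its range ends. -/
def peaksBody (w v b c : ℕ) : Cmd :=
  assign 11 (var 11 - 1) ++
  .ite (ltE 1 (var w >>> var 11))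
    (fetchTo (20 + var 11) ++ bagCmd b c (20 + var 11) (endsE v (var 11)))
    (.null (20 + var 11))

/-- Receive the mountains below the one with the index in the word cell `11`, and bag them. -/
def peaksLoop (w v b c : ℕ) : Cmd := .loop (var 11) (peaksBody w v b c)

theorem peaksLoop_runs {N : ℕ} (h1 : 100 * (N + 2) ≤ E.bound) (h2 : Nat.log 2 N + 40 ≤ E.space)
    {C R : List MTree} {π : List (Digest ℓ)} {s : St ℓ} {M q w v b c : ℕ} (hbc : b ≠ c) (hb : b < 20)
    (hc : c < 20) (hw : w < 9) (hv : v < 9) (hMN : M ≤ N) (hs : s.words 11 = q)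
    (hsw : s.words w = M) (hsv : s.words v = endMask M) (hq : q ≤ Nat.log 2 N)
    (hstr : Stream C π (peaks M q ++ R) s) (h : CompSt E.A C π M q b c s) :
    RunsIn E (peaksLoop w v b c) s (100 * q + 100) fun s' =>
      Stream C π R s' ∧ CompSt E.A C π M 0 b c s' ∧
      (∀ t, t < q → 2 ≤ M >>> t → Comp E.A C π (mtn M t) (s'.digs (20 + t))) ∧
      (∀ k, k ≠ 9 → k ≠ 10 → k ≠ 11 → s'.words k = s.words k) ∧
      (∀ k, k < 20 → k ≠ b → k ≠ c → s'.digs k = s.digs k) := by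
  have hlog : Nat.log 2 N ≤ N := Nat.log_le_self _ _
  have hem := endMask_le M
  have key := RunsIn.loop (E := E) (by omega) (e := var 11) (P := peaksBody w v b c)
    (T := (peaksBody w v b c).cost) (fun k s' => k ≤ q ∧ s'.words 11 = k ∧
      Stream C π (peaks M k ++ R) s' ∧ CompSt E.A C π M k b c s' ∧
      (∀ t, k ≤ t → t < q → 2 ≤ M >>> t → Comp E.A C π (mtn M t) (s'.digs (20 + t))) ∧
      (∀ k, k ≠ 9 → k ≠ 10 → k ≠ 11 → s'.words k = s.words k) ∧
      (∀ k, k < 20 → k ≠ b → k ≠ c → s'.digs k = s.digs k)) ?_ ?_ q s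
      ⟨le_rfl, hs, hstr, h, fun t h1 h2 => by omega, fun _ _ _ _ => rfl, fun _ _ _ _ => rfl⟩
  · refine key.mono ?_ fun s' h' => ⟨by simpa [peaks] using h'.2.2.1, h'.2.2.2.1,
      fun t => h'.2.2.2.2.1 t (Nat.zero_le _), h'.2.2.2.2.2.1, h'.2.2.2.2.2.2⟩
    have hcost : 1 + (var 11).size + (peaksBody w v b c).cost ≤ 100 := Nat.le_of_ble_eq_true rfl
    have := Nat.mul_le_mul_left q hcost
    omega
  · rintro k s' ⟨hk, h11, hst, hcs, hT, hfw, hfd⟩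
    refine ⟨by simp [h11]; omega, by simp [h11], runsIn_of_pre (by omega)
      (pre_of_forall fun Q hQ => ?_)⟩
    have hw' : s'.words w = M := by rw [hfw w (by omega) (by omega) (by omega), hsw]
    have hv' : s'.words v = endMask M := by rw [hfw v (by omega) (by omega) (by omega), hsv]
    simp only [peaksBody, pre_append, pre_assign, pre_ite, pre_null]
    simp [h11, show w ≠ 11 by omega, hw']
    repeat refine ⟨by omega, ?_⟩
    refine ⟨fun hge => ?_, fun hlt => ?_⟩
    · rw [peaks, if_pos (by omega), List.append_assoc] at hst
      refine fetchTo_pre (C := C) (π := π) (u := mtn M k) (rest := peaks M k ++ R) (by omega) (by omega)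
        (p := 20 + k) (hst.congr (by simp) (by simp)) (by simp; omega) (by simp) (by simp; omega)
        (by simp) (by omega) fun s1 hw1 hd1 hc1 hs1 => ?_
      have h11' : s1.words 11 = k := by rw [hw1 11 (by omega) (by omega)]; simp
      have hv1 : s1.words v = endMask M := by
        rw [hw1 v (by omega) (by omega)]; simp [hv', show v ≠ 11 by omega]
      refine bagCmd_pre (C := C) (π := π) (N := M) (q := k) (p := 20 + k) (by omega) (by omega) hbc (by omega)
        (by omega) (by simp [h11']; omega) (by simp [h11']) (by omega) ?_ ?_ (by omega) ⟨?_, ?_⟩ hc1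
        fun s2 hw2 hi2 hd2 hc2 => ?_
      · intro d
        exact ok_endsE (by omega) (by omega) (by omega) (by rw [words_setDig, hv1]; omega)
          (by simp [h11']; omega)
      · intro d
        exact val_endsE (by simpa using hv1) (by simpa using h11') (by omega)
      · rw [hd1 _ (by omega)]; simpa using hcs.1
      · rw [hd1 _ (by omega)]; simpa using hcs.2
      · refine hQ _ ⟨by omega, by rw [hw2, h11'], hs1.congr hi2 (by rw [hw2]), hc2, fun t ht1 ht2 ht3 => ?_, ?_, ?_⟩
        · rw [hd2 _ (by omega) (by omega)]
          rcases Nat.lt_or_ge k t with h | h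
          · rw [hd1 _ (by omega)]; simpa using hT t h ht2 ht3
          · obtain rfl : t = k := by omega
            exact hc1
        · intro i i1 i2 i3
          rw [hw2, hw1 i i1 i2, words_setWord, if_neg i3, hfw i i1 i2 i3]
        · intro i i1 i2 i3
          rw [hd2 i i2 i3, hd1 i (by omega), digs_setWord, hfd i i1 i2 i3]
    · rw [peaks, if_neg (by omega), List.nil_append] at hst
      repeat refine ⟨by omega, ?_⟩
      refine hQ _ ⟨by omega, by simp, hst.congr (by simp) (by simp), ?_, fun t ht1 ht2 ht3 => ?_,
        ?_, ?_⟩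
      · have e : M >>> (k + 1) ≤ 1 := by rw [shr_succ]; omega
        obtain ⟨c1, c2⟩ := hcs
        rw [bel_top e] at c1
        rw [chn_top e] at c2
        rw [CompSt, bel_top (by omega), chn_top (by omega)]
        simpa [show b ≠ 20 + k by omega, show c ≠ 20 + k by omega] using And.intro c1 c2
      · rcases Nat.lt_or_ge k t with h | h
        · simpa [show t ≠ k by omega] using hT t h ht2 ht3
        · obtain rfl : t = k := by omega
          omega
      · intro i i1 i2 i3
        simp [i3, hfw i i1 i2 i3]
      · intro i i1 i2 i3
        simp [show i ≠ 20 + k by omega, hfd i i1 i2 i3]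
  · rintro s' ⟨hk, h11, hst, hcs, hT, hfw, hfd⟩
    refine ⟨by simp [h11]; omega, by simp [h11]⟩

end

/-! ### The loop over the new blocks -/

section

variable {ℓ : ℕ} {E : Env ℓ}

/-- One level of the composition of the blocks next to the first new item, in the cells `9` and
`10`, from the old mountains in the cells `20 + t` and the new blocks. The word cells `3, 4, 5`
contain `M`, `N` and the number of levels, and `11` the current one. -/
def blocksBody : Cmd :=
  .ite ((var 3 >>> var 11) % 2)
    (.hash 10 9 10 ++ .copy 9 (20 + var 11))
    (.hash 9 (20 + var 11) 9 ++
      .ite (ltE (var 11 + 1) (var 5) + (var 4 >>> (var 5 - 1)) % 2)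
        (fetchTo 13 ++ .hash 10 10 13) (.copy 13 13)) ++
  assign 11 (var 11 + 1)

/-- The composition of the blocks up to the level in the word cell `5`. -/
def blocksLoop : Cmd := .loop (ltE (var 11) (var 5)) blocksBody

theorem growing_ne_empty (M N L t : ℕ) : growing M N L t ≠ .empty := by
  unfold growing; split <;> exact blk_ne_empty _ _

theorem blocksLoop_runs {M N L P : ℕ} (hs : Split M N L P) (h1 : 100 * (N + 2) ≤ E.bound)
    (h2 : Nat.log 2 N + 40 ≤ E.space) (hMN : M ≤ N) (hL : L ≤ Nat.log 2 N)
    {C R : List MTree} {π : List (Digest ℓ)} {s : St ℓ} (w3 : s.words 3 = M) (w4 : s.words 4 = N)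
    (w5 : s.words 5 = L) (w11 : s.words 11 = 0)
    (hstr : Stream C π (newBlocks M N L 0 L ++ R) s)
    (hT : ∀ t, t < L → 2 ≤ M >>> t → Comp E.A C π (mtn M t) (s.digs (20 + t)))
    (hZ : Comp E.A C π (blk 0 (M - 1)) (s.digs 9))
    (hY : 1 ≤ L → Comp E.A C π (growing M N L 0) (s.digs 10)) :
    RunsIn E blocksLoop s (100 * L + 100) fun s' =>
      Stream C π R s' ∧ (1 ≤ M >>> L → Comp E.A C π (blk L (M >>> L - 1)) (s'.digs 9)) ∧
      (1 ≤ L → Comp E.A C π (growing M N L L) (s'.digs 10)) ∧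
      (∀ k, k ≠ 9 → k ≠ 10 → k ≠ 11 → s'.words k = s.words k) ∧
      (∀ k, k ≠ 9 → k ≠ 10 → k ≠ 13 → s'.digs k = s.digs k) := by
  have hlog : Nat.log 2 N ≤ N := Nat.log_le_self _ _
  have key := RunsIn.loop (E := E) (by omega) (e := ltE (var 11) (var 5)) (P := blocksBody)
    (T := blocksBody.cost) (fun d s' => ∃ t, t + d = L ∧ s'.words 11 = t ∧
      Stream C π (newBlocks M N L t d ++ R) s' ∧
      (1 ≤ M >>> t → Comp E.A C π (blk t (M >>> t - 1)) (s'.digs 9)) ∧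
      (1 ≤ L → Comp E.A C π (growing M N L t) (s'.digs 10)) ∧
      (∀ k, k ≠ 9 → k ≠ 10 → k ≠ 11 → s'.words k = s.words k) ∧
      (∀ k, k ≠ 9 → k ≠ 10 → k ≠ 13 → s'.digs k = s.digs k)) ?_ ?_ L s
      ⟨0, by omega, w11, hstr, fun _ => by simpa using hZ, hY, fun _ _ _ _ => rfl,
        fun _ _ _ _ => rfl⟩
  · refine key.mono ?_ fun s' h' => ?_
    · have hcost : 1 + (ltE (var 11) (var 5)).size + blocksBody.cost ≤ 100 :=
        Nat.le_of_ble_eq_true rfl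
      have := Nat.mul_le_mul_left L hcost
      omega
    · obtain ⟨t, ht, h11, hst, hz, hy, hw, hd⟩ := h'
      obtain rfl : t = L := by omega
      exact ⟨by simpa [newBlocks] using hst, hz, hy, hw, hd⟩
  · rintro d s' ⟨t, ht, h11, hst, hz, hy, hw, hd⟩
    have v3 : s'.words 3 = M := by rw [hw 3 (by omega) (by omega) (by omega), w3]
    have v4 : s'.words 4 = N := by rw [hw 4 (by omega) (by omega) (by omega), w4]
    have v5 : s'.words 5 = L := by rw [hw 5 (by omega) (by omega) (by omega), w5]
    refine ⟨by simp [h11, v5]; omega, by simp [h11, v5]; omega, runsIn_of_pre (by omega)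
      (pre_of_forall fun Q hQ => ?_)⟩
    have hy := hy (by omega)
    have hT := hT t (by omega)
    rw [← hd (20 + t) (by omega) (by omega) (by omega)] at hT
    have h3 := shr_half M t
    simp only [blocksBody, pre_append, pre_ite]
    refine ⟨by simp [h11, v3]; omega, fun hb => ?_, fun hb => ?_⟩
    · have hb : (M >>> t) % 2 = 1 := by simp [h11, v3] at hb; omega
      rw [newBlocks, if_neg (c := Used M N L t) (fun hu => by have := hu.1; omega),
        List.nil_append] at hst
      simp [h11]
      repeat refine ⟨by omega, ?_⟩
      refine hQ _ ⟨t + 1, by omega, by simp, hst.congr (by simp) (by simp), fun h => ?_, fun _ => ?_,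
        ?_, ?_⟩
      · have hM : 2 ≤ M >>> t := by
          by_contra h0
          have := shr_succ M t
          rw [Nat.div_eq_of_lt (not_le.1 h0)] at this
          rw [this] at h
          exact absurd h (by norm_num)
        rw [blk_old_odd hb]
        simpa [show 20 + t ≠ 10 by omega] using hT hM
      · rw [hs.growing_odd (by omega) hb]
        have := Comp.node (hz (by omega)) hy (Or.inl (blk_ne_empty _ _))
        simpa using this
      · intro k k1 k2 k3
        simp [k3, hw k k1 k2 k3]
      · intro k k1 k2 k3
        simp [k1, k2, hd k k1 k2 k3]
    · have hb : (M >>> t) % 2 = 0 := by simpa [h11, v3] using hb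
      have hz' : 1 ≤ M >>> (t + 1) → Comp E.A C π (blk (t + 1) (M >>> (t + 1) - 1))
          (E.A.H (cat (s'.digs (20 + t)) (s'.digs 9))) := by
        intro h
        have hM : 2 ≤ M >>> t := by
          by_contra h0
          have := shr_succ M t
          rw [Nat.div_eq_of_lt (not_le.1 h0)] at this
          rw [this] at h
          exact absurd h (by norm_num)
        rw [blk_old_even hM hb]
        exact Comp.node (hT hM) (hz (by omega)) (Or.inl (mtn_ne_empty _ _))
      have hg := Split.growing_even (N := N) (show t < L by omega) hb
      rw [pre_hash]
      refine ⟨by simp; omega, by simp; omega, by simp [h11]; omega, by simp [h11]; omega,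
        by simp; omega, by simp; omega, ?_, fun hu => ?_, fun hu => ?_⟩
      · have hN : (N >>> (L - 1)) % 2 < 2 := Nat.mod_lt _ (by omega)
        simp [h11, v4, v5]
        repeat refine ⟨by omega, ?_⟩
        split <;> omega
      · have hu : Used M N L t := by
          refine ⟨hb, ?_⟩
          by_contra hn
          rw [not_or] at hn
          simp [h11, v4, v5, hn.1] at hu
          omega
        rw [newBlocks, if_pos hu, List.append_assoc] at hst
        refine fetchTo_pre (by omega) (by omega) (u := blk t (M >>> t + 1)) (p := 13)
          (rest := newBlocks M N L (t + 1) d ++ R) (hst.congr (by simp) (by simp))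
          (by simp; omega) (by simp) (by simp; omega) (by simp) (by omega) fun s1 hw1 hd1 hc1 hs1 => ?_
        have e1 : s1.digs 10 = s'.digs 10 := by rw [hd1 10 (by omega)]; simp
        have e2 : s1.digs 9 = E.A.H (cat (s'.digs (20 + t)) (s'.digs 9)) := by
          rw [hd1 9 (by omega)]; simp [h11]
        have e3 : s1.words 11 = t := by rw [hw1 11 (by omega) (by omega)]; simp [h11]
        simp [e3]
        repeat refine ⟨by omega, ?_⟩
        refine hQ _ ⟨t + 1, by omega, by simp, hs1.congr (by simp) (by simp), fun h => ?_, fun _ => ?_,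
          ?_, ?_⟩
        · simpa [e2] using hz' h
        · rw [hg, if_pos hu]
          have := Comp.node (e1 ▸ hy) hc1 (Or.inl (growing_ne_empty _ _ _ _))
          simpa using this
        · intro k k1 k2 k3
          simp [k3, hw1 k k1 k2, hw k k1 k2 k3]
        · intro k k1 k2 k3
          simp [k1, k2, hd1 k k3, hd k k1 k2 k3]
      · have hu : ¬ Used M N L t := by
          rintro ⟨-, h⟩
          simp [h11, v4, v5] at hu
          omega
        rw [newBlocks, if_neg hu, List.nil_append] at hst
        simp [h11]
        repeat refine ⟨by omega, ?_⟩
        refine hQ _ ⟨t + 1, by omega, by simp, hst.congr (by simp) (by simp), fun h => ?_, fun _ => ?_,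
          ?_, ?_⟩
        · simpa using hz' h
        · rw [hg, if_neg hu]
          simpa using hy
        · intro k k1 k2 k3
          simp [k3, hw k k1 k2 k3]
        · intro k k1 k2 k3
          simp [k1, k2, k3, hd k k1 k2 k3]
  · rintro s' ⟨t, ht, h11, hst, hz, hy, hw, hd⟩
    have v5 : s'.words 5 = L := by rw [hw 5 (by omega) (by omega) (by omega), w5]
    exact ⟨by simp [h11, v5]; omega, by simp [h11, v5]; omega⟩

/-! ### The computation of the level -/

/-- Compute the level of `M` and `N`, which are in the word cells `3` and `4`. -/
def levelLoop : Cmd :=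
  .loop (ltE (var 3 >>> var 5 + 1) (var 4 >>> var 5)) (assign 5 (var 5 + 1))

theorem level_lt_log {M N : ℕ} (h : M < N) (hM : 1 ≤ M) : level M N ≤ Nat.log 2 N := by
  rcases Nat.eq_zero_or_pos (level M N) with h0 | h0
  · omega
  · have := lt_log_of_two_le_shr ((Nat.le_add_left 2 _).trans ((split h).min h0))
    omega

theorem levelLoop_runs {M N : ℕ} (h : M < N) (hM : 1 ≤ M) (h1 : 100 * (N + 2) ≤ E.bound)
    (h2 : Nat.log 2 N + 40 ≤ E.space) {s : St ℓ} (w3 : s.words 3 = M) (w4 : s.words 4 = N)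
    (w5 : s.words 5 = 0) :
    RunsIn E levelLoop s (100 * level M N + 100) fun s' => s' = s.setWord 5 (level M N) := by
  have hlog : Nat.log 2 N ≤ N := Nat.log_le_self _ _
  have hle := level_lt_log h hM
  have key := RunsIn.loop (E := E) (by omega) (e := ltE (var 3 >>> var 5 + 1) (var 4 >>> var 5))
    (P := assign 5 (var 5 + 1)) (T := (assign 5 (var 5 + 1)).cost)
    (fun d s' => ∃ t, t + d = level M N ∧ s' = s.setWord 5 t) ?_ ?_ (level M N) s
    ⟨0, by omega, ?_⟩
  · refine key.mono ?_ fun s' h' => ?_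
    · have hcost : 1 + (ltE (var 3 >>> var 5 + 1) (var 4 >>> var 5)).size +
        (assign 5 (var 5 + 1)).cost ≤ 100 := Nat.le_of_ble_eq_true rfl
      have := Nat.mul_le_mul_left (level M N) hcost
      omega
    · obtain ⟨t, ht, rfl⟩ := h'
      rw [show t = level M N by omega]
  · rintro d s' ⟨t, ht, rfl⟩
    have h3 : M >>> t ≤ M := Nat.shiftRight_le _ _
    have h4 : ¬ N >>> t ≤ M >>> t + 1 := Nat.find_min (exists_level M N) (show t < level M N by omega)
    refine ⟨by simp [w3, w4]; omega, by simp [w3, w4]; omega, runsIn_of_pre (by omega) ?_⟩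
    rw [pre_assign]
    refine ⟨by omega, by omega, by simp; omega, t + 1, by omega, ?_⟩
    simp [St.setWord]
  · rintro s' ⟨t, ht, rfl⟩
    have h3 : M >>> t ≤ M := Nat.shiftRight_le _ _
    have h4 : N >>> level M N ≤ M >>> level M N + 1 := Nat.find_spec (exists_level M N)
    rw [show level M N = t by omega] at h4
    exact ⟨by simp [w3, w4]; omega, by simp [w3, w4]; omega⟩
  · rw [St.setWord, ← w5, Function.update_eq_self]

end

/-! ### The nodes above the level of the increment -/

section

variable {ℓ : ℕ} {E : Env ℓ}

/-- The mask of the range ends, for the number in the word cell `w`. -/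
def maskE (w : ℕ) : Expr :=
  (var w ^^^ (var w &&& ((var w <<< Expr.const 1) &&& (var w >>> Expr.const 1)))) %
    (Expr.const 1 <<< Expr.log2 (var w))

theorem maskE_spec {s : St ℓ} {w N : ℕ} (hN : 1 ≤ N) (h1 : 100 * (N + 2) ≤ E.bound)
    (hw : w < 20) (hs : 20 ≤ E.space) (h : s.words w = N) :
    (maskE w).Ok E s ∧ (maskE w).val s = endMask N := by
  have h3 := shiftLeft_log_le hN
  have h4 : N <<< 1 = 2 * N := by rw [Nat.shiftLeft_eq, pow_one]; omega
  have h5 := xor_and_le N (2 * N &&& N >>> 1)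
  constructor
  · simp [maskE, h, h4]
    repeat refine ⟨by omega, ?_⟩
    omega
  · simp [maskE, h, endMask, Nat.shiftLeft_eq 1]

/-- The levels and masks of the two lists. -/
def headCmd : Cmd :=
  assign 3 (var 1 + 1) ++ assign 4 (var 2 + 1) ++ assign 5 0 ++ assign 9 1 ++
  assign 7 (maskE 3) ++ assign 8 (maskE 4)

/-- The end of the carry. -/
def carryCmd : Cmd :=
  assign 6 (var 5 + Expr.log2 (var 4 >>> var 5 - (var 4 >>> var 5 &&& var 3 >>> var 5)))

/-- The contents of the word cells during the verification of an increment proof. -/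
structure IncWords (M N L P : ℕ) (s : St ℓ) : Prop where
  w3 : s.words 3 = M
  w4 : s.words 4 = N
  w5 : s.words 5 = L
  w6 : s.words 6 = P
  w7 : s.words 7 = endMask M
  w8 : s.words 8 = endMask N

theorem IncWords.congr {M N L P : ℕ} {s s' : St ℓ} (h : IncWords M N L P s)
    (hw : ∀ k, k ≠ 9 → k ≠ 10 → k ≠ 11 → s'.words k = s.words k) : IncWords M N L P s' := by
  obtain ⟨h3, h4, h5, h6, h7, h8⟩ := h
  constructor <;> rw [hw _ (by omega) (by omega) (by omega)] <;> assumption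

/-- Receive the belt and the chain of the new list above the carry. -/
def aboveCmd : Cmd :=
  .ite (var 8 >>> (var 6 + 1)) (fetchTo 4) (.null 4) ++
  .ite (ltE (var 4 >>> (var 6 + 1)) 2 + (var 8 >>> (var 6 + 1)) % 2) (.null 5) (fetchTo 5)

/-- The belt and the chain of the old list above the carry. -/
def aboveOldCmd : Cmd :=
  .ite ((var 3 >>> (var 6 + 1)) % 2 * ((var 3 >>> (var 6 + 2)) % 2))
    (.hash 2 4 5 ++ .null 3) (.copy 2 4 ++ .copy 3 5)

/-- Receive the two mountains that are merged, and extend the old bagging by them. -/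
def pairCmd : Cmd :=
  .ite (ltE 1 (var 3 >>> var 6))
    (aboveOldCmd ++ (fetchTo 6 ++ (bagCmd 2 3 6 (endsE 7 (var 6)) ++
      .ite (ltE (var 5) (var 6)) (fetchTo 7 ++ bagCmd 2 3 7 (endsE 7 (var 6 - 1))) (.copy 7 7))))
    (.null 2 ++ .null 3)

/-- Receive the chain of the shifted range, and extend the old bagging by it. -/
def shiftedCmd : Cmd :=
  .ite (ltE (var 5 + 1) (var 6))
    (fetchTo 8 ++ .ite (endsE 7 (var 5)) (.hash 2 2 8) (.copy 3 8)) (.null 8)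

variable {M N L P : ℕ} {C R : List MTree} {π : List (Digest ℓ)} {s : St ℓ}

theorem aboveCmd_pre (hc : Carry M N L P) (hN : 1 ≤ N) (h1 : 100 * (N + 2) ≤ E.bound)
    (h2 : Nat.log 2 N + 40 ≤ E.space) (hP : P ≤ Nat.log 2 N) (hw : IncWords M N L P s)
    (hstr : Stream C π (opt (bel N (P + 1)) ++ (opt (chn N (P + 1)) ++ R)) s) {Q : St ℓ → Prop}
    (hQ : ∀ s' : St ℓ, IncWords M N L P s' → (∀ k, k < 4 → s'.digs k = s.digs k) →
      Stream C π R s' → CompSt E.A C π N (P + 1) 4 5 s' → Q s') :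
    aboveCmd.Pre E Q s := by
  have hlog : Nat.log 2 N ≤ N := Nat.log_le_self _ _
  have hem := endMask_le N
  obtain ⟨b1, b2⟩ := bel_endMask (N := N) (Q := P + 1) hN (by omega)
  have hbe : (endMask N >>> (P + 1) = 0 ↔ bel N (P + 1) = .empty) := by
    refine ⟨b1, fun h => ?_⟩
    by_contra h0
    obtain ⟨j, -, h4, h5, h6⟩ := b2 h0
    rw [h6, bel_close (two_le_shr h5) h4] at h
    exact absurd h (by simp)
  have hce : chn N (P + 1) = .empty ↔
      (N >>> (P + 1) < 2 ∨ (endMask N >>> (P + 1)) % 2 = 1) := by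
    rw [endMask_bit (by omega)]
    constructor
    · intro h
      by_contra h0
      rw [not_or, not_lt] at h0
      rw [chn_open h0.1 fun h' => h0.2 ⟨lt_log_of_two_le_shr h0.1, h'⟩] at h
      exact absurd h (by simp)
    · rintro (h | h)
      · exact chn_top (by omega)
      · exact chn_close h.2
  -- the second half
  have key : ∀ s1 : St ℓ, IncWords M N L P s1 → (∀ k, k < 4 → s1.digs k = s.digs k) →
      Stream C π (opt (chn N (P + 1)) ++ R) s1 → Comp E.A C π (bel N (P + 1)) (s1.digs 4) →
      Cmd.Pre E (.ite (ltE (var 4 >>> (var 6 + 1)) 2 + (var 8 >>> (var 6 + 1)) % 2) (.null 5)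
        (fetchTo 5)) Q s1 := by
    intro s1 hw1 hd1 hs1 hc1
    obtain ⟨v3, v4, v5, v6, v7, v8⟩ := hw1
    rw [pre_ite]
    have hv : (ltE (var 4 >>> (var 6 + 1)) 2 + (var 8 >>> (var 6 + 1)) % 2 : Expr).val s1 = 0 ↔
        chn N (P + 1) ≠ .empty := by
      rw [Ne, hce]
      simp [v4, v6, v8]
    refine ⟨?_, fun hne => ?_, fun he => ?_⟩
    · have : (endMask N >>> (P + 1)) % 2 < 2 := Nat.mod_lt _ (by omega)
      simp [v4, v6, v8]
      repeat refine ⟨by omega, ?_⟩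
      split <;> omega
    · have he := not_not.1 (mt hv.2 hne)
      rw [he, opt_empty, List.nil_append] at hs1
      simp only [pre_null, ok_ofNat, val_ofNat]
      refine ⟨by omega, by omega, hQ _ ⟨v3, v4, v5, v6, v7, v8⟩ ?_ (hs1.congr rfl rfl) ⟨?_, ?_⟩⟩
      · intro k hk
        simp [show k ≠ 5 by omega, hd1 k hk]
      · simpa using hc1
      · rw [he]; simpa using Comp.empty
    · have he := hv.1 he
      rw [opt, if_neg he] at hs1
      refine fetchTo_pre (by omega) (by omega) (p := 5) hs1 (by simp; omega) (by simp)
        (by simp; omega) (by simp) (by omega) fun s2 hw2 hd2 hc2 hs2 => ?_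
      refine hQ _ (IncWords.congr ⟨v3, v4, v5, v6, v7, v8⟩ fun k k1 k2 _ => hw2 k k1 k2) ?_ hs2
        ⟨?_, hc2⟩
      · intro k hk
        rw [hd2 k (by omega), hd1 k hk]
      · rw [hd2 4 (by omega)]; exact hc1
  obtain ⟨v3, v4, v5, v6, v7, v8⟩ := hw
  rw [aboveCmd, pre_append, pre_ite]
  refine ⟨by simp [v6, v8]; omega, fun hne => ?_, fun he => ?_⟩
  · have hne : bel N (P + 1) ≠ .empty := fun h => hne (by simpa [v6, v8] using hbe.2 h)
    rw [opt, if_neg hne] at hstr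
    refine fetchTo_pre (by omega) (by omega) (p := 4) hstr (by simp; omega) (by simp)
      (by simp; omega) (by simp) (by omega) fun s2 hw2 hd2 hc2 hs2 => ?_
    exact key s2 (IncWords.congr ⟨v3, v4, v5, v6, v7, v8⟩ fun k k1 k2 _ => hw2 k k1 k2)
      (fun k hk => hd2 k (by omega)) hs2 hc2
  · have he : bel N (P + 1) = .empty := hbe.1 (by simpa [v6, v8] using he)
    rw [he, opt_empty, List.nil_append] at hstr
    simp only [pre_null, ok_ofNat, val_ofNat]
    refine ⟨by omega, by omega, key _ ⟨v3, v4, v5, v6, v7, v8⟩ ?_ (hstr.congr rfl rfl) ?_⟩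
    · intro k hk; simp [show k ≠ 4 by omega]
    · rw [he]; simpa using Comp.empty

theorem aboveOldCmd_pre (hc : Carry M N L P) (h1 : 100 * (N + 2) ≤ E.bound)
    (h2 : Nat.log 2 N + 40 ≤ E.space) (hMN : M ≤ N) (hP : P ≤ Nat.log 2 N) (hw : IncWords M N L P s)
    (hcs : CompSt E.A C π N (P + 1) 4 5 s) {Q : St ℓ → Prop}
    (hQ : ∀ s' : St ℓ, s'.words = s.words → s'.inbox = s.inbox →
      (∀ k, k ≠ 2 → k ≠ 3 → s'.digs k = s.digs k) → CompSt E.A C π M (P + 1) 2 3 s' → Q s') :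
    aboveOldCmd.Pre E Q s := by
  have hlog : Nat.log 2 N ≤ N := Nat.log_le_self _ _
  obtain ⟨v3, v4, v5, v6, v7, v8⟩ := hw
  have hm1 : (M >>> (P + 1)) % 2 < 2 := Nat.mod_lt _ (by omega)
  have hm2 : (M >>> (P + 2)) % 2 < 2 := Nat.mod_lt _ (by omega)
  have hmul : (M >>> (P + 1)) % 2 * ((M >>> (P + 2)) % 2) ≤ 1 * 1 := Nat.mul_le_mul (by omega) (by omega)
  obtain ⟨k1, k2⟩ := hc.st_old_succ
  simp only [aboveOldCmd, pre_ite]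
  refine ⟨?_, fun hne => ?_, fun he => ?_⟩
  · simp [v3, v6]
    repeat refine ⟨by omega, ?_⟩
    omega
  · have hb : (M >>> (P + 1)) % 2 = 1 ∧ (M >>> (P + 2)) % 2 = 1 := by
      simp [v3, v6] at hne; omega
    obtain ⟨i1, i2, i3⟩ := k1 hb
    simp
    repeat refine ⟨by omega, ?_⟩
    refine hQ _ (by simp) (by simp) (by simp +contextual) ⟨?_, ?_⟩
    · rw [i1]
      simpa using Comp.node hcs.1 hcs.2 (Or.inr (by rw [i3]; simp))
    · rw [i2]; simpa using Comp.empty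
  · have hb : ¬ ((M >>> (P + 1)) % 2 = 1 ∧ (M >>> (P + 2)) % 2 = 1) := by
      rintro ⟨q1, q2⟩
      simp [v3, v6, q1, q2] at he
    obtain ⟨i1, i2⟩ := k2 hb
    simp
    repeat refine ⟨by omega, ?_⟩
    refine hQ _ (by simp) (by simp) (by simp +contextual) ⟨?_, ?_⟩
    · rw [i1]; simpa using hcs.1
    · rw [i2]; simpa using hcs.2

/-- The values of the nodes above the level `L`, and the old bagging at this level. -/
structure FarVals (A : Hashing ℓ) (C : List MTree) (π : List (Digest ℓ)) (M N L P : ℕ) (s : St ℓ) :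
    Prop where
  above : CompSt A C π N (P + 1) 4 5 s
  left : 2 ≤ M >>> P → Comp A C π (mtn M P) (s.digs 6)
  right : 2 ≤ M >>> P → L < P → Comp A C π (mtn M (P - 1)) (s.digs 7)
  shifted : L < P → Comp A C π (chn N (L + 1)) (s.digs 8)

theorem Carry.level_le_log (hc : Carry M N L P) : P ≤ Nat.log 2 N := by
  have h := hc.shr_new
  rw [Nat.shiftRight_eq_div_pow] at h
  refine Nat.le_log_of_pow_le (by norm_num) ?_
  by_contra hlt
  rw [Nat.div_eq_of_lt (not_le.1 hlt)] at h
  omega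

theorem pairCmd_pre (hc : Carry M N L P) (h1 : 100 * (N + 2) ≤ E.bound)
    (h2 : Nat.log 2 N + 40 ≤ E.space) (hMN : M ≤ N) (hw : IncWords M N L P s)
    (hstr : Stream C π ((if 2 ≤ M >>> P then [mtn M P] ++ (if L < P then [mtn M (P - 1)] else [])
      else []) ++ R) s)
    (hcs : CompSt E.A C π N (P + 1) 4 5 s) {Q : St ℓ → Prop}
    (hQ : ∀ s' : St ℓ, IncWords M N L P s' → (∀ k, k < 2 → s'.digs k = s.digs k) →
      Stream C π R s' → CompSt E.A C π N (P + 1) 4 5 s' →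
      (2 ≤ M >>> P → Comp E.A C π (mtn M P) (s'.digs 6)) →
      (2 ≤ M >>> P → L < P → Comp E.A C π (mtn M (P - 1)) (s'.digs 7)) →
      CompSt E.A C π M (if L < P then P - 1 else P) 2 3 s' → Q s') :
    pairCmd.Pre E Q s := by
  have hlog : Nat.log 2 N ≤ N := Nat.log_le_self _ _
  have hP := hc.level_le_log
  have hem := endMask_le M
  have hLP := hc.le
  have hshr : M >>> P ≤ M := Nat.shiftRight_le _ _
  rw [pairCmd, pre_ite]
  refine ⟨by simp [hw.w3, hw.w6]; omega, fun hne => ?_, fun he => ?_⟩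
  · have hG : 2 ≤ M >>> P := by
      by_contra h0; simp [hw.w3, hw.w6, show ¬ 1 < M >>> P by omega] at hne
    rw [if_pos hG, List.append_assoc] at hstr
    rw [pre_append]
    refine aboveOldCmd_pre hc h1 h2 hMN hP hw hcs fun s1 hw1 hi1 hd1 hc1 => ?_
    have hw1' : IncWords M N L P s1 := hw.congr fun k _ _ _ => by rw [hw1]
    rw [pre_append]
    refine fetchTo_pre (by omega) (by omega) (p := 6) (hstr.congr hi1 (by rw [hw1])) (by simp; omega)
      (by simp) (by simp; omega) (by simp) (by omega) fun s2 hw2 hd2 hc2 hs2 => ?_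
    have hw2' : IncWords M N L P s2 := hw1'.congr fun k k1 k2 _ => hw2 k k1 k2
    rw [pre_append]
    refine bagCmd_pre (N := M) (q := P) (p := 6) (by omega) (by omega) (by omega) (by omega) (by omega)
      (by simp; omega) (by simp) (by omega) ?_ ?_ hG ⟨?_, ?_⟩ hc2 fun s3 hw3 hi3 hd3 hc3 => ?_
    · intro d
      exact ok_endsE (by omega) (by omega) (by omega) (by rw [words_setDig, hw2'.w7]; omega)
        (by simp [hw2'.w6]; omega)
    · intro d
      exact val_endsE hw2'.w7 hw2'.w6 hG
    · rw [hd2 _ (by omega)]; exact hc1.1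
    · rw [hd2 _ (by omega)]; exact hc1.2
    have hw3' : IncWords M N L P s3 := hw2'.congr fun k _ _ _ => by rw [hw3]
    have ha3 : CompSt E.A C π N (P + 1) 4 5 s3 := by
      rw [CompSt, hd3 4 (by omega) (by omega), hd3 5 (by omega) (by omega), hd2 4 (by omega),
        hd2 5 (by omega), hd1 4 (by omega) (by omega), hd1 5 (by omega) (by omega)]
      exact hcs
    have h6 : Comp E.A C π (mtn M P) (s3.digs 6) := by rw [hd3 6 (by omega) (by omega)]; exact hc2
    have h01 : ∀ k, k < 2 → s3.digs k = s.digs k := fun k hk => by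
      rw [hd3 k (by omega) (by omega), hd2 k (by omega), hd1 k (by omega) (by omega)]
    have hs3 := hs2.congr hi3 (by rw [hw3])
    rw [pre_ite]
    refine ⟨by simp [hw3'.w5, hw3'.w6]; omega, fun hne => ?_, fun he => ?_⟩
    · have hL : L < P := by
        by_contra h0; simp [hw3'.w5, hw3'.w6, h0] at hne
      rw [if_pos hL] at hs3 hQ
      have hq : 2 ≤ M >>> (P - 1) := by
        have h5 := shr_half M (P - 1)
        rw [show P - 1 + 1 = P by omega] at h5
        omega
      rw [pre_append]
      refine fetchTo_pre (by omega) (by omega) (p := 7) hs3 (by simp; omega)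
        (by simp) (by simp; omega) (by simp) (by omega) fun s4 hw4 hd4 hc4 hs4 => ?_
      have hw4' : IncWords M N L P s4 := hw3'.congr fun k k1 k2 _ => hw4 k k1 k2
      refine bagCmd_pre (N := M) (q := P - 1) (p := 7) (by omega) (by omega) (by omega) (by omega)
        (by omega) (by simp; omega) (by simp) (by omega) ?_ ?_ hq ⟨?_, ?_⟩ hc4
        fun s5 hw5 hi5 hd5 hc5 => ?_
      · intro d
        exact ok_endsE (by omega) (by omega) (by omega) (by rw [words_setDig, hw4'.w7]; omega)
          (by simp [hw4'.w6]; omega)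
      · intro d
        exact val_endsE hw4'.w7 (by simp [hw4'.w6]) hq
      · rw [hd4 _ (by omega), show P - 1 + 1 = P by omega]; exact hc3.1
      · rw [hd4 _ (by omega), show P - 1 + 1 = P by omega]; exact hc3.2
      refine hQ s5 (hw4'.congr fun k _ _ _ => by rw [hw5]) (fun k hk => ?_)
        (hs4.congr hi5 (by rw [hw5])) ?_ (fun _ => ?_) (fun _ _ => ?_) hc5
      · rw [hd5 k (by omega) (by omega), hd4 k (by omega), h01 k hk]
      · rw [CompSt, hd5 4 (by omega) (by omega), hd5 5 (by omega) (by omega), hd4 4 (by omega),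
          hd4 5 (by omega)]
        exact ha3
      · rw [hd5 6 (by omega) (by omega), hd4 6 (by omega)]; exact h6
      · rw [hd5 7 (by omega) (by omega)]; exact hc4
    · have hL : ¬ L < P := by
        intro h0; simp [hw3'.w5, hw3'.w6, h0] at he
      rw [if_neg hL] at hs3 hQ
      simp only [pre_copy, ok_ofNat, val_ofNat]
      refine ⟨by omega, by omega, by omega, by omega, hQ _ ⟨hw3'.w3, hw3'.w4, hw3'.w5, hw3'.w6,
        hw3'.w7, hw3'.w8⟩ (fun k hk => ?_) (hs3.congr rfl rfl) ?_ (fun _ => ?_)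
        (fun _ h => absurd h hL) ?_⟩
      · simp [show k ≠ 7 by omega, h01 k hk]
      · simpa [CompSt] using ha3
      · simpa using h6
      · simpa [CompSt] using hc3
  · have hG : ¬ 2 ≤ M >>> P := by
      intro h0; simp [hw.w3, hw.w6, show 1 < M >>> P by omega] at he
    rw [if_neg hG, List.nil_append] at hstr
    have e2 : M >>> (if L < P then P - 1 else P) ≤ 1 := by
      have h0 := hc.shr_old
      split
      · have h2 := shr_succ M (P - 1)
        rw [show P - 1 + 1 = P by omega] at h2
        omega
      · omega
    simp only [pre_append, pre_null, ok_ofNat, val_ofNat]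
    refine ⟨by omega, by omega, by omega, by omega, hQ _ ⟨hw.w3, hw.w4, hw.w5, hw.w6,
      hw.w7, hw.w8⟩ (fun k hk => ?_) (hstr.congr rfl rfl) ?_ (fun h => absurd h hG)
      (fun h _ => absurd h hG) ?_⟩
    · simp [show k ≠ 2 by omega, show k ≠ 3 by omega]
    · simpa [CompSt] using hcs
    · rw [CompSt, bel_top e2, chn_top e2]
      simpa using Comp.empty (A := E.A) (C := C) (π := π)

theorem shiftedCmd_pre (hc : Carry M N L P) (h1 : 100 * (N + 2) ≤ E.bound)
    (h2 : Nat.log 2 N + 40 ≤ E.space) (hMN : M ≤ N) (hw : IncWords M N L P s)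
    (hstr : Stream C π ((if L + 2 ≤ P then [chn N (L + 1)] else []) ++ R) s)
    (hcs : CompSt E.A C π M (if L < P then P - 1 else P) 2 3 s) {Q : St ℓ → Prop}
    (hQ : ∀ s' : St ℓ, IncWords M N L P s' →
      (∀ k, k ≠ 2 → k ≠ 3 → k ≠ 8 → s'.digs k = s.digs k) →
      Stream C π R s' → (L < P → Comp E.A C π (chn N (L + 1)) (s'.digs 8)) →
      CompSt E.A C π M L 2 3 s' → Q s') :
    shiftedCmd.Pre E Q s := by
  have hlog : Nat.log 2 N ≤ N := Nat.log_le_self _ _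
  have hP := hc.level_le_log
  have hem := endMask_le M
  have hLP := hc.le
  rw [shiftedCmd, pre_ite]
  refine ⟨by simp [hw.w5, hw.w6]; omega, fun hne => ?_, fun he => ?_⟩
  · have hL : L + 2 ≤ P := by
      by_contra h0; simp [hw.w5, hw.w6, show ¬ L + 1 < P by omega] at hne
    rw [if_pos hL] at hstr
    rw [if_pos (by omega)] at hcs
    obtain ⟨i1, i2, i3⟩ := hc.chn_new_low hL
    have hq : 2 ≤ M >>> L := by have := (hc.four_le le_rfl hL).2; omega
    obtain ⟨e1, e2⟩ := st_eq hq
    rw [pre_append]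
    refine fetchTo_pre (by omega) (by omega) (p := 8) hstr (by simp; omega)
      (by simp) (by simp; omega) (by simp) (by omega) fun s1 hw1 hd1 hc1 hs1 => ?_
    have hw1' : IncWords M N L P s1 := hw.congr fun k k1 k2 _ => hw1 k k1 k2
    have hc2 := hcs.1
    have hc3 := hcs.2
    rw [chn_close (hc.closes_old (by omega))] at hc3
    rw [← i3, ← hd1 2 (by omega)] at hc2
    rw [← hd1 3 (by omega)] at hc3
    have hval := val_endsE (e := var 5) (s := s1) hw1'.w7 hw1'.w5 hq
    rw [pre_ite]
    refine ⟨ok_endsE (by omega) (by omega) (by omega) (by rw [hw1'.w7]; omega)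
      (by simp [hw1'.w5]; omega), fun hne => ?_, fun he => ?_⟩
    · have hcl := hval.1 hne
      simp only [pre_hash, ok_ofNat, val_ofNat]
      refine ⟨by omega, by omega, by omega, by omega, by omega, by omega, hQ _ ⟨hw1'.w3, hw1'.w4,
        hw1'.w5, hw1'.w6, hw1'.w7, hw1'.w8⟩ (fun k k1 k2 k3 => ?_) (hs1.congr rfl rfl)
        (fun _ => ?_) ?_⟩
      · simp [k1, hd1 k k3]
      · simpa using hc1
      · rw [CompSt, e1, e2, if_pos hcl, if_pos hcl, ← i1]
        have := Comp.node hc2 hc1 (Or.inr (by rw [i1]; simp))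
        simpa using And.intro this hc3
    · have hcl := fun h => hval.2 h he
      simp only [pre_copy, ok_ofNat, val_ofNat]
      refine ⟨by omega, by omega, by omega, by omega, hQ _ ⟨hw1'.w3, hw1'.w4,
        hw1'.w5, hw1'.w6, hw1'.w7, hw1'.w8⟩ (fun k k1 k2 k3 => ?_) (hs1.congr rfl rfl)
        (fun _ => ?_) ?_⟩
      · simp [k2, hd1 k k3]
      · simpa using hc1
      · rw [CompSt, e1, e2, if_neg hcl, if_neg hcl, ← i1]
        simpa using And.intro hc2 hc1
  · have hL : ¬ L + 2 ≤ P := by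
      intro h0; simp [hw.w5, hw.w6, show L + 1 < P by omega] at he
    rw [if_neg hL, List.nil_append] at hstr
    have : (if L < P then P - 1 else P) = L := by split <;> omega
    rw [this] at hcs
    simp only [pre_null, ok_ofNat, val_ofNat]
    refine ⟨by omega, by omega, hQ _ ⟨hw.w3, hw.w4, hw.w5, hw.w6,
      hw.w7, hw.w8⟩ (fun k k1 k2 k3 => ?_) (hstr.congr rfl rfl) (fun h => ?_) ?_⟩
    · simp [k3]
    · obtain rfl : P = L + 1 := by omega
      rw [chn_close (hc.closes_new h)]
      simpa using Comp.empty
    · simpa [CompSt] using hcs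

/-- Receive the nodes above the level `L`, and compute the old bagging at this level. -/
def farCmd : Cmd := aboveCmd ++ (pairCmd ++ shiftedCmd)

theorem farCmd_pre (hc : Carry M N L P) (hN : 1 ≤ N) (h1 : 100 * (N + 2) ≤ E.bound)
    (h2 : Nat.log 2 N + 40 ≤ E.space) (hMN : M ≤ N) (hw : IncWords M N L P s)
    (hstr : Stream C π (farNodes M N L P ++ R) s) {Q : St ℓ → Prop}
    (hQ : ∀ s' : St ℓ, IncWords M N L P s' → (∀ k, k < 2 → s'.digs k = s.digs k) →
      Stream C π R s' → FarVals E.A C π M N L P s' → CompSt E.A C π M L 2 3 s' → Q s') :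
    farCmd.Pre E Q s := by
  rw [farNodes] at hstr
  simp only [List.append_assoc] at hstr
  rw [farCmd, pre_append]
  refine aboveCmd_pre hc hN h1 h2 hc.level_le_log hw hstr fun s1 hw1 hd1 hs1 hc1 => ?_
  rw [pre_append]
  refine pairCmd_pre hc h1 h2 hMN hw1 (by simpa only [List.append_assoc] using hs1) hc1
    fun s2 hw2 hd2 hs2 hc2 h6 h7 hcs2 => ?_
  refine shiftedCmd_pre hc h1 h2 hMN hw2 hs2 hcs2 fun s3 hw3 hd3 hs3 h8 hcs3 => ?_
  refine hQ s3 hw3 (fun k hk => ?_) hs3 ⟨?_, fun h => ?_, fun h h' => ?_, h8⟩ hcs3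
  · rw [hd3 k (by omega) (by omega) (by omega), hd2 k hk, hd1 k (by omega)]
  · rw [CompSt, hd3 4 (by omega) (by omega) (by omega), hd3 5 (by omega) (by omega) (by omega)]
    exact hc2
  · rw [hd3 6 (by omega) (by omega) (by omega)]; exact h6 h
  · rw [hd3 7 (by omega) (by omega) (by omega)]; exact h7 h h'

/-- The new bagging at the level `L`, where the block with the first new item is in the cell `9`. -/
def nearCmd : Cmd :=
  .ite (var 3 >>> var 5)
    (.ite (ltE (var 5) (var 6))
      (.ite (ltE 1 (var 3 >>> var 6)) (.hash 13 6 7 ++ (.hash 13 5 13 ++ .hash 11 4 13)) (.null 11) ++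
        (.copy 12 8 ++ bagCmd 11 12 9 (endsE 8 (var 5))))
      (.hash 13 6 9 ++ (.copy 11 4 ++ (.copy 12 5 ++ bagCmd 11 12 13 (endsE 8 (var 5))))))
    (.null 11 ++ .null 12)

theorem nearCmd_pre (hc : Carry M N L P) (h1 : 100 * (N + 2) ≤ E.bound)
    (h2 : Nat.log 2 N + 40 ≤ E.space) (hMN : M ≤ N) (hw : IncWords M N L P s)
    (hf : FarVals E.A C π M N L P s)
    (hZ : 1 ≤ M >>> L → Comp E.A C π (blk L (M >>> L - 1)) (s.digs 9)) {Q : St ℓ → Prop}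
    (hQ : ∀ s' : St ℓ, s'.words = s.words → s'.inbox = s.inbox →
      (∀ k, k ≠ 11 → k ≠ 12 → k ≠ 13 → s'.digs k = s.digs k) →
      CompSt E.A C π N L 11 12 s' → Q s') :
    nearCmd.Pre E Q s := by
  have hlog : Nat.log 2 N ≤ N := Nat.log_le_self _ _
  have hP := hc.level_le_log
  have hem := endMask_le N
  have hLP := hc.le
  have hG0 := hc.shr_old
  have hsN := hc.succ L le_rfl hLP
  have hMP : M >>> P ≤ M := Nat.shiftRight_le _ _
  have hML : M >>> L ≤ M := Nat.shiftRight_le _ _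
  have hends : ∀ s' : St ℓ, s'.words = s.words → ∀ d c,
      Expr.Ok E (s'.setDig c d) (endsE 8 (var 5)) ∧ (1 ≤ M >>> L →
        ((endsE 8 (var 5)).val (s'.setDig c d) ≠ 0 ↔ Closes N L)) := by
    intro s' hs' d c
    refine ⟨ok_endsE (by omega) (by omega) (by omega) (by rw [words_setDig, hs', hw.w8]; omega)
      (by simp [hs', hw.w5]; omega), fun hg => ?_⟩
    exact val_endsE (by rw [words_setDig, hs', hw.w8]) (by simp [hs', hw.w5]) (by omega)
  obtain ⟨⟨fB, fC⟩, fT, fT1, fW⟩ := hf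
  rw [nearCmd, pre_ite]
  refine ⟨by simp [hw.w3, hw.w5]; omega, fun hne => ?_, fun he => ?_⟩
  · have hg : 1 ≤ M >>> L := by
      simp [hw.w3, hw.w5] at hne
      exact Nat.one_le_iff_ne_zero.2 hne
    have hZ := hZ hg
    rw [pre_ite]
    refine ⟨by simp [hw.w5, hw.w6]; omega, fun hne => ?_, fun he => ?_⟩
    · have hL : L < P := by
        by_contra h0; simp [hw.w5, hw.w6, h0] at hne
      have key : ∀ s1 : St ℓ, s1.words = s.words → s1.inbox = s.inbox →
          (∀ k, k ≠ 11 → k ≠ 13 → s1.digs k = s.digs k) →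
          Comp E.A C π (bel N (L + 1)) (s1.digs 11) →
          Cmd.Pre E (.copy 12 8 ++ bagCmd 11 12 9 (endsE 8 (var 5))) Q s1 := by
        intro s1 hw1 hi1 hd1 hb1
        simp only [pre_append, pre_copy, ok_ofNat, val_ofNat]
        refine ⟨by omega, by omega, by omega, by omega, ?_⟩
        refine bagCmd_pre (C := C) (π := π) (N := N) (q := L) (p := 9) (by omega) (by omega) (by omega) (by omega)
          (by omega) (by simp; omega) (by simp) (by omega) (fun d => (hends _ (by simpa using hw1) _ _).1)
          (fun d => (hends _ (by simpa using hw1) _ _).2 hg) (by omega) ⟨?_, ?_⟩ ?_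
          fun s2 hw2 hi2 hd2 hc2 => ?_
        · simpa using hb1
        · simpa [hd1 8 (by omega) (by omega)] using fW hL
        · rw [hc.mtn_low hL]; simpa [hd1 9 (by omega) (by omega)] using hZ
        · refine hQ s2 (by rw [hw2]; exact hw1) (by rw [hi2]; exact hi1) (fun k k1 k2 k3 => ?_) hc2
          rw [hd2 k k1 k2, digs_setDig, if_neg k2, hd1 k k1 k3]
      have hbl : bel N (L + 1) = bel N P := by
        by_cases h : L + 2 ≤ P
        · exact (hc.chn_new_low h).2.1
        · rw [show L + 1 = P by omega]
      rw [pre_append, pre_ite]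
      refine ⟨by simp [hw.w3, hw.w6]; omega, fun hne => ?_, fun he => ?_⟩
      · have hG : 2 ≤ M >>> P := by
          by_contra h0; simp [hw.w3, hw.w6, show ¬ 1 < M >>> P by omega] at hne
        simp only [pre_append, pre_hash, ok_ofNat, val_ofNat]
        repeat refine ⟨by omega, ?_⟩
        refine key _ (by simp) (by simp) (by simp +contextual) ?_
        rw [hbl, hc.bel_new hL (by omega), hc.mtn_new (by omega), ← hc.mtn_old, ← hc.mtn_old_pred hL]
        have c1 := Comp.node (fT hG) (fT1 hG hL) (Or.inl (mtn_ne_empty _ _))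
        have c2 := Comp.node fC c1 (Or.inr (by simp))
        have c3 := Comp.node fB c2 (Or.inr (by simp))
        simpa using c3
      · have hG : ¬ 2 ≤ M >>> P := by
          intro h0; simp [hw.w3, hw.w6, show 1 < M >>> P by omega] at he
        simp only [pre_null, ok_ofNat, val_ofNat]
        refine ⟨by omega, by omega, key _ (by simp) (by simp) (by simp +contextual) ?_⟩
        rw [hbl, bel_top (by rw [hc.shr_new]; omega)]
        simpa using Comp.empty (A := E.A) (C := C) (π := π)
    · have hL : L = P := by
        by_contra h0; simp [hw.w5, hw.w6, show L < P by omega] at he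
      subst hL
      simp only [pre_append, pre_hash, pre_copy, ok_ofNat, val_ofNat]
      repeat refine ⟨by omega, ?_⟩
      have hm : mtn N L = node (mtn M L) (blk L (M >>> L - 1)) := by
        rw [hc.mtn_new (by omega), ← hc.mtn_old, hG0]
      refine bagCmd_pre (C := C) (π := π) (N := N) (q := L) (p := 13) (by omega) (by omega) (by omega)
        (by omega) (by omega) (by simp; omega) (by simp) (by omega) (fun d => (hends _ (by simp) _ _).1)
        (fun d => (hends _ (by simp) _ _).2 hg) (by omega) ⟨?_, ?_⟩ ?_
        fun s2 hw2 hi2 hd2 hc2 => ?_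
      · simpa using fB
      · simpa using fC
      · rw [hm]
        simpa using Comp.node (fT (by omega)) hZ (Or.inl (mtn_ne_empty _ _))
      · refine hQ s2 (by rw [hw2]; rfl) (by rw [hi2]; rfl) (fun k k1 k2 k3 => ?_) hc2
        rw [hd2 k k1 k2]
        simp [k1, k2, k3]
  · have hg : M >>> L = 0 := by simpa [hw.w3, hw.w5] using he
    simp only [pre_append, pre_null, ok_ofNat, val_ofNat]
    refine ⟨by omega, by omega, by omega, by omega, hQ _ (by simp) (by simp) (by simp +contextual) ?_⟩
    rw [CompSt, bel_top (by omega), chn_top (by omega)]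
    simpa using Comp.empty (A := E.A) (C := C) (π := π)

end

/-! ### The program that verifies increment proofs -/

section

variable {ℓ : ℕ} {E : Env ℓ}

/-- Compare the two values that have been computed with the commitments, and check the length of the
message. -/
def compareCmd : Cmd :=
  .recv 13 10 ++ assign 0 (var 9 * eqE (var 10) 0 * .sameHash 2 0 * .sameHash 11 1)

theorem compareCmd_pre (h1 : 20 < E.bound) (h2 : 20 < E.space) {C : List MTree}
    {π : List (Digest ℓ)} {s : St ℓ} (hstr : Stream C π [] s) :
    compareCmd.Pre E (fun s' => s'.words 0 = 1 ↔
      π.length = C.length ∧ s.digs 2 = s.digs 0 ∧ s.digs 11 = s.digs 1) s := by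
  obtain ⟨pre, h3, h4, h5⟩ := hstr
  rw [List.append_nil] at h3
  subst h3
  simp only [compareCmd, pre_append, pre_recv, pre_assign, ok_ofNat, val_ofNat]
  repeat refine ⟨by omega, ?_⟩
  have hlt : 1 < E.bound := by omega
  have hlt0 : 0 < E.bound := by omega
  have l0 : 0 < E.space := by omega
  have l1 : 1 < E.space := by omega
  have l2 : 2 < E.space := by omega
  have l9 : 9 < E.space := by omega
  have l10 : 10 < E.space := by omega
  have l11 : 11 < E.space := by omega
  have b2 : 2 < E.bound := by omega
  have b9 : 9 < E.bound := by omega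
  have b10 : 10 < E.bound := by omega
  have b11 : 11 < E.bound := by omega
  rcases Nat.lt_or_ge C.length π.length with hl | hl
  · rw [List.drop_eq_getElem_cons hl] at h4
    rw [St.receive, h4]
    rw [if_pos hl.le] at h5
    simp [*]
    omega
  · rw [List.drop_eq_nil_of_le hl] at h4
    rw [St.receive, h4]
    by_cases hlen : C.length ≤ π.length
    · rw [if_pos hlen] at h5
      have : π.length = C.length := by omega
      by_cases e1 : s.digs 2 = s.digs 0 <;> by_cases e2 : s.digs 11 = s.digs 1 <;> simp [*]
    · rw [if_neg hlen] at h5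
      have : π.length ≠ C.length := by omega
      by_cases e1 : s.digs 2 = s.digs 0 <;> by_cases e2 : s.digs 11 = s.digs 1 <;> simp [*]

/-- Compute the old commitment from the message. -/
def oldCmd : Cmd := (carryCmd ++ (farCmd ++ assign 11 (var 5))) ++ peaksLoop 3 7 2 3

/-- Compute the blocks that contain the items next to the first new one. -/
def middleCmd : Cmd :=
  (fetchTo 9 ++ (.ite (var 5) (fetchTo 10) (.copy 13 13) ++ assign 11 0)) ++ blocksLoop

/-- Compute the new commitment from the message. -/
def newCmd : Cmd :=
  (nearCmd ++ (.ite (var 5) (bagCmd 11 12 10 (endsE 8 (var 5 - 1))) (.copy 13 13) ++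
    assign 11 (var 5 - 1))) ++ peaksLoop 4 8 11 12

/-- The program for the verification of increment proofs. -/
def verifyIncCmd : Cmd := (headCmd ++ levelLoop) ++ (oldCmd ++ (middleCmd ++ (newCmd ++ compareCmd)))

variable {M N L P : ℕ} {C R : List MTree} {π : List (Digest ℓ)} {s : St ℓ}

theorem oldCmd_runs (hM : 1 ≤ M) (hMN : M < N) (h1 : 100 * (N + 2) ≤ E.bound)
    (h2 : Nat.log 2 N + 40 ≤ E.space) (w3 : s.words 3 = M) (w4 : s.words 4 = N)
    (w5 : s.words 5 = level M N) (w7 : s.words 7 = endMask M) (w8 : s.words 8 = endMask N)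
    (hstr : Stream C π (farNodes M N (level M N) (carryEnd M N) ++
      (peaks M (level M N) ++ R)) s) :
    RunsIn E oldCmd s (1000 + 100 * level M N) fun s' =>
      IncWords M N (level M N) (carryEnd M N) s' ∧ (∀ k, k < 2 → s'.digs k = s.digs k) ∧
      Stream C π R s' ∧ FarVals E.A C π M N (level M N) (carryEnd M N) s' ∧
      Comp E.A C π (bel M 0) (s'.digs 2) ∧
      ∀ t, t < level M N → 2 ≤ M >>> t → Comp E.A C π (mtn M t) (s'.digs (20 + t)) := by
  have hs := split hMN
  have hL := level_lt_log hMN hM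
  have hlog : Nat.log 2 N ≤ N := Nat.log_le_self _ _
  have hP := hs.carry.level_le_log
  refine (RunsIn.seq (T := 800) (U := 100 * level M N + 100)
    (Q := fun s' => IncWords M N (level M N) (carryEnd M N) s' ∧
      (∀ k, k < 2 → s'.digs k = s.digs k) ∧
      Stream C π (peaks M (level M N) ++ R) s' ∧
      FarVals E.A C π M N (level M N) (carryEnd M N) s' ∧
      CompSt E.A C π M (level M N) 2 3 s' ∧ s'.words 11 = level M N) ?_
    fun s' h => ?_).mono (by omega) fun s' h => h
  · refine (runsIn_of_pre (by omega) (pre_of_forall fun Q hQ => ?_)).mono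
      (Nat.le_of_ble_eq_true rfl) fun s' h => h
    rw [pre_append, carryCmd, pre_assign]
    have hce : carryEnd M N = level M N + Nat.log 2 (N >>> level M N - (N >>> level M N &&& M >>> level M N)) := rfl
    refine ⟨by omega, by omega, ?_, ?_⟩
    · simp [w3, w4, w5, ← hce]
      omega
    · rw [pre_append]
      refine farCmd_pre (s := s.setWord 6 _) (C := C) (π := π) hs.carry (by omega) h1 h2 hMN.le ⟨?_, ?_, ?_, ?_, ?_, ?_⟩
        (hstr.congr rfl rfl) fun s' hw hd hst hf hcs => ?_
      · simpa using w3
      · simpa using w4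
      · simpa using w5
      · simp [w3, w4, w5, hce]
      · simpa using w7
      · simpa using w8
      · rw [pre_assign]
        refine ⟨by omega, by omega, by simp [hw.w5]; omega, hQ _ ⟨hw.congr fun k _ _ h => by simp [h], hd,
          hst.congr rfl rfl, ⟨hf.1, hf.2, hf.3, hf.4⟩, hcs, by simp [hw.w5]⟩⟩
  · obtain ⟨hw, hd, hst, hf, hcs, h11⟩ := h
    refine (peaksLoop_runs h1 h2 (by omega) (by omega) (by omega) (by omega) (by omega) hMN.le h11
      hw.w3 hw.w7 hL hst hcs).mono le_rfl ?_
    rintro s'' ⟨i1, i2, i3, i4, i5⟩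
    refine ⟨hw.congr i4, fun k hk => by rw [i5 k (by omega) (by omega) (by omega), hd k hk], i1, ?_,
      i2.1, i3⟩
    obtain ⟨⟨f1, f2⟩, f3, f4, f5⟩ := hf
    constructor
    · rw [CompSt, i5 4 (by omega) (by omega) (by omega), i5 5 (by omega) (by omega) (by omega)]
      exact ⟨f1, f2⟩
    · rw [i5 6 (by omega) (by omega) (by omega)]; exact f3
    · rw [i5 7 (by omega) (by omega) (by omega)]; exact f4
    · rw [i5 8 (by omega) (by omega) (by omega)]; exact f5

theorem middleCmd_runs (hs : Split M N L P) (hM : 1 ≤ M) (h1 : 100 * (N + 2) ≤ E.bound)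
    (h2 : Nat.log 2 N + 40 ≤ E.space) (hMN : M ≤ N) (hL : L ≤ Nat.log 2 N)
    (hw : IncWords M N L P s)
    (hstr : Stream C π (leaf M :: ((if 1 ≤ L then leaf (M + 1) :: newBlocks M N L 0 L else []) ++ R)) s)
    (hT : ∀ t, t < L → 2 ≤ M >>> t → Comp E.A C π (mtn M t) (s.digs (20 + t))) :
    RunsIn E middleCmd s (500 + 100 * L) fun s' =>
      IncWords M N L P s' ∧ (∀ k, k ≠ 9 → k ≠ 10 → k ≠ 13 → s'.digs k = s.digs k) ∧
      Stream C π R s' ∧ (1 ≤ M >>> L → Comp E.A C π (blk L (M >>> L - 1)) (s'.digs 9)) ∧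
      (1 ≤ L → Comp E.A C π (mtn N (L - 1)) (s'.digs 10)) := by
  have hlog : Nat.log 2 N ≤ N := Nat.log_le_self _ _
  have hb0 : blk 0 (M - 1) = leaf M := by rw [blk, Nat.sub_add_cancel hM]
  have hg0 : 1 ≤ L → growing M N L 0 = leaf (M + 1) := fun h => by
    rw [growing, if_pos (Or.inl (by omega))]; simp [blk]
  refine (RunsIn.seq (T := 200) (U := 100 * L + 100)
    (Q := fun s' => IncWords M N L P s' ∧ s'.words 11 = 0 ∧
      (∀ k, k ≠ 9 → k ≠ 10 → k ≠ 13 → s'.digs k = s.digs k) ∧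
      Stream C π (newBlocks M N L 0 L ++ R) s' ∧ Comp E.A C π (leaf M) (s'.digs 9) ∧
      (1 ≤ L → Comp E.A C π (leaf (M + 1)) (s'.digs 10))) ?_
    fun s' h => ?_).mono (by omega) fun s' h => h
  · refine (runsIn_of_pre (by omega) (pre_of_forall fun Q hQ => ?_)).mono
      (Nat.le_of_ble_eq_true rfl) fun s' h => h
    rw [pre_append]
    refine fetchTo_pre (by omega) (by omega) (p := 9) hstr (by simp; omega)
      (by simp) (by simp; omega) (by simp) (by omega) fun s1 hw1 hd1 hc1 hs1 => ?_
    have hw1' : IncWords M N L P s1 := hw.congr fun k k1 k2 _ => hw1 k k1 k2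
    rw [pre_append, pre_ite]
    refine ⟨by simp [hw1'.w5]; omega, fun hne => ?_, fun he => ?_⟩
    · have h : 1 ≤ L := by rw [val_var, hw1'.w5] at hne; omega
      rw [if_pos h] at hs1
      refine fetchTo_pre (by omega) (by omega) (p := 10) hs1 (by simp; omega)
        (by simp) (by simp; omega) (by simp) (by omega) fun s2 hw2 hd2 hc2 hs2 => ?_
      have hw2' : IncWords M N L P s2 := hw1'.congr fun k k1 k2 _ => hw2 k k1 k2
      rw [pre_assign]
      refine ⟨by omega, by omega, by simp; omega, hQ _ ⟨hw2'.congr fun k _ _ h => by simp [h],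
        by simp, fun k k1 k2 _ => ?_, hs2.congr rfl rfl, ?_, fun _ => hc2⟩⟩
      · rw [digs_setWord, hd2 k k2, hd1 k k1]
      · rw [digs_setWord, hd2 9 (by omega)]; exact hc1
    · have h : L = 0 := by rw [val_var, hw1'.w5] at he; omega
      rw [if_neg (by omega)] at hs1
      simp only [pre_copy, pre_assign, ok_ofNat, val_ofNat]
      refine ⟨by omega, by omega, by omega, by omega, by omega, by omega, by omega,
        hQ _ ⟨hw1'.congr fun k _ _ h => by simp [h], by simp, fun k k1 k2 k3 => ?_, ?_, ?_,
          fun _ => by omega⟩⟩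
      · simp [k3, hd1 k k1]
      · subst h
        exact hs1.congr (by simp) (by simp)
      · simpa using hc1
  · obtain ⟨hw', h11, hd, hst, hc1, hc2⟩ := h
    refine (blocksLoop_runs hs h1 h2 hMN hL hw'.w3 hw'.w4 hw'.w5 h11 hst (fun t h3 h4 => ?_)
      (by rwa [hb0]) (fun h => by rw [hg0 h]; exact hc2 h)).mono le_rfl ?_
    · rw [hd _ (by omega) (by omega) (by omega)]; exact hT t h3 h4
    · rintro s'' ⟨i1, i2, i3, i4, i5⟩
      exact ⟨hw'.congr i4, fun k k1 k2 k3 => by rw [i5 k k1 k2 k3, hd k k1 k2 k3], i1, i2,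
        fun h => by rw [hs.mtn_growing h]; exact i3 h⟩

theorem newCmd_runs (hs : Split M N L P) (h1 : 100 * (N + 2) ≤ E.bound)
    (h2 : Nat.log 2 N + 40 ≤ E.space) (hMN : M ≤ N) (hL : L ≤ Nat.log 2 N)
    (hw : IncWords M N L P s) (hstr : Stream C π (peaks N (L - 1) ++ R) s)
    (hf : FarVals E.A C π M N L P s)
    (hZ : 1 ≤ M >>> L → Comp E.A C π (blk L (M >>> L - 1)) (s.digs 9))
    (hY : 1 ≤ L → Comp E.A C π (mtn N (L - 1)) (s.digs 10)) :
    RunsIn E newCmd s (800 + 100 * L) fun s' =>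
      (∀ k, k < 3 → s'.digs k = s.digs k) ∧ Stream C π R s' ∧
      Comp E.A C π (bel N 0) (s'.digs 11) := by
  have hlog : Nat.log 2 N ≤ N := Nat.log_le_self _ _
  have hem := endMask_le N
  refine (RunsIn.seq (T := 700) (U := 100 * (L - 1) + 100)
    (Q := fun s' => s'.words 11 = L - 1 ∧ s'.words 4 = N ∧ s'.words 8 = endMask N ∧
      (∀ k, k < 3 → s'.digs k = s.digs k) ∧ Stream C π (peaks N (L - 1) ++ R) s' ∧
      CompSt E.A C π N (L - 1) 11 12 s') ?_
    fun s' h => ?_).mono (by omega) fun s' h => h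
  · refine (runsIn_of_pre (by omega) (pre_of_forall fun Q hQ => ?_)).mono
      (Nat.le_of_ble_eq_true rfl) fun s' h => h
    rw [pre_append]
    refine nearCmd_pre hs.carry h1 h2 hMN hw hf hZ fun s1 hw1 hi1 hd1 hc1 => ?_
    have hw1' : IncWords M N L P s1 := hw.congr fun k _ _ _ => by rw [hw1]
    have hs1 := hstr.congr hi1 (by rw [hw1])
    rw [pre_append, pre_ite]
    refine ⟨by simp [hw1'.w5]; omega, fun hne => ?_, fun he => ?_⟩
    · have h : 1 ≤ L := by rw [val_var, hw1'.w5] at hne; omega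
      have hmin : 2 ≤ N >>> (L - 1) := (Nat.le_add_left 2 _).trans (hs.min h)
      refine bagCmd_pre (C := C) (π := π) (N := N) (q := L - 1) (p := 10) (by omega) (by omega)
        (by omega) (by omega) (by omega) (by simp; omega) (by simp) (by omega) (fun d => ?_)
        (fun d => ?_) hmin ?_ ?_ fun s2 hw2 hi2 hd2 hc2 => ?_
      · exact ok_endsE (by omega) (by omega) (by omega) (by rw [words_setDig, hw1'.w8]; omega)
          (by simp [hw1'.w5]; omega)
      · exact val_endsE hw1'.w8 (by simp [hw1'.w5]) hmin
      · rw [show L - 1 + 1 = L by omega]; exact hc1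
      · rw [hd1 10 (by omega) (by omega) (by omega)]; exact hY h
      · rw [pre_assign]
        refine ⟨by omega, by omega, by simp [hw2, hw1'.w5]; omega, hQ _ ⟨by simp [hw2, hw1'.w5],
          by simp [hw2, hw1'.w4], by simp [hw2, hw1'.w8], fun k hk => ?_,
          hs1.congr hi2 (by simp [hw2]), hc2⟩⟩
        rw [digs_setWord, hd2 k (by omega) (by omega), hd1 k (by omega) (by omega) (by omega)]
    · have h : L = 0 := by rw [val_var, hw1'.w5] at he; omega
      subst h
      simp only [pre_copy, pre_assign, ok_ofNat, val_ofNat]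
      refine ⟨by omega, by omega, by omega, by omega, by omega, by omega, by simp [hw1'.w5]; omega,
        hQ _ ⟨by simp [hw1'.w5], by simp [hw1'.w4], by simp [hw1'.w8], fun k hk => ?_,
          hs1.congr rfl rfl, ?_⟩⟩
      · simp [show k ≠ 13 by omega, hd1 k (by omega) (by omega) (by omega)]
      · simpa [CompSt] using hc1
  · obtain ⟨h11, w4, w8, hd, hst, hcs⟩ := h
    refine (peaksLoop_runs h1 h2 (by omega) (by omega) (by omega) (by omega) (by omega) le_rfl h11
      w4 w8 (by omega) hst hcs).mono le_rfl ?_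
    rintro s'' ⟨i1, i2, i3, i4, i5⟩
    exact ⟨fun k hk => by rw [i5 k (by omega) (by omega) (by omega), hd k hk], i1, i2.1⟩

theorem verifyIncCmd_runs {m n : ℕ} (hm : 1 ≤ m) (hmn : m < n) (h1 : 100 * (n + 3) ≤ E.bound)
    (h2 : Nat.log 2 (n + 1) + 40 ≤ E.space) {d d' : Digest ℓ} {s : St ℓ} (w1 : s.words 1 = m)
    (w2 : s.words 2 = n) (d0 : s.digs 0 = d) (d1 : s.digs 1 = d') :
    RunsIn E verifyIncCmd s (5000 * lg (n - m)) fun s' =>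
      s'.words 0 = 1 ↔ IncValid E.A (coverNodes m n) m n d d' s.inbox := by
  set π := s.inbox with hπ
  have hMN : m + 1 < n + 1 := by omega
  have hs := split hMN
  have hLle : level (m + 1) (n + 1) ≤ lg (n - m) := by
    have := level_le hMN
    rwa [Nat.add_sub_add_right] at this
  have hL := level_lt_log hMN (by omega)
  have hlg : 1 ≤ lg (n - m) := by unfold lg; omega
  obtain ⟨b1, b2⟩ := built_cover hm hmn
  have hC : Indep (coverNodes m n) := b2.indep (by rw [leaves_mmb]; exact List.nodup_range')
  set L := level (m + 1) (n + 1) with hLdef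
  set P := carryEnd (m + 1) (n + 1) with hPdef
  have hlogn : Nat.log 2 (n + 1) ≤ n + 1 := Nat.log_le_self _ _
  refine (RunsIn.seq (T := 100 * L + 400) (U := 3500 + 400 * L)
    (Q := fun s' => s'.words 3 = m + 1 ∧ s'.words 4 = n + 1 ∧ s'.words 5 = L ∧
      s'.words 7 = endMask (m + 1) ∧ s'.words 8 = endMask (n + 1) ∧ s'.words 9 = 1 ∧
      s'.inbox = π ∧ s'.digs = s.digs) ?_ fun s1 h => ?_).mono (by omega) fun s' h => h
  · refine (RunsIn.seq (T := 200) (U := 100 * L + 100)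
      (Q := fun s' => s'.words 3 = m + 1 ∧ s'.words 4 = n + 1 ∧ s'.words 5 = 0 ∧
      s'.words 7 = endMask (m + 1) ∧ s'.words 8 = endMask (n + 1) ∧ s'.words 9 = 1 ∧
      s'.inbox = π ∧ s'.digs = s.digs) ?_ fun s1 h => ?_).mono (by omega) fun s' h => h
    · refine (runsIn_of_pre (by omega) (pre_of_forall fun Q hQ => ?_)).mono
        (Nat.le_of_ble_eq_true rfl) fun s' h => h
      simp only [headCmd, pre_append]
      rw [pre_assign]
      refine ⟨by omega, by omega, by simp [w1]; omega, ?_⟩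
      rw [pre_assign]
      refine ⟨by omega, by omega, by simp [w2]; omega, ?_⟩
      rw [pre_assign]
      refine ⟨by omega, by omega, by simp; omega, ?_⟩
      rw [pre_assign]
      refine ⟨by omega, by omega, by simp; omega, ?_⟩
      rw [pre_assign]
      have k1 := fun s : St ℓ => maskE_spec (E := E) (s := s) (w := 3) (N := m + 1) (by omega)
        (by omega) (by omega) (by omega)
      have k2 := fun s : St ℓ => maskE_spec (E := E) (s := s) (w := 4) (N := n + 1) (by omega)
        (by omega) (by omega) (by omega)
      refine ⟨by omega, by omega, (k1 _ (by simp [w1])).1, ?_⟩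
      rw [(k1 _ (by simp [w1])).2, pre_assign]
      refine ⟨by omega, by omega, (k2 _ (by simp [w2])).1, ?_⟩
      rw [(k2 _ (by simp [w2])).2]
      exact hQ _ ⟨by simp [w1], by simp [w2], by simp, by simp, by simp, by simp, rfl, rfl⟩
    · obtain ⟨w3, w4, w5, w7, w8, w9, hi, hd⟩ := h
      refine (levelLoop_runs hMN (by omega) (by omega) h2 w3 w4 w5).mono le_rfl ?_
      rintro s2 rfl
      exact ⟨by simpa, by simpa, by simp [hLdef], by simpa, by simpa, by simpa, hi, hd⟩
  · obtain ⟨w3, w4, w5, w7, w8, w9, hi, hd⟩ := h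
    have hcov : coverNodes m n = farNodes (m + 1) (n + 1) L P ++ (peaks (m + 1) L ++
        (leaf (m + 1) :: ((if 1 ≤ L then leaf (m + 1 + 1) :: newBlocks (m + 1) (n + 1) L 0 L else [])
          ++ (peaks (n + 1) (L - 1) ++ [])))) := by
      rw [coverNodes, nearNodes, ← hLdef, ← hPdef]
      split
      · simp
      · simp [show L = 0 by omega, peaks]
    have hstr : Stream (coverNodes m n) π (coverNodes m n) s1 := ⟨[], by simp, by simp [hi], by simp [w9]⟩
    nth_rw 2 [hcov] at hstr
    refine (RunsIn.seq (oldCmd_runs (by omega) hMN (by omega) h2 w3 w4 w5 w7 w8 hstr)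
      (U := 2400 + 300 * L) fun s2 h => ?_).mono (by omega) fun s' h => h
    obtain ⟨hw2, hd2, hst2, hf2, hc2, hT2⟩ := h
    refine (RunsIn.seq (middleCmd_runs hs (by omega) (by omega) h2 hMN.le hL hw2 hst2 hT2)
      (U := 1800 + 200 * L) fun s3 h => ?_).mono (by omega) fun s' h => h
    obtain ⟨hw3, hd3, hst3, hZ3, hY3⟩ := h
    have hf3 : FarVals E.A (coverNodes m n) π (m + 1) (n + 1) L P s3 := by
      obtain ⟨⟨f1, f2⟩, f3, f4, f5⟩ := hf2
      constructor
      · rw [CompSt, hd3 4 (by omega) (by omega) (by omega), hd3 5 (by omega) (by omega) (by omega)]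
        exact ⟨f1, f2⟩
      · rw [hd3 6 (by omega) (by omega) (by omega)]; exact f3
      · rw [hd3 7 (by omega) (by omega) (by omega)]; exact f4
      · rw [hd3 8 (by omega) (by omega) (by omega)]; exact f5
    refine (RunsIn.seq (newCmd_runs hs (by omega) h2 hMN.le hL hw3 hst3 hf3 hZ3 hY3)
      (U := 1000) fun s4 h => ?_).mono (by omega) fun s' h => h
    obtain ⟨hd4, hst4, hN4⟩ := h
    have e2 : s4.digs 2 = s2.digs 2 := by
      rw [hd4 2 (by omega), hd3 2 (by omega) (by omega) (by omega)]
    have e01 : ∀ k, k < 2 → s4.digs k = s.digs k := fun k hk => by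
      rw [hd4 k (by omega), hd3 k (by omega) (by omega) (by omega), hd2 k hk, hd]
    refine (runsIn_of_pre (by omega) (compareCmd_pre (by omega) (by omega) hst4)).mono
      (Nat.le_of_ble_eq_true rfl) fun s5 h => ?_
    rw [h, e01 0 (by omega), e01 1 (by omega), d0, d1, e2, IncValid, mmb_eq, mmb_eq]
    refine and_congr_right fun hlen => ?_
    rw [(derive_of_comp hC hlen hc2).1, (derive_of_comp hC hlen hN4).1]

end

/-! ### The shape of membership proofs -/

/-- A sibling to the right, which is not missing. -/
def IsRight (p : Bool × MTree) : Prop := p.1 = false ∧ p.2 ≠ .empty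

theorem siblings_left {i : ℕ} {l r : MTree} (h : i ∈ l.leaves) :
    siblings i (node l r) = siblings i l ++ [(false, r)] := by rw [siblings, if_pos h]

theorem siblings_right {i : ℕ} {l r : MTree} (h : i ∉ l.leaves) :
    siblings i (node l r) = siblings i r ++ [(true, l)] := by rw [siblings, if_neg h]

theorem siblings_blk {i : ℕ} (hi : 1 ≤ i) (h : ℕ) :
    (siblings i (blk h ((i - 1) >>> h))).map Prod.fst = (List.range h).map (i - 1).testBit ∧
      ∀ p ∈ siblings i (blk h ((i - 1) >>> h)), p.2 ≠ .empty := by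
  induction h with
  | zero => simp [blk, siblings]
  | succ h ih =>
    have h3 := shr_half (i - 1) h
    have hb := Nat.testBit_eq_decide_div_mod_eq (x := i - 1) (i := h)
    rw [← Nat.shiftRight_eq_div_pow] at hb
    rw [blk, List.range_succ, List.map_append, ← ih.1]
    rcases Nat.mod_two_eq_zero_or_one ((i - 1) >>> h) with h0 | h0
    · have e : 2 * (i - 1) >>> (h + 1) = (i - 1) >>> h := by omega
      rw [e, siblings_left (mem_leaves_blk.2 ⟨hi, rfl⟩)]
      refine ⟨by simp [hb, h0], fun p hp => ?_⟩
      rcases List.mem_append.1 hp with hp | hp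
      · exact ih.2 p hp
      · rw [List.mem_singleton.1 hp]; exact blk_ne_empty _ _
    · have e : 2 * (i - 1) >>> (h + 1) + 1 = (i - 1) >>> h := by omega
      rw [e, siblings_right fun h' => by have := (mem_leaves_blk.1 h').2; omega]
      refine ⟨by simp [hb, h0], fun p hp => ?_⟩
      rcases List.mem_append.1 hp with hp | hp
      · exact ih.2 p hp
      · rw [List.mem_singleton.1 hp]; exact blk_ne_empty _ _

/-- The item `i` belongs to the mountain `p`. -/
structure InMountain (N p i : ℕ) : Prop where
  pos : 1 ≤ i
  lt : (i - 1) >>> p + 1 < N >>> p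
  ge : N >>> (p + 1) ≤ (i - 1) >>> (p + 1) + 1

namespace InMountain

variable {N p i : ℕ}

theorem two_le (h : InMountain N p i) : 2 ≤ N >>> p :=
  (Nat.le_add_left 1 _).trans_lt h.lt

theorem mtn_eq (h : InMountain N p i) : mtn N p =
    blk (p + (N >>> p) % 2) ((i - 1) >>> (p + (N >>> p) % 2)) := by
  obtain ⟨h1, h2, h3⟩ := h
  have h4 := shr_half N p
  have h5 := shr_half (i - 1) p
  rw [mtn]
  split
  · rename_i h0
    rw [h0, Nat.add_zero]
    congr 1; omega
  · rename_i h0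
    rw [show N >>> p % 2 = 1 by omega]
    congr 1; omega

theorem mem_mtn (h : InMountain N p i) : i ∈ (mtn N p).leaves := by
  rw [h.mtn_eq]; exact mem_leaves_blk.2 ⟨h.pos, rfl⟩

theorem not_mem (h : InMountain N p i) :
    i ∉ (bel N (p + 1)).leaves ∧ i ∉ (chn N (p + 1)).leaves := by
  rw [← not_or, ← List.mem_append, leaves_st, List.mem_range'_1]
  rintro ⟨h1, h2⟩
  have h3 := h.ge
  rw [Nat.shiftRight_eq_div_pow (i - 1)] at h3
  have h4 : 2 ^ (p + 1) * (N >>> (p + 1) - 1) ≤ 2 ^ (p + 1) * ((i - 1) / 2 ^ (p + 1)) :=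
    Nat.mul_le_mul_left _ (Nat.sub_le_of_le_add h3)
  have h5 := Nat.mul_div_le (i - 1) (2 ^ (p + 1))
  omega

theorem two_le_of_le (h : InMountain N p i) {q : ℕ} (hq : q ≤ p) : 2 ≤ N >>> q :=
  two_le_shr (hq.trans_lt (lt_log_of_two_le_shr h.two_le))

/-- The siblings within the range of the item. -/
theorem siblings_chain (h : InMountain N p i) (d q : ℕ) (hd : q + d = p)
    (ho : ∀ t, q < t → t ≤ p → ¬ Closes N t) :
    i ∈ (node (chn N (q + 1)) (mtn N q)).leaves ∧
    ∃ R, siblings i (node (chn N (q + 1)) (mtn N q)) =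
      siblings i (mtn N p) ++ (true, chn N (p + 1)) :: R ∧ R.length = d ∧ ∀ p ∈ R, IsRight p := by
  induction d generalizing q with
  | zero =>
    obtain rfl : q = p := hd
    refine ⟨by simp [leaves, h.mem_mtn], [], ?_, rfl, by simp⟩
    rw [siblings_right h.not_mem.2]
  | succ d ih =>
    obtain ⟨h1, R, h2, h3, h4⟩ := ih (q + 1) (by omega) fun t ht => ho t (by omega)
    rw [← chn_open (h.two_le_of_le (by omega)) (ho (q + 1) (by omega) (by omega))] at h1 h2
    refine ⟨by simp [leaves, h1], R ++ [(false, mtn N q)], ?_, by simp [h3], ?_⟩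
    · rw [siblings_left h1, h2, List.append_assoc, List.cons_append]
    · intro p hp
      rcases List.mem_append.1 hp with hp | hp
      · exact h4 p hp
      · rw [List.mem_singleton.1 hp]; exact ⟨rfl, mtn_ne_empty _ _⟩

/-- The siblings to the right of the range of the item. -/
theorem siblings_belt (h : InMountain N p i) (d q : ℕ) (hq : q + d ≤ p)
    (hi : i ∈ (bel N (q + d)).leaves) :
    i ∈ (bel N q).leaves ∧ ∃ R, siblings i (bel N q) = siblings i (bel N (q + d)) ++ R ∧
      R.length = ((Finset.Ico q (q + d)).filter (Closes N)).card ∧ ∀ p ∈ R, IsRight p := by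
  induction d generalizing q with
  | zero => exact ⟨hi, [], by simp⟩
  | succ d ih =>
    rw [← Nat.add_assoc, Nat.add_right_comm] at hi ⊢
    obtain ⟨h1, R, h2, h3, h4⟩ := ih (q + 1) (by omega) hi
    rw [← Finset.insert_Ico_add_one_left_eq_Ico (by omega), Finset.filter_insert]
    by_cases hc : Closes N q
    · rw [bel_close (h.two_le_of_le (by omega)) hc, siblings_left h1, h2, if_pos hc,
        Finset.card_insert_of_notMem (by simp)]
      refine ⟨by simp [leaves, h1], _, List.append_assoc _ _ _, by simp [h3], ?_⟩
      intro p hp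
      rcases List.mem_append.1 hp with hp | hp
      · exact h4 p hp
      · rw [List.mem_singleton.1 hp]; exact ⟨rfl, by simp⟩
    · rw [bel_open hc, if_neg hc]
      exact ⟨h1, R, h2, h3, h4⟩

/-- A membership proof consists of the siblings in the mountain, the chain to the left of the
mountain, mountains of the range to the right, the belt to the left of the range, and ranges to the
right. -/
theorem siblings_eq (h : InMountain N p i) {q : ℕ} (hq : q ≤ p) (hc : Closes N q)
    (ho : ∀ t, q < t → t ≤ p → ¬ Closes N t) : ∃ R R', siblings i (bel N 0) =
      siblings i (mtn N p) ++ (true, chn N (p + 1)) :: (R ++ (true, bel N (q + 1)) :: R') ∧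
      R.length = p - q ∧ R'.length = ((Finset.Ico 0 q).filter (Closes N)).card ∧
      (∀ p ∈ R, IsRight p) ∧ ∀ p ∈ R', IsRight p := by
  obtain ⟨h1, R, h2, h3, h4⟩ := h.siblings_chain (p - q) q (by omega) ho
  have hb : bel N (q + 1) = bel N (p + 1) := by
    rw [bel_eq_of_not_closes (p - q) fun t h5 h6 => ho t (by omega) (by omega)]
    congr 1; omega
  have hn : i ∉ (bel N (q + 1)).leaves := by rw [hb]; exact h.not_mem.1
  have hbq := bel_close (h.two_le_of_le hq) hc
  have hi : i ∈ (bel N (0 + q)).leaves := by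
    rw [Nat.zero_add, hbq, leaves]; exact List.mem_append_right _ h1
  obtain ⟨-, R', h5, h6, h7⟩ := h.siblings_belt q 0 (by omega) hi
  rw [Nat.zero_add] at h5 h6
  refine ⟨R, R', ?_, h3, h6, h4, h7⟩
  rw [h5, hbq, siblings_right hn, h2]
  simp

end InMountain

/-! ### Counting the ones of a binary number -/

/-- The positions of the ones in the binary representation. -/
def ones (x : ℕ) : Finset ℕ := (Finset.range x).filter fun t => x.testBit t

theorem mem_ones {x t : ℕ} : t ∈ ones x ↔ x.testBit t = true := by
  rw [ones, Finset.mem_filter, Finset.mem_range, and_iff_right_iff_imp]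
  intro h
  by_contra h'
  rw [Nat.testBit_eq_false_of_lt ((not_lt.1 h').trans_lt Nat.lt_two_pow_self)] at h
  exact absurd h (by simp)

theorem card_ones_le (x : ℕ) : (ones x).card ≤ x :=
  (Finset.card_filter_le _ _).trans (Finset.card_range x).le

theorem testBit_log {x : ℕ} (hx : x ≠ 0) : x.testBit (Nat.log 2 x) = true := by
  rw [testBit_iff, shr_log (Nat.one_le_iff_ne_zero.2 hx)]

theorem lt_of_testBit {x t p : ℕ} (h : x < 2 ^ p) (ht : x.testBit t = true) : t < p := by
  by_contra h'
  rw [Nat.testBit_eq_false_of_lt (h.trans_le (Nat.pow_le_pow_right (by norm_num) (not_lt.1 h')))] at ht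
  exact absurd ht (by simp)

theorem ones_mod_log {x : ℕ} (hx : x ≠ 0) :
    (ones (x % 2 ^ Nat.log 2 x)).card + 1 = (ones x).card := by
  rw [← Finset.card_erase_add_one (mem_ones.2 (testBit_log hx))]
  congr 2
  ext t
  rw [Finset.mem_erase, mem_ones, mem_ones, Nat.testBit_mod_two_pow, Bool.and_eq_true,
    decide_eq_true_eq]
  refine and_congr_left fun ht => ?_
  have := lt_of_testBit (Nat.lt_pow_succ_log_self (by norm_num) x) ht
  omega

/-- The ones of `x` that are zeros of `y`. -/
def onesDiff (x y : ℕ) : ℕ := x ^^^ (x &&& y)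

theorem ones_onesDiff (x y : ℕ) : ones (onesDiff x y) = ones x \ ones y := by
  ext t
  rw [Finset.mem_sdiff, mem_ones, mem_ones, mem_ones, onesDiff, Nat.testBit_xor, Nat.testBit_and]
  cases x.testBit t <;> cases y.testBit t <;> simp

theorem card_ones_add (x y : ℕ) :
    (ones x).card + (ones (onesDiff y x)).card = (ones y).card + (ones (onesDiff x y)).card := by
  rw [ones_onesDiff, ones_onesDiff, Nat.add_comm, Finset.card_sdiff_add_card, Nat.add_comm (ones y).card,
    Finset.card_sdiff_add_card, Finset.union_comm]

/-- The mask of the range ends between `1` and `p`, shifted by one. -/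
def endsBelow (N p : ℕ) : ℕ := (endMask N >>> 1) % 2 ^ p

theorem mem_endsBelow {N p t : ℕ} (hp : p < Nat.log 2 N) :
    t ∈ ones (endsBelow N p) ↔ t < p ∧ Closes N (t + 1) := by
  rw [mem_ones, endsBelow, Nat.testBit_mod_two_pow, Nat.testBit_shiftRight, Bool.and_eq_true,
    decide_eq_true_eq, testBit_iff, Nat.add_comm 1 t, endMask_bit (by omega)]
  refine and_congr_right fun h => ⟨fun h => h.2, fun h => ⟨by omega, h⟩⟩

/-- The mountain that ends the range of the mountain `p`. -/
def rangeEnd (N p : ℕ) : ℕ := Nat.log 2 (2 * endsBelow N p)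

theorem rangeEnd_spec {N p : ℕ} (hp : p < Nat.log 2 N) :
    rangeEnd N p ≤ p ∧ Closes N (rangeEnd N p) ∧
    (∀ t, rangeEnd N p < t → t ≤ p → ¬ Closes N t) ∧
    ((Finset.Ico 0 (rangeEnd N p)).filter (Closes N)).card = (ones (endsBelow N p)).card := by
  by_cases h0 : endsBelow N p = 0
  · have hr : rangeEnd N p = 0 := by rw [rangeEnd, h0]; simp
    rw [hr]
    refine ⟨Nat.zero_le _, Or.inl rfl, fun t h1 h2 hc => ?_, by simp [h0, ones]⟩
    have := (mem_endsBelow (t := t - 1) hp).2 ⟨by omega, by rwa [Nat.sub_add_cancel h1]⟩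
    rw [h0] at this
    simp [ones] at this
  · have hr : rangeEnd N p = Nat.log 2 (endsBelow N p) + 1 := by
      rw [rangeEnd, Nat.mul_comm, Nat.log_mul_base (by norm_num) h0]
    have hmem := (mem_endsBelow hp).1 (mem_ones.2 (testBit_log h0))
    have hmax : ∀ t ∈ ones (endsBelow N p), t < rangeEnd N p := fun t ht => by
      have := lt_of_testBit (Nat.lt_pow_succ_log_self (by norm_num) _) (mem_ones.1 ht)
      omega
    refine ⟨by omega, by rw [hr]; exact hmem.2, fun t h1 h2 hc => ?_, ?_⟩
    · have := hmax (t - 1) ((mem_endsBelow hp).2 ⟨by omega, by rwa [Nat.sub_add_cancel (by omega)]⟩)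
      omega
    · -- a range end below the last one corresponds to the next higher one
      have e : ((Finset.Ico 1 (rangeEnd N p + 1)).filter (Closes N)) =
          (ones (endsBelow N p)).image (· + 1) := by
        ext t
        simp only [Finset.mem_filter, Finset.mem_Ico, Finset.mem_image]
        constructor
        · rintro ⟨⟨h1, h2⟩, hc⟩
          exact ⟨t - 1, (mem_endsBelow hp).2 ⟨by omega, by rwa [Nat.sub_add_cancel h1]⟩, by omega⟩
        · rintro ⟨u, hu, rfl⟩
          have := hmax u hu
          exact ⟨⟨by omega, by omega⟩, ((mem_endsBelow hp).1 hu).2⟩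
      have e2 : (ones (endsBelow N p)).card =
          ((Finset.Ico 1 (rangeEnd N p + 1)).filter (Closes N)).card := by
        rw [e, Finset.card_image_of_injective _ (add_left_injective 1)]
      have hc0 : Closes N 0 := Or.inl rfl
      have hc1 : Closes N (rangeEnd N p) := by rw [hr]; exact hmem.2
      rw [e2, ← Finset.insert_Ico_right_eq_Ico_add_one (by omega), Finset.filter_insert, if_pos hc1,
        ← Finset.insert_Ico_add_one_left_eq_Ico (by omega), Finset.filter_insert, if_pos hc0,
        Finset.card_insert_of_notMem (by simp), Finset.card_insert_of_notMem (by simp), Nat.zero_add]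

/-! ### The path of an item and its change -/

section

variable {M N L P n m i p q : ℕ}

theorem InMountain.of_shr_eq (h : InMountain N p i) (h1 : N >>> p = M >>> p) : InMountain M p i :=
  ⟨h.pos, h1 ▸ h.lt, by rw [← shr_add_eq h1 (Nat.le_succ p)]; exact h.ge⟩

theorem shr_lt_of_le {j : ℕ} (hq : q ≤ p) (h : j >>> p + 1 < N >>> p) : j >>> q + 1 < N >>> q := by
  obtain ⟨d, rfl⟩ := Nat.exists_eq_add_of_le hq
  rw [Nat.shiftRight_add, Nat.shiftRight_add, Nat.shiftRight_eq_div_pow _ d,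
    Nat.shiftRight_eq_div_pow _ d, ← Nat.succ_le_iff, Nat.le_div_iff_mul_le (Nat.two_pow_pos d)] at h
  have h1 := Nat.lt_div_mul_add (a := j >>> q) (Nat.two_pow_pos d)
  have h2 := Nat.two_pow_pos d
  rw [Nat.succ_eq_add_one, Nat.add_mul, Nat.add_mul] at h
  omega

theorem InMountain.unique (h : InMountain N p i) (h' : InMountain N q i) : p = q := by
  rcases Nat.lt_trichotomy p q with h1 | h1 | h1
  · exact absurd (shr_lt_of_le h1 h'.lt) (not_lt.2 h.ge)
  · exact h1
  · exact absurd (shr_lt_of_le h1 h.lt) (not_lt.2 h'.ge)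

/-- The index of the mountain with the item `i`. It is determined, up to one, by the number of
items from `i` on. -/
def mountainOf (N i : ℕ) : ℕ :=
  Nat.log 2 (N - i) + (if (i - 1) >>> Nat.log 2 (N - i) + 1 < N >>> Nat.log 2 (N - i) then 1 else 0) - 1

theorem inMountain_mountainOf (hi : 1 ≤ i) (hN : i < N) : InMountain N (mountainOf N i) i := by
  set e := Nat.log 2 (N - i) with he
  have h1 : 2 ^ e ≤ N - i := Nat.pow_log_le_self 2 (by omega)
  have h2 : N - i < 2 ^ (e + 1) := Nat.lt_pow_succ_log_self (by norm_num) _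
  have high : N >>> (e + 1) ≤ (i - 1) >>> (e + 1) + 1 := by
    rw [Nat.shiftRight_eq_div_pow, Nat.shiftRight_eq_div_pow]
    have h3 := Nat.lt_div_mul_add (a := i - 1) (Nat.two_pow_pos (e + 1))
    rw [← Nat.lt_succ_iff, Nat.div_lt_iff_lt_mul (Nat.two_pow_pos (e + 1)), Nat.succ_eq_add_one,
      Nat.add_mul, Nat.add_mul]
    omega
  rw [mountainOf, ← he]
  split
  · rename_i h
    exact ⟨hi, h, high⟩
  · rename_i h
    rw [not_lt] at h
    have he1 : 1 ≤ e := by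
      by_contra h0
      have h0 : e = 0 := by omega
      rw [h0, Nat.shiftRight_zero, Nat.shiftRight_zero] at h
      rw [h0] at h2
      omega
    rw [Nat.add_zero]
    refine ⟨hi, ?_, by rwa [Nat.sub_add_cancel he1]⟩
    rw [Nat.shiftRight_eq_div_pow, Nat.shiftRight_eq_div_pow, ← Nat.succ_le_iff,
      Nat.le_div_iff_mul_le (Nat.two_pow_pos _), Nat.succ_eq_add_one, Nat.add_mul, Nat.add_mul]
    have h3 := Nat.div_mul_le_self (i - 1) (2 ^ (e - 1))
    have h4 : 2 ^ e = 2 ^ (e - 1) + 2 ^ (e - 1) := by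
      rw [← Nat.two_mul, ← pow_succ', Nat.sub_add_cancel he1]
    omega

theorem mountainOf_le (N i : ℕ) : mountainOf N i ≤ Nat.log 2 (N - i) := by
  rw [mountainOf]; split <;> omega

/-- The height of the mountain with the item `i`. -/
def heightOf (N i : ℕ) : ℕ := mountainOf N i + N >>> mountainOf N i % 2

/-- The range ends to the right of the mountain with the item `i`, and its own range end. -/
def endsOf (N i : ℕ) : ℕ := endsBelow N (mountainOf N i)

/-- The number of mountains to the right in the same range. -/
def rightOf (N i : ℕ) : ℕ := mountainOf N i - rangeEnd N (mountainOf N i)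

/-- The length of the membership proof of the item `i`. -/
def pathLen (N i : ℕ) : ℕ := heightOf N i + rightOf N i + 2 + (ones (endsOf N i)).card

/-- Whether the `t`-th sibling in the membership proof of `i` is a left one. -/
def isLeft (n i t : ℕ) : Bool := ((path n i).map Prod.fst).getD t false

theorem length_filter_isRight {R : List (Bool × MTree)} (h : ∀ p ∈ R, IsRight p) :
    R.filter (fun p => p.2 = .empty) = [] := by
  rw [List.filter_eq_nil_iff]
  exact fun p hp => by simpa using (h p hp).2

theorem map_fst_isRight {R : List (Bool × MTree)} (h : ∀ p ∈ R, IsRight p) :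
    R.map Prod.fst = List.replicate R.length false := by
  rw [List.eq_replicate_iff]
  refine ⟨by simp, fun b hb => ?_⟩
  obtain ⟨p, hp, rfl⟩ := List.mem_map.1 hb
  exact (h p hp).1

theorem path_spec (hi : 1 ≤ i) (hn : i ≤ n) : (path n i).length = pathLen (n + 1) i ∧
    (∀ t, isLeft n i t = true ↔ if t < heightOf (n + 1) i then ((i - 1) >>> t) % 2 = 1 else
      t = heightOf (n + 1) i ∨ t = heightOf (n + 1) i + rightOf (n + 1) i + 1) ∧
    ((path n i).filter fun p => p.2 = .empty).length ≤ 2 := by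
  have h := inMountain_mountainOf (N := n + 1) hi (by omega)
  obtain ⟨r1, r2, r3, r4⟩ := rangeEnd_spec (lt_log_of_two_le_shr h.two_le)
  obtain ⟨R, R', h1, h2, h3, h4, h5⟩ := h.siblings_eq r1 r2 r3
  obtain ⟨b1, b2⟩ := siblings_blk hi (heightOf (n + 1) i)
  have hm : mtn (n + 1) (mountainOf (n + 1) i) =
      blk (heightOf (n + 1) i) ((i - 1) >>> heightOf (n + 1) i) := h.mtn_eq
  have hb := congrArg List.length b1
  rw [List.length_map, List.length_map, List.length_range] at hb
  rw [hm] at h1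
  have hp : path n i = _ := (by rw [path, mmb_eq] : path n i = siblings i (bel (n + 1) 0)).trans h1
  rw [r4] at h3
  refine ⟨?_, fun t => ?_, ?_⟩
  · rw [hp, pathLen, endsOf, ← h3, rightOf, ← h2]
    simp only [List.length_append, List.length_cons, hb]
    omega
  · have hr : rightOf (n + 1) i = R.length := h2.symm
    have e : (path n i).map Prod.fst = (List.range (heightOf (n + 1) i)).map (i - 1).testBit ++
        (true :: (List.replicate R.length false ++ true :: List.replicate R'.length false)) := by
      rw [hp, List.map_append, b1, List.map_cons, List.map_append, List.map_cons,
        map_fst_isRight h4, map_fst_isRight h5]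
    rw [isLeft, e, hr, List.getD_eq_getElem?_getD]
    split
    · rename_i ht
      rw [List.getElem?_append_left (by simpa using ht)]
      simp [ht, testBit_iff]
    · rename_i ht
      rw [List.getElem?_append_right (by simpa using ht), List.length_map, List.length_range]
      obtain ⟨u, rfl⟩ := Nat.exists_eq_add_of_le (not_lt.1 ht)
      rw [Nat.add_sub_cancel_left]
      rcases Nat.eq_zero_or_pos u with rfl | hu
      · simp
      · obtain ⟨v, rfl⟩ : ∃ v, u = v + 1 := ⟨u - 1, by omega⟩
        rw [List.getElem?_cons_succ]
        rcases Nat.lt_trichotomy v R.length with hv | hv | hv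
        · rw [List.getElem?_append_left (by simpa using hv)]
          simp [hv]
          omega
        · rw [List.getElem?_append_right (by simp [hv])]
          simp [hv]
          omega
        · rw [List.getElem?_append_right (by simpa using hv.le)]
          obtain ⟨w, rfl⟩ := Nat.exists_eq_add_of_lt hv
          simp only [List.length_replicate]
          rw [show R.length + w + 1 - R.length = w + 1 by omega, List.getElem?_cons_succ]
          simp [List.getElem?_replicate]
          split <;> simp <;> omega
  · rw [hp]
    simp only [List.filter_append, List.filter_cons, length_filter_isRight h4,
      length_filter_isRight h5]
    have : (siblings i (blk (heightOf (n + 1) i) ((i - 1) >>> heightOf (n + 1) i))).filter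
        (fun p => p.2 = .empty) = [] := by
      rw [List.filter_eq_nil_iff]
      exact fun p hp => by simpa using b2 p hp
    rw [this]
    split <;> split <;> simp

theorem pathLen_le (hi : 1 ≤ i) (hn : i ≤ n) :
    pathLen (n + 1) i ≤ 3 * lg (n + 1 - i) ∧ mountainOf (n + 1) i < Nat.log 2 (n + 1) ∧
    (ones (endsOf (n + 1) i)).card ≤ mountainOf (n + 1) i := by
  have h := inMountain_mountainOf (N := n + 1) hi (by omega)
  have hp := lt_log_of_two_le_shr h.two_le
  have h1 : (ones (endsOf (n + 1) i)).card ≤ mountainOf (n + 1) i := by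
    have : ones (endsOf (n + 1) i) ⊆ Finset.range (mountainOf (n + 1) i) := fun t ht =>
      Finset.mem_range.2 ((mem_endsBelow hp).1 ht).1
    simpa using Finset.card_le_card this
  have h2 := mountainOf_le (n + 1) i
  refine ⟨?_, hp, h1⟩
  rw [pathLen, heightOf, rightOf, lg]
  omega

/-- The number of hash values of an old membership proof that are kept in an update. -/
def keepLen (m n i : ℕ) : ℕ := (path n i).length - 12 * lg (n - m)

theorem keepLen_spec (hi : 1 ≤ i) (hm : i ≤ m) (hmn : m < n) : keepLen m n i ≤ (path m i).length ∧
    (path m i).take (keepLen m n i) = (path n i).take (keepLen m n i) := by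
  obtain ⟨b1, b2⟩ := built_cover (show 1 ≤ m by omega) hmn
  have hC : Indep (coverNodes m n) := b2.indep (by rw [leaves_mmb]; exact List.nodup_range')
  obtain ⟨u, hu, hiu, r, hr, -⟩ := b1.siblings (i := i)
    (by rw [leaves_mmb, List.mem_range'_1]; omega)
  obtain ⟨v, hv, hiv, r', hr', hl⟩ := b2.siblings (i := i)
    (by rw [leaves_mmb, List.mem_range'_1]; omega)
  obtain rfl := eq_of_common_leaf hC.leaves_nodup (coverOld_subset m n hu) hv hiu hiv
  have h1 := length_coverNodes hmn
  have h2 := (path_spec hi (hm.trans hmn.le)).2.2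
  have h3 : (r'.filter fun p => p.2 = .empty).length ≤ 2 := by
    refine le_trans ?_ h2
    rw [path, hr', List.filter_append, List.length_append]
    omega
  have h4 : r'.length = (r'.filter fun p => p.2 ≠ .empty).length +
      (r'.filter fun p => p.2 = .empty).length := by
    rw [List.length_eq_length_filter_add (fun p => decide (p.2 ≠ .empty))]
    simp
  have h5 : 1 ≤ lg (n - m) := by unfold lg; omega
  have h6 : keepLen m n i ≤ (siblings i u).length := by
    rw [keepLen, path, hr', List.length_append]
    omega
  rw [path, path, hr, hr', List.length_append, List.take_append_of_le_length h6,
    List.take_append_of_le_length h6]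
  exact ⟨by omega, rfl⟩

theorem Carry.closes_iff (hc : Carry M N L P) (hq : P + 2 ≤ q) : Closes N q ↔ Closes M q := by
  rw [Closes, Closes, hc.above q (by omega), hc.above (q + 1) (by omega),
    hc.above (q - 1) (by omega)]

theorem card_le_of_subset {L P : ℕ} {S : Finset ℕ}
    (h : ∀ t ∈ S, t < L ∨ t + 1 = P - 1 ∨ t + 1 = P ∨ t = P) : S.card ≤ L + 3 := by
  have h1 : S ⊆ insert (P - 2) (insert (P - 1) (insert P (Finset.range L))) := by
    intro t ht
    simp only [Finset.mem_insert, Finset.mem_range]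
    have := h t ht
    omega
  refine (Finset.card_le_card h1).trans ((Finset.card_insert_le _ _).trans ?_)
  have h2 := Finset.card_insert_le (P - 1) (insert P (Finset.range L))
  have h3 := Finset.card_insert_le P (Finset.range L)
  rw [Finset.card_range] at h3
  omega

/-- The range ends to the right of an item change in few places only. -/
theorem card_onesDiff_endsOf (hi : 1 ≤ i) (hm : i ≤ m) (hmn : m < n) :
    (ones (onesDiff (endsOf (n + 1) i) (endsOf (m + 1) i))).card ≤ lg (n - m) + 3 ∧
    (ones (onesDiff (endsOf (m + 1) i) (endsOf (n + 1) i))).card ≤ lg (n - m) + 3 := by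
  have hs := (split (show m + 1 < n + 1 by omega)).carry
  have hL := level_le (show m + 1 < n + 1 by omega)
  rw [Nat.add_sub_add_right] at hL
  have hN := inMountain_mountainOf (N := n + 1) hi (by omega)
  have hM := inMountain_mountainOf (N := m + 1) hi (by omega)
  have mN := fun t => mem_endsBelow (t := t) (lt_log_of_two_le_shr hN.two_le)
  have mM := fun t => mem_endsBelow (t := t) (lt_log_of_two_le_shr hM.two_le)
  rw [ones_onesDiff, ones_onesDiff]
  refine ⟨(card_le_of_subset (P := carryEnd (m + 1) (n + 1)) fun t ht => ?_).trans (Nat.add_le_add_right hL 3),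
    (card_le_of_subset (P := carryEnd (m + 1) (n + 1)) fun t ht => ?_).trans (Nat.add_le_add_right hL 3)⟩
  · rw [Finset.mem_sdiff, endsOf, endsOf, mN, mM] at ht
    obtain ⟨⟨h1, h2⟩, h3⟩ := ht
    by_contra h0
    rw [not_or, not_or, not_or] at h0
    rcases Nat.lt_or_ge (t + 1) (carryEnd (m + 1) (n + 1)) with h | h
    · exact hs.not_closes_new (by omega) (by omega) h h2
    · have hq : carryEnd (m + 1) (n + 1) + 2 ≤ t + 1 := by omega
      have := (hN.of_shr_eq (hs.above _ (by omega))).unique hM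
      exact h3 ⟨by omega, (hs.closes_iff hq).1 h2⟩
  · rw [Finset.mem_sdiff, endsOf, endsOf, mN, mM] at ht
    obtain ⟨⟨h1, h2⟩, h3⟩ := ht
    by_contra h0
    rw [not_or, not_or, not_or] at h0
    rcases Nat.lt_or_ge (t + 2) (carryEnd (m + 1) (n + 1)) with h | h
    · exact hs.not_closes_old_run (by omega) h h2
    · have hq : carryEnd (m + 1) (n + 1) + 2 ≤ t + 1 := by omega
      have := (hM.of_shr_eq (hs.above _ (by omega)).symm).unique hN
      exact h3 ⟨by omega, (hs.closes_iff hq).2 h2⟩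

end

/-! ### The verification of membership proofs -/

section

variable {ℓ : ℕ} {E : Env ℓ}

/-- The hash of the `t`-th ancestor, from the hash `h` of the leaf and the siblings `v`. -/
def ancestor (A : Hashing ℓ) (dir : ℕ → Bool) (v : ℕ → Digest ℓ) (h : Digest ℓ) : ℕ → Digest ℓ
  | 0 => h
  | t + 1 => A.H (joinStr (ancestor A dir v h t) (dir t, v t))

theorem ancestor_congr {A : Hashing ℓ} {dir dir' : ℕ → Bool} {v v' : ℕ → Digest ℓ} {h : Digest ℓ}
    {k : ℕ} (hd : ∀ t < k, dir t = dir' t) (hv : ∀ t < k, v t = v' t) :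
    ancestor A dir v h k = ancestor A dir' v' h k := by
  induction k with
  | zero => rfl
  | succ k ih =>
    rw [ancestor, ancestor, ih (fun t ht => hd t (by omega)) (fun t ht => hv t (by omega)),
      hd k (by omega), hv k (by omega)]

theorem climb_zip {A : Hashing ℓ} {h : Digest ℓ} {D : List Bool} {π : List (Digest ℓ)}
    (hl : π.length = D.length) (d : Digest ℓ) :
    climb A h (D.zip π) = ancestor A (fun t => D.getD t false) (fun t => π.getD t d) h D.length := by
  have key : ∀ k ≤ D.length, climb A h ((D.zip π).take k) =
      ancestor A (fun t => D.getD t false) (fun t => π.getD t d) h k := by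
    intro k hk
    induction k with
    | zero => rfl
    | succ k ih =>
      have h1 : k < D.length := hk
      have h2 : k < π.length := by omega
      rw [List.take_add_one, climb_append, ih (by omega), ancestor,
        List.getElem?_eq_getElem (by simp [h1, h2])]
      simp [climb, List.getD_eq_getElem?_getD, h1, h2]
  rw [← key _ le_rfl, List.take_of_length_le (by simp [hl])]

theorem memValid_iff {A : Hashing ℓ} {n i : ℕ} {h d : Digest ℓ} {π : List (Digest ℓ)} :
    MemValid A n i h π d ↔ π.length = (path n i).length ∧
      ancestor A (isLeft n i) (fun t => π.getD t A.dflt) h (path n i).length = d := by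
  refine and_congr_right fun hl => ?_
  rw [oriented, climb_zip (by simpa using hl) A.dflt, List.length_map]
  rfl

/-- Compute the parameters of the path of an item. The word cells `2, 3, 5` contain the number of
items, the index of the item, and the old range ends; the new range ends are written to `12`, and the
heights at which left siblings occur to `13` and `14`. -/
def pathCmd : Cmd :=
  assign 8 (var 2 + 1) ++ (assign 16 (.log2 (var 8 - var 3)) ++
  (assign 15 (var 16 + ltE ((var 3 - 1) >>> var 16 + 1) (var 8 >>> var 16) - 1) ++
  (assign 13 (var 15 + (var 8 >>> var 15) % 2) ++
  (assign 12 ((maskE 8 >>> (1 : Expr)) % ((1 : Expr) <<< var 15)) ++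
  (assign 14 (var 13 + (var 15 - .log2 (2 * var 12)) + 1) ++
  assign 7 (var 12 ^^^ (var 12 &&& var 5)))))))

theorem endsOf_le (N i : ℕ) : endsOf N i ≤ N :=
  (Nat.mod_le _ _).trans ((Nat.shiftRight_le _ _).trans (endMask_le N))

theorem onesDiff_le (x y : ℕ) : onesDiff x y ≤ x := xor_and_le x y

theorem pathCmd_pre {n i S : ℕ} (hi : 1 ≤ i) (hn : i ≤ n) (h1 : 100 * (n + 3) ≤ E.bound)
    (h2 : 20 ≤ E.space) {s : St ℓ} (w2 : s.words 2 = n) (w3 : s.words 3 = i)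
    (w5 : s.words 5 = S) (hS : S ≤ n + 1) {Q : St ℓ → Prop}
    (hQ : ∀ s' : St ℓ, (∀ k, k < 7 → s'.words k = s.words k) →
      s'.digs = s.digs → s'.inbox = s.inbox → s'.words 7 = onesDiff (endsOf (n + 1) i) S →
      s'.words 12 = endsOf (n + 1) i → s'.words 13 = heightOf (n + 1) i →
      s'.words 14 = heightOf (n + 1) i + rightOf (n + 1) i + 1 → Q s') :
    pathCmd.Pre E Q s := by
  obtain ⟨-, hp, -⟩ := pathLen_le hi hn
  have hlog : Nat.log 2 (n + 1) ≤ n + 1 := Nat.log_le_self _ _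
  have hlog' : Nat.log 2 (n + 1 - i) ≤ Nat.log 2 (n + 1) := Nat.log_mono_right (Nat.sub_le _ _)
  have hpe : (1 : ℕ) <<< mountainOf (n + 1) i ≤ n + 1 := by
    rw [Nat.shiftLeft_eq, Nat.one_mul]
    exact (Nat.pow_le_pow_right (by norm_num) hp.le).trans (Nat.pow_log_le_self 2 (by omega))
  have hse := endsOf_le (n + 1) i
  have hle : Nat.log 2 (2 * endsOf (n + 1) i) ≤ 2 * endsOf (n + 1) i := Nat.log_le_self _ _
  have hsh : (i - 1) >>> Nat.log 2 (n + 1 - i) ≤ i - 1 := Nat.shiftRight_le _ _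
  simp only [pathCmd, pre_append]
  rw [pre_assign]
  refine ⟨by omega, by omega, by simp [w2]; omega, ?_⟩
  rw [pre_assign]
  refine ⟨by omega, by omega, by simp [w2, w3]; omega, ?_⟩
  rw [pre_assign]
  refine ⟨by omega, by omega, ?_, ?_⟩
  · simp [w2, w3]
    split <;> omega
  have e15 : (var 16 + ltE ((var 3 - 1) >>> var 16 + 1) (var 8 >>> var 16) - 1 : Expr).val
      ((s.setWord 8 ((var 2 + 1 : Expr).val s)).setWord 16
        ((Expr.log2 (var 8 - var 3)).val (s.setWord 8 ((var 2 + 1 : Expr).val s)))) =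
      mountainOf (n + 1) i := by
    simp [w2, w3, mountainOf]
  rw [e15, pre_assign]
  refine ⟨by omega, by omega, by simp [w2]; omega, ?_⟩
  rw [pre_assign]
  have k := fun s : St ℓ => maskE_spec (E := E) (s := s) (w := 8) (N := n + 1) (by omega)
    (by omega) (by omega) (by omega)
  have e12 : ∀ s : St ℓ, s.words 8 = n + 1 → s.words 15 = mountainOf (n + 1) i →
      ((maskE 8 >>> (1 : Expr)) % ((1 : Expr) <<< var 15)).val s = endsOf (n + 1) i := by
    intro s w8 w15
    rw [val_mod, val_shr, val_shl, (k s w8).2, endsOf, endsBelow, val_var, w15, val_ofNat,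
      Nat.shiftLeft_eq, Nat.one_mul]
  refine ⟨by omega, by omega, ?_, ?_⟩
  · rw [ok_mod, ok_shr]
    refine ⟨⟨(k _ (by simp [w2])).1, by simp; omega⟩, ?_⟩
    simp
    omega
  rw [e12 _ (by simp [w2]) (by simp), pre_assign]
  refine ⟨by omega, by omega, by simp [w2]; omega, ?_⟩
  rw [pre_assign]
  refine ⟨by omega, by omega, ?_, hQ _ (fun k hk => ?_) rfl rfl ?_ ?_ ?_ ?_⟩
  · have := onesDiff_le (endsOf (n + 1) i) S
    rw [onesDiff] at this
    simp [w5]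
    omega
  · simp [show k ≠ 7 by omega, show k ≠ 8 by omega, show k ≠ 12 by omega, show k ≠ 13 by omega,
      show k ≠ 14 by omega, show k ≠ 15 by omega, show k ≠ 16 by omega]
  · simp [w5, onesDiff]
  · simp
  · simp [w2, heightOf]
  · simp [w2, heightOf, rightOf, rangeEnd, endsOf]

/-- Remove the highest one from the word in the cell `7`. -/
def shrinkE : Expr := var 7 % ((1 : Expr) <<< Expr.log2 (var 7))

/-- Pass through the ones of the word in the cell `7`, and change the counter in the cell `6`. -/
def countLoop (e : Expr) : Cmd :=
  .loop (var 7) (assign 7 (shrinkE) ++ assign 6 e)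

theorem countLoop_runs {e : Expr} (he : e.size ≤ 5) (h2 : 20 ≤ E.space) {x : ℕ} {s : St ℓ}
    (h1 : 100 + x < E.bound) (w7 : s.words 7 = x) (g : ℕ → ℕ) (hg : s.words 6 = g (ones x).card)
    (hok : ∀ k (s' : St ℓ), k < (ones x).card → s'.words 6 = g (k + 1) →
      e.Ok E s' ∧ e.val s' = g k) :
    RunsIn E (countLoop e) s (50 * (ones x).card + 50) fun s' =>
      (∀ k, k ≠ 6 → k ≠ 7 → s'.words k = s.words k) ∧ s'.digs = s.digs ∧ s'.inbox = s.inbox ∧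
      s'.words 6 = g 0 := by
  have key := RunsIn.loop (E := E) (by omega) (e := var 7)
    (P := assign 7 (shrinkE) ++ assign 6 e) (T := 25)
    (fun k s' => k ≤ (ones x).card ∧ (ones (s'.words 7)).card = k ∧ s'.words 7 ≤ x ∧
      (∀ k, k ≠ 6 → k ≠ 7 → s'.words k = s.words k) ∧ s'.digs = s.digs ∧ s'.inbox = s.inbox ∧
      s'.words 6 = g k) ?_ ?_ (ones x).card s
    ⟨le_rfl, by rw [w7], w7.le, fun _ _ _ => rfl, rfl, rfl, hg⟩
  · refine key.mono ?_ fun s' h' => ⟨h'.2.2.2.1, h'.2.2.2.2.1, h'.2.2.2.2.2.1, h'.2.2.2.2.2.2⟩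
    have hcost : 1 + (var 7).size + 25 ≤ 50 := Nat.le_of_ble_eq_true rfl
    have := Nat.mul_le_mul_left (ones x).card hcost
    omega
  · rintro k s' ⟨hk, hc, hx, hw, hd, hin, h6⟩
    have h0 : s'.words 7 ≠ 0 := by
      intro h; rw [h] at hc; simp [ones] at hc
    have hsh := shiftLeft_log_le (N := s'.words 7) (by omega)
    have hcost : (assign 7 (shrinkE) ++ assign 6 e).cost =
      1 + 1 + 8 + (1 + 1 + e.size) := rfl
    refine ⟨by simp; omega, by simpa using h0, (runsIn_of_pre (by omega)
      (pre_of_forall fun Q hQ => ?_)).mono (by rw [hcost]; omega) fun _ h => h⟩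
    rw [pre_append, pre_assign]
    refine ⟨by omega, by omega, by simp [shrinkE]; omega, ?_⟩
    rw [pre_assign]
    obtain ⟨o1, o2⟩ := hok k (s'.setWord 7 (shrinkE.val s'))
      (by omega) (by simpa using h6)
    refine ⟨by omega, by omega, o1, hQ _ ⟨by omega, ?_, ?_, fun t t1 t2 => ?_, hd, hin, ?_⟩⟩
    · have := ones_mod_log h0
      simp [shrinkE, Nat.shiftLeft_eq]
      omega
    · simp [shrinkE]
      exact (Nat.mod_le _ _).trans hx
    · simp [t1, t2, hw t t1 t2]
    · simp [o2]
  · rintro s' ⟨hk, hc, hx, hw, hd, hin, h6⟩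
    have h0 : s'.words 7 = 0 := by
      by_contra h
      have := ones_mod_log h
      omega
    exact ⟨by simp; omega, by simpa using h0⟩

/-- The direction of the sibling with the index in the word cell `11`. -/
def dirE : Expr :=
  ltE (var 11) (var 13) * (((var 3 - 1) >>> var 11) % 2) + eqE (var 11) (var 13) +
    eqE (var 11) (var 14)

/-- Receive one sibling and compute the next ancestor. -/
def climbBody : Cmd :=
  fetchTo (4 + 2 * var 11) ++
  (.ite dirE (.hash (5 + 2 * var 11) (4 + 2 * var 11) (3 + 2 * var 11))
    (.hash (5 + 2 * var 11) (3 + 2 * var 11) (4 + 2 * var 11)) ++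
  assign 11 (var 11 + 1))

/-- Compute all ancestors above the kept ones. -/
def climbLoop : Cmd := .loop (ltE (var 11) (var 4)) climbBody

theorem climbLoop_runs {n i len k : ℕ} (hi : 1 ≤ i) (hn : i ≤ n) (h1 : 100 * (n + 3) ≤ E.bound)
    (h2 : 2 * len + 20 < E.space) (hlen : len ≤ 10 * (n + 1)) {s : St ℓ} {h : Digest ℓ}
    {v : ℕ → Digest ℓ} {μ : List (Digest ℓ)} (hk : k ≤ len) (w3 : s.words 3 = i)
    (w4 : s.words 4 = len) (w11 : s.words 11 = k) (w13 : s.words 13 = heightOf (n + 1) i)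
    (w14 : s.words 14 = heightOf (n + 1) i + rightOf (n + 1) i + 1) (hw13 : s.words 13 ≤ 5 * n + 5)
    (hw14 : s.words 14 ≤ 5 * n + 5) (hr : Received μ 0 s)
    (hv : ∀ t, k ≤ t → v t = μ.getD (t - k) E.A.dflt)
    (hd4 : ∀ t, t < k → s.digs (4 + 2 * t) = v t)
    (hd3 : ∀ t, t ≤ k → s.digs (3 + 2 * t) = ancestor E.A (isLeft n i) v h t) :
    RunsIn E climbLoop s (200 * (len - k) + 200) fun s' =>
      (∀ k, k ≠ 9 → k ≠ 10 → k ≠ 11 → s'.words k = s.words k) ∧ Received μ (len - k) s' ∧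
      (∀ t, t < len → s'.digs (4 + 2 * t) = v t) ∧
      (∀ t, t ≤ len → s'.digs (3 + 2 * t) = ancestor E.A (isLeft n i) v h t) ∧
      s'.digs 1 = s.digs 1 := by
  have key := RunsIn.loop (E := E) (by omega) (e := ltE (var 11) (var 4)) (P := climbBody)
    (T := climbBody.cost) (fun d s' => ∃ j, j + d = len ∧ k ≤ j ∧ s'.words 11 = j ∧
      (∀ k, k ≠ 9 → k ≠ 10 → k ≠ 11 → s'.words k = s.words k) ∧ Received μ (j - k) s' ∧
      (∀ t, t < j → s'.digs (4 + 2 * t) = v t) ∧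
      (∀ t, t ≤ j → s'.digs (3 + 2 * t) = ancestor E.A (isLeft n i) v h t) ∧
      s'.digs 1 = s.digs 1) ?_ ?_ (len - k) s
    ⟨k, by omega, le_rfl, w11, fun _ _ _ _ => rfl, by simpa using hr, hd4, hd3, rfl⟩
  · refine key.mono ?_ ?_
    · have hcost : 1 + (ltE (var 11) (var 4)).size + climbBody.cost ≤ 200 :=
        Nat.le_of_ble_eq_true rfl
      have := Nat.mul_le_mul_left (len - k) hcost
      omega
    · rintro s' ⟨j, hj, -, h11, hw, hr, h4, h3, h1⟩
      obtain rfl : j = len := by omega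
      exact ⟨hw, hr, h4, h3, h1⟩
  · rintro d s' ⟨j, hj, hkj, h11, hw, hr, h4, h3, hd1⟩
    have v3 : s'.words 3 = i := by rw [hw 3 (by omega) (by omega) (by omega), w3]
    have v4 : s'.words 4 = len := by rw [hw 4 (by omega) (by omega) (by omega), w4]
    have v13 := hw 13 (by omega) (by omega) (by omega)
    have v14 := hw 14 (by omega) (by omega) (by omega)
    refine ⟨by simp [h11, v4]; omega, by simp [h11, v4]; omega, runsIn_of_pre (by omega)
      (pre_of_forall fun Q hQ => ?_)⟩
    rw [climbBody, pre_append]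
    refine fetchTo_received (p := 4 + 2 * j) (by omega) (by omega) hr (by simp [h11]; omega)
      (by simp [h11]) (by simp [h11]; omega) (by simp [h11]) (by omega) fun s1 hw1 hd hc hr1 => ?_
    have x11 : s1.words 11 = j := by rw [hw1 11 (by omega) (by omega), h11]
    have x3 : s1.words 3 = i := by rw [hw1 3 (by omega) (by omega), v3]
    have x13 : s1.words 13 = s.words 13 := by rw [hw1 13 (by omega) (by omega), v13]
    have x14 : s1.words 14 = s.words 14 := by rw [hw1 14 (by omega) (by omega), v14]
    have hvj : s1.digs (4 + 2 * j) = v j := by rw [hc, hv j hkj]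
    have haj : s1.digs (3 + 2 * j) = ancestor E.A (isLeft n i) v h j := by
      rw [hd _ (by omega), h3 j le_rfl]
    have hdir : dirE.Ok E s1 ∧ (dirE.val s1 ≠ 0 ↔ isLeft n i j = true) := by
      have hm : ((i - 1) >>> j) % 2 < 2 := Nat.mod_lt _ (by omega)
      constructor
      · simp [dirE, x11, x3, x13, x14]
        generalize ((i - 1) >>> j) % 2 = z at *
        split <;> split <;> split <;> omega
      · rw [(path_spec hi hn).2.1 j]
        simp only [dirE, val_add, val_mul, val_lt, val_eq, val_var, val_mod, val_shr, val_sub,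
          val_ofNat, x11, x3, x13, x14]
        rw [← w13]
        rw [show s.words 13 + rightOf (n + 1) i + 1 = s.words 14 by omega]
        generalize ((i - 1) >>> j) % 2 = z at *
        have hlt : s.words 13 < s.words 14 := by omega
        by_cases c1 : j < s.words 13
        · rw [if_pos c1, if_pos c1, if_neg (by omega), if_neg (by omega)]
          omega
        · rw [if_neg c1, if_neg c1]
          by_cases c2 : j = s.words 13 <;> by_cases c3 : j = s.words 14 <;> simp [c2, c3]
    -- both branches hash the sibling and the last ancestor, in the order given by the direction
    have hbranch : (Cmd.ite dirE (.hash (5 + 2 * var 11) (4 + 2 * var 11) (3 + 2 * var 11))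
        (.hash (5 + 2 * var 11) (3 + 2 * var 11) (4 + 2 * var 11))).Pre E
        (fun s2 => s2 = s1.setDig (5 + 2 * j) (ancestor E.A (isLeft n i) v h (j + 1))) s1 := by
      rw [pre_ite]
      refine ⟨hdir.1, fun h0 => ?_, fun h0 => ?_⟩
      · have := hdir.2.1 h0
        simp [x11, ancestor, joinStr, this, hvj, haj]
        omega
      · have : isLeft n i j = false := by
          rw [← Bool.not_eq_true, ← hdir.2]; exact not_not.2 h0
        simp [x11, ancestor, joinStr, this, hvj, haj]
        omega
    rw [pre_append]
    refine Cmd.Pre.mono hbranch ?_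
    rintro s2 rfl
    rw [pre_assign]
    refine ⟨by omega, by omega, by simp [x11]; omega, hQ _ ⟨j + 1, by omega, by omega, by simp [x11],
      fun t t1 t2 t3 => ?_, ?_, fun t ht => ?_, fun t ht => ?_, ?_⟩⟩
    · simp [t3, hw1 t t1 t2, hw t t1 t2 t3]
    · rw [show j + 1 - k = j - k + 1 by omega]
      exact ⟨hr1.1, by simpa using hr1.2⟩
    · rw [digs_setWord, digs_setDig, if_neg (by omega)]
      rcases Nat.lt_or_ge t j with h | h
      · rw [hd _ (by omega), h4 t h]
      · obtain rfl : t = j := by omega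
        exact hvj
    · rw [digs_setWord, digs_setDig]
      rcases Nat.lt_or_ge j t with h | h
      · obtain rfl : t = j + 1 := by omega
        rw [if_pos (by omega)]
      · rw [if_neg (by omega), hd _ (by omega), h3 t h]
    · rw [digs_setWord, digs_setDig, if_neg (by omega), hd _ (by omega), hd1]
  · rintro s' ⟨j, hj, hkj, h11, hw, hr, h4, h3, hd1⟩
    have v4 : s'.words 4 = len := by rw [hw 4 (by omega) (by omega) (by omega), w4]
    exact ⟨by simp [h11, v4]; omega, by simp [h11, v4]; omega⟩

end

/-! ### Updates of membership proofs -/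

section

variable {ℓ : ℕ} {E : Env ℓ}

/-- Compute the length of the path and the number of siblings that are kept, and store the new
parameters. -/
def keepCmd : Cmd :=
  assign 4 (var 14 + 1 + var 6) ++ (assign 11 (var 4 - 12 * (Expr.log2 (var 2 - var 1) + 1)) ++
  (assign 5 (var 12) ++ (assign 1 (var 2) ++ assign 9 1)))

/-- Compare the value that has been computed for the root with the commitment, and check the length of
the message. -/
def acceptCmd : Cmd :=
  .recv 0 10 ++ assign 0 (var 9 * eqE (var 10) 0 * .sameHash (3 + 2 * var 4) 1)

theorem acceptCmd_pre (h1 : 20 < E.bound) (h2 : 20 < E.space) {k len : ℕ} {π : List (Digest ℓ)}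
    {s : St ℓ} (hr : Received π k s) (w4 : s.words 4 = len) (h3 : 3 + 2 * len < E.space)
    (h4 : 3 + 2 * len < E.bound) :
    acceptCmd.Pre E (fun s' => (s'.words 0 = 1 ↔ π.length = k ∧ s.digs (3 + 2 * len) = s.digs 1) ∧
      (∀ t, t ≠ 0 → t ≠ 10 → s'.words t = s.words t) ∧ (∀ t, t ≠ 0 → s'.digs t = s.digs t)) s := by
  obtain ⟨h5, h6⟩ := hr
  simp only [acceptCmd, pre_append, pre_recv, pre_assign, ok_ofNat, val_ofNat]
  repeat refine ⟨by omega, ?_⟩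
  have b : ∀ t, t < 11 → t < E.bound := fun t ht => by omega
  have l : ∀ t, t < 11 → t < E.space := fun t ht => by omega
  have h7 : 2 * len < E.bound := by omega
  have h8 : len < E.bound := by omega
  rcases Nat.lt_or_ge k π.length with hl | hl
  · rw [List.drop_eq_getElem_cons hl] at h5
    rw [St.receive, h5]
    rw [if_pos hl.le] at h6
    have : π.length ≠ k := by omega
    simp +contextual [*]
  · rw [List.drop_eq_nil_of_le hl] at h5
    rw [St.receive, h5]
    by_cases hlen : k ≤ π.length
    · rw [if_pos hlen] at h6
      have : π.length = k := by omega
      by_cases e1 : s.digs (3 + 2 * len) = s.digs 1 <;> simp +contextual [*]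
    · rw [if_neg hlen] at h6
      have : π.length ≠ k := by omega
      by_cases e1 : s.digs (3 + 2 * len) = s.digs 1 <;> simp +contextual [*]

/-- The program for updates of membership proofs. For a new proof, it is used with no old one. -/
def updateMemCmd : Cmd :=
  pathCmd ++ (countLoop (var 6 + 1) ++ (assign 7 (var 5 ^^^ (var 5 &&& var 12)) ++
    (countLoop (var 6 - 1) ++ (keepCmd ++ (climbLoop ++ acceptCmd)))))

/-- The state of a participant with the membership proof `π`. Besides the proof, the hashes of all
ancestors of the leaf and the range ends to the right of it are stored. -/
structure MemState (A : Hashing ℓ) (n i : ℕ) (h d : Digest ℓ) (π : List (Digest ℓ)) (s : St ℓ) :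
    Prop where
  valid : MemValid A n i h π d
  stores : Stores s π
  size : s.words 1 = n
  item : s.words 3 = i
  ends : s.words 5 = endsOf (n + 1) i
  count : s.words 6 = (ones (endsOf (n + 1) i)).card
  ancestors : ∀ j ≤ π.length,
    s.digs (3 + 2 * j) = ancestor A (isLeft n i) (fun t => π.getD t A.dflt) h j

theorem updateMemCmd_runs {m n i S B k : ℕ} (hi : 1 ≤ i) (hn : i ≤ n) (hmn : m ≤ n)
    (h1 : 100 * (n + 3) ≤ E.bound) (h2 : 20 * (Nat.log 2 (n + 1) + 3) ≤ E.space) {s : St ℓ}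
    {h : Digest ℓ} {π : List (Digest ℓ)} (w1 : s.words 1 = m) (w2 : s.words 2 = n)
    (w3 : s.words 3 = i) (w5 : s.words 5 = S) (hS : S ≤ n + 1) (w6 : s.words 6 = (ones S).card)
    (hB : (ones (onesDiff (endsOf (n + 1) i) S)).card ≤ B)
    (hB' : (ones (onesDiff S (endsOf (n + 1) i))).card ≤ B)
    (hk : k = (path n i).length - 12 * lg (n - m)) (hkπ : k ≤ π.length)
    (hd4 : ∀ t, t < k → s.digs (4 + 2 * t) = π.getD t E.A.dflt)
    (hd3 : ∀ t, t ≤ k → s.digs (3 + 2 * t) =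
      ancestor E.A (isLeft n i) (fun t => π.getD t E.A.dflt) h t) :
    RunsIn E updateMemCmd s (1200 + 100 * B + 200 * ((path n i).length - k)) fun s' =>
      (s'.words 0 = 1 ↔ MemValid E.A n i h (π.take k ++ s.inbox) (s.digs 1)) ∧
      (s'.words 0 = 1 → MemState E.A n i h (s.digs 1) (π.take k ++ s.inbox) s') := by
  set μ := s.inbox with hμ
  set R := endsOf (n + 1) i with hR
  obtain ⟨hlen, -, -⟩ := path_spec hi hn
  obtain ⟨hl3, hpl, -⟩ := pathLen_le hi hn
  have hlog : Nat.log 2 (n + 1) ≤ n + 1 := Nat.log_le_self _ _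
  have hlog' : Nat.log 2 (n + 1 - i) ≤ Nat.log 2 (n + 1) := Nat.log_mono_right (Nat.sub_le _ _)
  have hlogm : Nat.log 2 (n - m) ≤ n - m := Nat.log_le_self _ _
  rw [lg] at hl3
  have hRn : R ≤ n + 1 := endsOf_le _ _
  have hpl2 : pathLen (n + 1) i = heightOf (n + 1) i + rightOf (n + 1) i + 2 + (ones R).card := rfl
  have hcard := card_ones_add S R
  have c1 := onesDiff_le R S
  have c2 := onesDiff_le S R
  have c3 := card_ones_le S
  have c4 := card_ones_le (onesDiff R S)
  set v : ℕ → Digest ℓ := fun t => (π.take k ++ μ).getD t E.A.dflt with hv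
  have hvlt : ∀ t, t < k → v t = π.getD t E.A.dflt := fun t ht => by
    simp only [hv, List.getD_eq_getElem?_getD]
    rw [List.getElem?_append_left (by simp; omega), List.getElem?_take_of_lt ht]
  have hvge : ∀ t, k ≤ t → v t = μ.getD (t - k) E.A.dflt := fun t ht => by
    simp only [hv, List.getD_eq_getElem?_getD]
    rw [List.getElem?_append_right (by simp; omega), List.length_take, Nat.min_eq_left hkπ]
  refine (RunsIn.seq (T := 300) (U := 900 + 100 * B + 200 * ((path n i).length - k))
    (runsIn_of_pre (by omega) (pathCmd_pre hi hn h1 (by omega) w2 w3 w5 hS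
      (Q := fun s' => (∀ k, k < 7 → s'.words k = s.words k) ∧
        s'.digs = s.digs ∧ s'.inbox = μ ∧ s'.words 7 = onesDiff R S ∧ s'.words 12 = R ∧
        s'.words 13 = heightOf (n + 1) i ∧ s'.words 14 = heightOf (n + 1) i + rightOf (n + 1) i + 1)
      fun s' a1 a2 a3 a4 a5 a6 a7 => ⟨a1, a2, a3, a4, a5, a6, a7⟩) |>.mono
        (Nat.le_of_ble_eq_true rfl) fun _ h => h) fun s1 h => ?_).mono (by omega) fun _ h => h
  obtain ⟨a1, a2, a3, a4, a5, a6, a7⟩ := h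
  -- count the new range ends
  refine (RunsIn.seq (U := 800 + 50 * B + 200 * ((path n i).length - k))
    (countLoop_runs (e := var 6 + 1) (Nat.le_of_ble_eq_true rfl) (by omega) (by omega) a4
      (fun j => (ones S).card + ((ones (onesDiff R S)).card - j)) (by rw [a1 6 (by omega), w6]; simp)
      fun j s' hj h6 => ⟨by simp [h6]; omega, by simp [h6]; omega⟩)
    fun s2 h => ?_).mono (by omega) fun _ h => h
  obtain ⟨b1, b2, b3, b4⟩ := h
  simp only [Nat.sub_zero] at b4
  -- and subtract those that have disappeared
  have e5 : s2.words 5 = S := by rw [b1 5 (by omega) (by omega), a1 5 (by omega), w5]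
  have e12 : s2.words 12 = R := by rw [b1 12 (by omega) (by omega), a5]
  refine (RunsIn.seq (T := 50) (U := 700 + 50 * B + 200 * ((path n i).length - k))
    (Q := fun s' => s' = s2.setWord 7 (onesDiff S R))
    ((runsIn_of_pre (by omega) (pre_of_forall fun Q hQ => ?_)).mono
      (Nat.le_of_ble_eq_true rfl) fun _ h => h) fun s3 h => ?_).mono (by omega) fun _ h => h
  · rw [pre_assign]
    refine ⟨by omega, by omega, ?_, hQ _ (by simp [e5, e12, onesDiff])⟩
    rw [onesDiff] at c2
    simp [e5, e12]
    omega
  subst h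
  refine (RunsIn.seq (U := 600 + 200 * ((path n i).length - k))
    (countLoop_runs (e := var 6 - 1) (x := onesDiff S R) (Nat.le_of_ble_eq_true rfl) (by omega)
      (by omega) (by simp)
      (fun j => (ones R).card + j) (by simp [b4]; omega)
      fun j s' hj h6 => ⟨by simp [h6]; have := card_ones_le R; have := card_ones_le (onesDiff S R); omega,
        by simp [h6]⟩)
    fun s4 h => ?_).mono (by omega) fun _ h => h
  obtain ⟨d1, d2, d3, d4⟩ := h
  rw [Nat.add_zero] at d4
  have f : ∀ t, t < 6 → s4.words t = s.words t := fun t ht => by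
    rw [d1 t (by omega) (by omega), words_setWord, if_neg (by omega), b1 t (by omega) (by omega),
      a1 t (by omega)]
  have f' : ∀ t, 12 ≤ t → s4.words t = s1.words t := fun t ht => by
    rw [d1 t (by omega) (by omega), words_setWord, if_neg (by omega), b1 t (by omega) (by omega)]
  have fd : s4.digs = s.digs := by rw [d2, digs_setWord, b2, a2]
  have fi : s4.inbox = μ := by rw [d3, inbox_setWord, b3, a3]
  -- the parameters of the path
  refine (RunsIn.seq (T := 100) (U := 400 + 200 * ((path n i).length - k))
    (Q := fun s' => s'.words 1 = n ∧ s'.words 3 = i ∧ s'.words 4 = (path n i).length ∧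
      s'.words 5 = R ∧ s'.words 6 = (ones R).card ∧ s'.words 11 = k ∧
      s'.words 13 = heightOf (n + 1) i ∧ s'.words 14 = heightOf (n + 1) i + rightOf (n + 1) i + 1 ∧
      s'.digs = s.digs ∧ Received μ 0 s')
    ((runsIn_of_pre (by omega) (pre_of_forall fun Q hQ => ?_)).mono
      (Nat.le_of_ble_eq_true rfl) fun _ h => h) fun s5 h => ?_).mono (by omega) fun _ h => h
  · have g1 := (f 1 (by omega)).trans w1
    have g2 := (f 2 (by omega)).trans w2
    have g3 := (f 3 (by omega)).trans w3
    have g12 := (f' 12 (by omega)).trans a5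
    have g13 := (f' 13 (by omega)).trans a6
    have g14 := (f' 14 (by omega)).trans a7
    simp only [keepCmd, pre_append]
    rw [pre_assign]
    refine ⟨by omega, by omega, by simp [g14, d4]; omega, ?_⟩
    rw [pre_assign]
    refine ⟨by omega, by omega, by simp [g14, d4, g1, g2]; omega, ?_⟩
    rw [pre_assign]
    refine ⟨by omega, by omega, by simp [g12]; omega, ?_⟩
    rw [pre_assign]
    refine ⟨by omega, by omega, by simp [g2]; omega, ?_⟩
    rw [pre_assign]
    refine ⟨by omega, by omega, by simp; omega, hQ _ ⟨by simp [g2], by simp [g3], ?_,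
      by simp [g12], by simp [d4], ?_, by simp [g13], by simp [g14], fd, ?_⟩⟩
    · simp [g14, d4]; omega
    · rw [hk]; simp [g14, d4, g1, g2, lg]; omega
    · exact ⟨by simpa using fi, by simp⟩
  obtain ⟨i1, i3, i4, i5, i6, i11, i13, i14, id, ir⟩ := h
  have hanc : ∀ t, t ≤ k → s5.digs (3 + 2 * t) = ancestor E.A (isLeft n i) v h t := fun t ht => by
    rw [id, hd3 t ht]
    exact ancestor_congr (fun _ _ => rfl) fun u hu => (hvlt u (by omega)).symm
  refine (RunsIn.seq (U := 200)
    (climbLoop_runs (v := v) (h := h) hi hn h1 (by omega) (by omega) (by omega) i3 i4 i11 i13 i14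
      (by omega) (by omega) ir hvge (fun t ht => by rw [id, hd4 t ht, hvlt t ht]) hanc)
    fun s6 h => ?_).mono (by omega) fun _ h => h
  obtain ⟨j1, j2, j3, j4, j5⟩ := h
  have k4 : s6.words 4 = (path n i).length := by rw [j1 4 (by omega) (by omega) (by omega), i4]
  refine (runsIn_of_pre (by omega) (acceptCmd_pre (by omega) (by omega) j2 k4 (by omega)
    (by omega))).mono (Nat.le_of_ble_eq_true rfl) ?_
  rintro s7 ⟨l1, l2, l3⟩
  have hlenμ : (π.take k ++ μ).length = (path n i).length ↔ μ.length = (path n i).length - k := by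
    rw [List.length_append, List.length_take, Nat.min_eq_left hkπ]; omega
  have hval : s7.words 0 = 1 ↔ MemValid E.A n i h (π.take k ++ μ) (s.digs 1) := by
    rw [l1, memValid_iff, hlenμ, j4 _ le_rfl, j5, id]
  refine ⟨hval, fun h0 => ?_⟩
  have hv0 := hval.1 h0
  have hw : ∀ t, 1 ≤ t → t < 9 → s7.words t = s5.words t := fun t t1 t2 => by
    rw [l2 t (by omega) (by omega), j1 t (by omega) (by omega) (by omega)]
  refine ⟨hv0, ⟨?_, fun j hj => ?_⟩, ?_, ?_, ?_, ?_, fun j hj => ?_⟩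
  · rw [hw 4 (by omega) (by omega), i4, hv0.1]
  · rw [l3 _ (by omega), j3 j (by rw [← hv0.1]; exact hj)]
    simp [hv, List.getD_eq_getElem?_getD, List.getElem?_eq_getElem hj]
  · rw [hw 1 (by omega) (by omega), i1]
  · rw [hw 3 (by omega) (by omega), i3]
  · rw [hw 5 (by omega) (by omega), i5]
  · rw [hw 6 (by omega) (by omega), i6]
  · rw [l3 _ (by omega), j4 j (by rw [← hv0.1]; exact hj)]

/-- The program for the verification of new membership proofs. -/
def verifyMemCmd : Cmd :=
  (assign 1 0 ++ (assign 5 0 ++ (assign 6 0 ++ .copy 3 2))) ++ updateMemCmd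

theorem verifyMemCmd_runs {m n i : ℕ} (hm : m < i) (hn : i ≤ n)
    (h1 : 100 * (n + 3) ≤ E.bound) (h2 : 20 * (Nat.log 2 (n + 1) + 3) ≤ E.space) {s : St ℓ}
    {h : Digest ℓ} (w2 : s.words 2 = n) (w3 : s.words 3 = i) (d2 : s.digs 2 = h) :
    RunsIn E verifyMemCmd s (3000 * lg (n - m)) fun s' =>
      (s'.words 0 = 1 ↔ MemValid E.A n i h s.inbox (s.digs 1)) ∧
      (s'.words 0 = 1 → MemState E.A n i h (s.digs 1) s.inbox s') := by
  obtain ⟨hlen, -, -⟩ := path_spec (show 1 ≤ i by omega) hn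
  obtain ⟨hl3, hpl, hc⟩ := pathLen_le (show 1 ≤ i by omega) hn
  have hlog : Nat.log 2 (n + 1) ≤ n + 1 := Nat.log_le_self _ _
  have hmono : lg (n + 1 - i) ≤ lg (n - m) :=
    Nat.add_le_add_right (Nat.log_mono_right (by omega)) 1
  have hmono' : lg (n + 1 - i) ≤ lg (n - 0) :=
    Nat.add_le_add_right (Nat.log_mono_right (by omega)) 1
  have hlg : 1 ≤ lg (n - m) := by unfold lg; omega
  have hB : (ones (endsOf (n + 1) i)).card ≤ lg (n - m) := by
    have := mountainOf_le (n + 1) i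
    unfold lg at *
    omega
  have h0 : ones 0 = ∅ := rfl
  refine (RunsIn.seq (T := 100) (U := 1200 + 100 * lg (n - m) + 200 * ((path n i).length - 0))
    (Q := fun s' => s' = (((s.setWord 1 0).setWord 5 0).setWord 6 0).setDig 3 h)
    ((runsIn_of_pre (by omega) (pre_of_forall fun Q hQ => ?_)).mono
      (Nat.le_of_ble_eq_true rfl) fun _ h => h) fun s1 h => ?_).mono (by omega) fun _ h => h
  · simp only [pre_append, pre_assign, pre_copy, ok_ofNat, val_ofNat]
    repeat refine ⟨by omega, ?_⟩
    exact hQ _ (by simp [d2])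
  subst h
  refine (updateMemCmd_runs (m := 0) (S := 0) (B := lg (n - m)) (k := 0) (π := []) (h := h)
    (by omega) hn (Nat.zero_le _) h1 h2 (by simp) (by simp [w2]) (by simp [w3]) (by simp) (by omega) (by simp [h0])
    (by rw [ones_onesDiff, h0, Finset.sdiff_empty]; exact hB)
    (by rw [ones_onesDiff, h0, Finset.empty_sdiff]; exact Nat.zero_le _) (by omega) (by simp)
    (by omega) fun t ht => ?_).mono le_rfl fun s' h' => by simpa using h'
  obtain rfl : t = 0 := by omega
  simp [ancestor]

end

/-! ### The properties of the scheme -/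

section

variable {ℓ : ℕ}

/-- The programs and node sets of the scheme. -/
def protocol : Protocol where
  append := appendCmd
  fetch := .recv 1 0
  verifyMem := verifyMemCmd
  verifyInc := verifyIncCmd
  updateMem := updateMemCmd
  cover := coverNodes
  keep := keepLen

theorem one_le_lg (k : ℕ) : 1 ≤ lg k := Nat.le_add_left 1 _

theorem lg_mono {a b : ℕ} (h : a ≤ b) : lg a ≤ lg b := Nat.add_le_add_right (Nat.log_mono_right h) 1

theorem machine_bounds (A : Hashing ℓ) {c : ℕ} (hc : 1000 ≤ c) (n : ℕ) :
    100 * (n + 3) ≤ (env A c n).bound ∧ 20 * (Nat.log 2 (n + 1) + 3) ≤ (env A c n).space ∧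
    Nat.log 2 (n + 1) + 40 ≤ (env A c n).space := by
  obtain ⟨h1, h2⟩ := env_bounds A hc n
  have h3 : Nat.log 2 (n + 1) ≤ Nat.log 2 n + 1 := by
    rcases Nat.eq_zero_or_pos n with rfl | hn
    · simp
    · rw [← Nat.log_mul_base (by norm_num) (by omega)]
      exact Nat.log_mono_right (by omega)
  omega

theorem isCorrect_protocol (A : Hashing ℓ) : IsCorrect A protocol where
  leaves := leaves_mmb
  membership x _ _ h1 h2 := memValid_memProof A x h1 h2
  update x m n i h1 h2 h3 := by
    have h := (keepLen_spec h1 h2 h3).2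
    rw [protocol, memProof, memProof, ← List.map_take, h, List.map_take, List.take_append_drop]
  cover _ _ h1 h2 := isIncrementCover_coverNodes h1 h2
  increment x m n h1 h2 :=
    incValid_map (built_cover h1 h2).1 (built_cover h1 h2).2 (coverOld_subset m n)

theorem isSound_protocol (A : Hashing ℓ) : IsSound A protocol where
  membership _ _ _ _ _ _ _ _ _ h h' hy := membership_sound h h' hy
  increment _ _ m n _ h1 h2 h hxy :=
    increment_sound (built_cover h1 h2).1 (built_cover h1 h2).2 (coverOld_subset m n) h hxy

theorem fetchesCommitment_protocol (A : Hashing ℓ) {c : ℕ} (hc : 1000 ≤ c) {cc : ℕ → ℕ → ℕ}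
    (hcc : ∀ m n, m < n → 10 ≤ cc m n) : FetchesCommitment A protocol c cc := by
  intro x m n hmn
  have h := hcc m n hmn
  obtain ⟨h1, h2, -⟩ := machine_bounds A hc n
  refine ⟨by omega, fun s w2 hi => ?_⟩
  refine (runsIn_of_pre (P := .recv 1 0) (by omega) ?_).mono
    (le_trans (Nat.le_of_ble_eq_true rfl) h) fun _ h => h
  rw [pre_recv, St.receive]
  refine ⟨by simp; omega, by simp; omega, by simp; omega, by simp; omega, ?_⟩
  rw [hi]
  exact ⟨rfl, rfl⟩

theorem verifiesIncrement_protocol (A : Hashing ℓ) {c : ℕ} (hc : 1000 ≤ c) {cc : ℕ → ℕ → ℕ}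
    (hcc : ∀ m n, m < n → 5000 * lg (n - m) ≤ cc m n) : VerifiesIncrement A protocol c cc := by
  intro m n hm hmn
  have h := hcc m n hmn
  obtain ⟨h1, -, h2⟩ := machine_bounds A hc n
  refine ⟨(length_coverNodes hmn).trans (by omega), fun d d' π s w1 d0 => ?_⟩
  exact (verifyIncCmd_runs (E := env A c n) (s := s.load n d' π) hm hmn h1 h2 (d := d) (d' := d')
    (by simpa [St.load] using w1) (by simp [St.load]) (by simpa [St.load] using d0)
    (by simp [St.load])).mono h fun _ h => h

theorem verifiesMembership_protocol (A : Hashing ℓ) {c : ℕ} (hc : 1000 ≤ c) {cc : ℕ → ℕ → ℕ}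
    (hcc : ∀ m n, m < n → 3000 * lg (n - m) ≤ cc m n) :
    VerifiesMembership A protocol c cc (MemState A) := by
  intro m n i hm hn
  have h := hcc m n (by omega)
  obtain ⟨h1, h2, -⟩ := machine_bounds A hc n
  refine ⟨?_, fun hi d π s w3 d2 => ?_⟩
  · rw [(path_spec (by omega) hn).1]
    have h3 := (pathLen_le (show 1 ≤ i by omega) hn).1
    have h4 := lg_mono (show n + 1 - i ≤ n - m by omega)
    omega
  · have := verifyMemCmd_runs (E := env A c n) (s := s.load n d π) (h := hi) hm hn h1 h2
      (by simp [St.load]) (by simpa [St.load] using w3) (by simpa [St.load] using d2)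
    refine this.mono h fun s' h' => ?_
    simp only [St.load, Function.update_self] at h'
    exact h'

theorem updatesMembership_protocol (A : Hashing ℓ) {c : ℕ} (hc : 1000 ≤ c) {cc : ℕ → ℕ → ℕ}
    (hcc : ∀ m n, m < n → 5000 * lg (n - m) ≤ cc m n) :
    UpdatesMembership A protocol c cc (MemState A) := by
  intro m n i hi him hmn
  have h := hcc m n hmn
  have hlg := one_le_lg (n - m)
  obtain ⟨h1, h2, -⟩ := machine_bounds A hc n
  obtain ⟨k1, k2⟩ := keepLen_spec hi him hmn
  have hk : (path n i).length - keepLen m n i ≤ 12 * lg (n - m) := by rw [keepLen]; omega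
  refine ⟨hk.trans (by omega), fun hd d d' π μ s hs => ?_⟩
  obtain ⟨b1, b2⟩ := card_onesDiff_endsOf hi him hmn
  have hlen := hs.valid.1
  have hdir : ∀ t < keepLen m n i, isLeft m i t = isLeft n i t := fun t ht => by
    rw [isLeft, isLeft, List.getD_eq_getElem?_getD, List.getD_eq_getElem?_getD,
      List.getElem?_map, List.getElem?_map, ← List.getElem?_take_of_lt ht, k2,
      List.getElem?_take_of_lt ht]
  have := updateMemCmd_runs (E := env A c n) (s := s.load n d' μ) (m := m) (n := n) (i := i)
    (S := endsOf (m + 1) i) (B := lg (n - m) + 3) (k := keepLen m n i) (π := π) (h := hd) hi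
    (by omega) hmn.le h1 h2 (by simpa [St.load] using hs.size) (by simp [St.load])
    (by simpa [St.load] using hs.item) (by simpa [St.load] using hs.ends)
    ((endsOf_le _ _).trans (by omega)) (by simpa [St.load] using hs.count) b1 b2 rfl
    (by rw [hlen]; exact k1) (fun t ht => ?_) fun t ht => ?_
  · refine this.mono (by omega) fun s' h' => ?_
    simp only [St.load, Function.update_self] at h'
    exact h'
  · have h3 : t < π.length := by omega
    simp only [St.load]
    rw [Function.update_of_ne (by omega), hs.stores.2 t h3, List.getD_eq_getElem?_getD,
      List.getElem?_eq_getElem h3, Option.getD_some]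
  · simp only [St.load]
    rw [Function.update_of_ne (by omega), hs.ancestors t (by omega)]
    exact ancestor_congr (fun u hu => hdir u (by omega)) fun _ _ => rfl

end

end MMB

theorem theorem1 :
    ∃ (P : MMB.Protocol) (c : ℕ), ∀ (ℓ : ℕ) (A : MMB.Hashing ℓ),
      MMB.IsCorrect A P ∧ MMB.IsSound A P ∧
      MMB.IsSuccinct A P c ∧
      MMB.IsIncremental A P c (fun k => c * MMB.lg k) ∧
      MMB.IsOptimallyAdditive A P c ∧
      ∀ (x : ℕ → List Bool) (n : ℕ), (MMB.commitment A x n).toList.length = ℓ := by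
  obtain ⟨c, hc⟩ : ∃ c, 5000 ≤ c := ⟨5000, le_rfl⟩
  refine ⟨MMB.protocol, c, fun ℓ A => ?_⟩
  have hc' : 1000 ≤ c := by omega
  have hlin : ∀ a ≤ 5000, ∀ m n, m < n → a * MMB.lg (n - m) ≤ c * MMB.lg (n - m) :=
    fun a ha _ _ _ => Nat.mul_le_mul_right _ (ha.trans hc)
  -- the bounds in terms of the number of new items imply those in terms of the number of all items
  have hpow : ∀ a ≤ 5000, ∀ m n, m < n → a * MMB.lg (n - m) ≤ c * MMB.lg n ^ c :=
    fun a ha m n h => (hlin a ha m n h).trans (Nat.mul_le_mul_left _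
      ((MMB.lg_mono (Nat.sub_le n m)).trans (Nat.le_self_pow (by omega) _)))
  have h10 : ∀ m n, m < n → 10 ≤ 10 * MMB.lg (n - m) := fun m n _ => by
    have := MMB.one_le_lg (n - m)
    omega
  refine ⟨MMB.isCorrect_protocol A, MMB.isSound_protocol A, ⟨?_, ?_, ?_⟩, ⟨?_, ?_, MMB.MemState A,
    fun _ _ _ _ _ _ h => ⟨h.valid, h.stores⟩, ?_, ?_⟩, MMB.appends A rfl hc', fun x n => by simp⟩
  · exact MMB.fetchesCommitment_protocol A hc' fun m n h =>
      (h10 m n h).trans (hpow 10 (by norm_num) m n h)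
  · exact MMB.verifiesIncrement_protocol A hc' (hpow 5000 le_rfl)
  · intro m n i h1 h2
    obtain ⟨h3, h4⟩ := MMB.verifiesMembership_protocol A hc' (cc := fun _ n => c * MMB.lg n ^ c)
      (hpow 3000 (by norm_num)) m n i h1 h2
    exact ⟨h3, fun h d π s w d2 => (h4 h d π s w d2).mono le_rfl fun _ h => ⟨h.1, fun _ => trivial⟩⟩
  · exact MMB.fetchesCommitment_protocol A hc' fun m n h =>
      (h10 m n h).trans (hlin 10 (by norm_num) m n h)
  · exact MMB.verifiesIncrement_protocol A hc' (hlin 5000 le_rfl)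
  · exact MMB.verifiesMembership_protocol A hc' (hlin 3000 (by norm_num))
  · exact MMB.updatesMembership_protocol A hc' (hlin 5000 le_rfl)
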